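/- **Setting.** Let $1\le n\le N$ be integers and fix $v\in\mathbb R^N$. Let $Y\in\mathbb R^{N\times n}$ be a random matrix whose first column is $v$ and whose other $n-1$ columns are i.i.d. $\mathcal N(0,\frac1N I_N)$ vectors. Let $Q\in\mathbb R^{n\times n}$ be an arbitrary orthogonal matrix (it may even depend on $Y$), and observe $\tilde Y=YQ$, with rows $\tilde y_1^\top,\dots,\tilde y_N^\top$. Put $$\tilde M=\sum_{i=1}^N\Big(\|\tilde y_i\|^2-\frac{n-1}{N}\Big)\tilde y_i\tilde y_i^\top-\frac3N I_n ,$$ and let $\tilde u$ be a leading eigenvector of $\tilde M$, i.e. a unit eigenvector whose eigenvalue has the largest magnitude among the eigenvalues of $\tilde M$ (both bounds below hold simultaneously for every such $\tilde u$ and every $Q$, on an event of the stated probability). Here $\|\cdot\|$ is the Euclidean norm and $\|\cdot\|_p$ the $\ell_p$ norm. **Theorem (asymptotic form).** There are absolute constants $C_0,C_1>0$ and $N_0\in\mathbb N$ and a function $\omega:\mathbb N\to\mathbb R$ with $\omega(N)\to\infty$ as $N\to\infty$ such that for every $c>0$ there is a constant $K=K(c)>0$ with the following property. Let $N\ge N_0$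 and $1\le n\le N$, let $\|v\|=1$ and $\big|\|v\|_4^4-\frac3N\big|\ge\frac cN$, and suppose that $$\varepsilon:=\frac1{\|v\|_4^4}\frac n{N^{3/2}}+\frac{\|v\|_\infty}{\|v\|_4^2}\sqrt{\frac nN}\ \le\ \frac1{(\log N)^{C_0}} .$$ Then, with probability at least $1-N^{-\omega(N)}$, there is a single sign $s\in\{1,-1\}$ (depending on $\tilde u$) such that $$\big|\tilde y_j^\top(s\tilde u)-v_j\big|\le K(\log N)^{C_1}\,\varepsilon\Big(|v_j|+\frac1{\sqrt N}\Big)\qquad\text{for all }j\in\{1,\dots,N\}.$$ **Theorem (precise form).** There are universal constants $A,c,C>0$ and $N_0\in\mathbb N$ such that the following holds for all $N\ge N_0$, $1\le n\le N$, $v\in\mathbb R^N$ with $\|v\|_4^4\ne\frac3N$, and $\delta\in(0,1)$. Put $$\eta=A\bigg((\|v\|+1)\frac{n\sqrt{\log(N/\delta)}}{N^{3/2}}+\|v\|_4^2\frac{\sqrt{n\log(N/\delta)}}{N}+\|v\|_6^3\frac{\sqrt n+\sqrt{\log(N/\delta)}}{\sqrt N}+\|v\|_\infty^2\frac{n\log(N/\delta)+\log^2(N/\delta)}{N}+\frac{(n\log(N/\delta))^{3/2}}{N^2}+\frac1N\big|\|v\|^2-1\big|\bigg).$$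 If $N\ge\log^7(N/\delta)$ and $\eta\big/\big|\|v\|_4^4-\frac3N\big|\le c$, then, with probability at least $1-\delta$, there is a single sign $s\in\{1,-1\}$ (depending on $\tilde u$) such that $$\big|\tilde y_j^\top(s\tilde u)-v_j\big|\le\frac{C\,\eta}{\big|\|v\|_4^4-\frac3N\big|}\Big(|v_j|+\frac{\sqrt{\log(N/\delta)}}{\sqrt N}\Big)\qquad\text{for all }j\in\{1,\dots,N\}.$$ -/

import Mathlib

open MeasureTheory ProbabilityTheory Filter
open scoped NNReal ENNReal Matrix

noncomputable section

/-- The `ℓ^p` norm of a finite real vector (Mathlib's norm on `PiLp`). -/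
def ellNorm {k : ℕ} (p : ℝ≥0∞) (x : Fin k → ℝ) : ℝ :=
  ‖(WithLp.toLp p x : PiLp p fun _ : Fin k => ℝ)‖

/-- `Y` is a random `N × n` matrix whose first column is the fixed vector `v` and whose other
`n - 1` columns are i.i.d. `N(0, (1/N) I_N)` vectors; that is, all entries outside of the first
column are independent centred Gaussian variables of variance `1/N`. -/
structure IsGaussianBasis {Ω : Type*} [MeasurableSpace Ω] (μ : Measure Ω) {N n : ℕ}
    (v : Fin N → ℝ) (Y : Ω → Matrix (Fin N) (Fin n) ℝ) : Prop where
  first_column : ∀ ω i (k : Fin n), (k : ℕ) = 0 → Y ω i k = v i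
  gaussian : ∀ i (k : Fin n), (k : ℕ) ≠ 0 →
    HasLaw (fun ω => Y ω i k) (gaussianReal 0 (1 / (N : ℝ≥0))) μ
  indep : iIndepFun
    (fun (p : Fin N × {k : Fin n // (k : ℕ) ≠ 0}) (ω : Ω) => Y ω p.1 p.2) μ

/-- The matrix `∑ i, (‖y_i‖² - (n-1)/N) y_i y_iᵀ - (3/N) I_n`, where `y_iᵀ` is the `i`-th row
of the observed `N × n` matrix `A`. -/
def spectralMatrix {N n : ℕ} (A : Matrix (Fin N) (Fin n) ℝ) : Matrix (Fin n) (Fin n) ℝ :=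
  ∑ i, (ellNorm 2 (A i) ^ 2 - ((n : ℝ) - 1) / N) • Matrix.vecMulVec (A i) (A i)
    - (3 / (N : ℝ)) • (1 : Matrix (Fin n) (Fin n) ℝ)

/-- `u` is a leading eigenvector of `M`: a unit eigenvector whose eigenvalue has the largest
magnitude among all eigenvalues of `M`. -/
def IsLeadingEigenvector {n : ℕ} (M : Matrix (Fin n) (Fin n) ℝ) (u : Fin n → ℝ) : Prop :=
  ellNorm 2 u = 1 ∧ ∃ l : ℝ, M *ᵥ u = l • u ∧
    ∀ l' : ℝ, Module.End.HasEigenvalue (Matrix.toLin' M) l' → |l'| ≤ |l|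

/-- For every leading eigenvector `u` of the spectral matrix of the observed matrix `A` with rows
`y_jᵀ`, one global choice of the sign of `u` gives `|y_jᵀ u - v_j| ≤ r_j` for all `j`. -/
def EntrywiseClose {N n : ℕ} (A : Matrix (Fin N) (Fin n) ℝ) (v r : Fin N → ℝ) : Prop :=
  ∀ u : Fin n → ℝ, IsLeadingEigenvector (spectralMatrix A) u →
    ∃ s : ℝ, (s = 1 ∨ s = -1) ∧ ∀ j, |A j ⬝ᵥ (s • u) - v j| ≤ r j

/-- The quantity `ε = ‖v‖₄⁻⁴ n / N^{3/2} + (‖v‖_∞ / ‖v‖₄²) √(n/N)`. -/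
def epsRate {N : ℕ} (n : ℕ) (v : Fin N → ℝ) : ℝ :=
  1 / ellNorm 4 v ^ 4 * ((n : ℝ) / (N : ℝ) ^ (3 / 2 : ℝ))
    + ellNorm ∞ v / ellNorm 4 v ^ 2 * √((n : ℝ) / N)

/-- The quantity `η = η(N, n, v, δ)` with leading constant `A`. -/
def etaRate (A : ℝ) {N : ℕ} (n : ℕ) (v : Fin N → ℝ) (δ : ℝ) : ℝ :=
  A * ((ellNorm 2 v + 1) * ((n : ℝ) * √(Real.log (N / δ)) / (N : ℝ) ^ (3 / 2 : ℝ))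
    + ellNorm 4 v ^ 2 * (√((n : ℝ) * Real.log (N / δ)) / N)
    + ellNorm 6 v ^ 3 * ((√(n : ℝ) + √(Real.log (N / δ))) / √(N : ℝ))
    + ellNorm ∞ v ^ 2 * (((n : ℝ) * Real.log (N / δ) + Real.log (N / δ) ^ 2) / N)
    + ((n : ℝ) * Real.log (N / δ)) ^ (3 / 2 : ℝ) / (N : ℝ) ^ 2
    + 1 / (N : ℝ) * |ellNorm 2 v ^ 2 - 1|)

end

open scoped RealInnerProductSpace

/-! An orthogonal change of basis conjugates the spectral matrix (`EntrywiseClose.mul_orthogonal`),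
so it suffices to treat the original basis. Split each row as (v_i, g_i) with g_i = z_i/√N and z_i
standard Gaussian in dimension n - 1. The weight of the row is a_i = v_i² + X_i/N, where X_i =
‖z_i‖² - (n - 1), and the matrix has three blocks: the corner ∑ a_i v_i² - 3/N, the off-diagonal
vector β = ∑ a_i v_i g_i, and T = ∑ a_i g_i g_iᵀ - 3/N. The corner is close to λ = ‖v‖₄⁴ - 3/N.
Since X_i ⟪z_i, x⟫² has mean 2 for unit x (`integral_chiDev_mul_inner_sq`), the sum in T has mean
(‖v‖² + 2)/N, so that the shift 3/N cancels it up to (‖v‖² - 1)/N.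

Probability: with high probability |corner - λ|, ‖β‖ and ‖T‖ are all at most η. This is Bernstein's
inequality for sums over independent rows, followed by a union bound over a 1/2-net of the sphere.
The products X_i ⟪z_i, x⟫² are of degree four and lack exponential moments; therefore X_i is
truncated at a radius that, with high probability, no row exceeds. `RowEvents` collects the
resulting events, `measureReal_not_rowEvents_le` bounds the probability that one fails, and
`rate_bounds` compares the bounds with η.

Linear algebra (`exists_sign_entrywise_close`): the leading eigenvalue l satisfies |l| ≥ |λ| - η, so
the tail w of a unit eigenvector (u₁, w) has norm O(η/|λ|). This alone does not control the entries
⟪g_j, w⟫, because w depends on g_j. Delete row j from T and β: then l w = T_j w + u₁ β_j + a_j (v_j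
u₁ + ⟪g_j, w⟫) g_j. Expand w in a Neumann series. The vectors T_j^k β_j are independent of g_j, so
their inner products with g_j are smaller than Cauchy–Schwarz allows; the last term is controlled by
|a_j| ‖g_j‖² ≤ η and is partly absorbed.

The asymptotic form is the precise one at δ = N^(-log N), together with a crude bound for the
boundedly many N, depending on c, that it does not reach. -/

/-! ### Exponential moments of a squared Gaussian variable. -/

lemma gaussianReal_zero_one_eq :
    gaussianReal 0 1 = volume.withDensity
      (fun x => ENNReal.ofReal ((√(2 * Real.pi))⁻¹ * Real.exp (-x ^ 2 / 2))) := by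
  rw [gaussianReal_of_var_ne_zero _ one_ne_zero]
  congr 1
  ext x
  simp [gaussianPDF, gaussianPDFReal]

lemma integrable_exp_mul_sq_gaussianReal {s : ℝ} (hs : s < 1 / 2) :
    Integrable (fun x => Real.exp (s * x ^ 2)) (gaussianReal 0 1) := by
  rw [gaussianReal_zero_one_eq, integrable_withDensity_iff (by fun_prop)
    (ae_of_all _ fun x => ENNReal.ofReal_lt_top)]
  have h := (integrable_exp_neg_mul_sq (b := 1 / 2 - s) (by linarith)).mul_const (√(2 * Real.pi))⁻¹
  refine h.congr (ae_of_all _ fun x => ?_)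
  dsimp only
  rw [ENNReal.toReal_ofReal (by positivity)]
  rw [mul_comm, mul_comm (Real.exp (s * x ^ 2)), mul_assoc, ← Real.exp_add]
  congr 2
  ring

lemma integral_exp_mul_sq_gaussianReal {s : ℝ} (hs : s < 1 / 2) :
    ∫ x, Real.exp (s * x ^ 2) ∂(gaussianReal 0 1) = (√(1 - 2 * s))⁻¹ := by
  rw [integral_gaussianReal_eq_integral_smul one_ne_zero]
  have h := integral_gaussian (1 / 2 - s)
  have h2 : ∀ x : ℝ, gaussianPDFReal 0 1 x • Real.exp (s * x ^ 2) =
      (√(2 * Real.pi))⁻¹ * Real.exp (-(1 / 2 - s) * x ^ 2) := by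
    intro x
    simp only [gaussianPDFReal, NNReal.coe_one, mul_one, sub_zero, smul_eq_mul]
    rw [mul_assoc, ← Real.exp_add]
    congr 2
    ring
  simp_rw [h2]
  rw [integral_const_mul, h, ← Real.sqrt_inv, ← Real.sqrt_mul (by positivity), ← Real.sqrt_inv]
  congr 1
  have : (1 - 2 * s) ≠ 0 := by linarith
  have : (1 / 2 - s) ≠ 0 := by linarith
  have := Real.pi_ne_zero
  field_simp

/-- Squaring and writing t = 2s turns the claim into 1 ≤ (1 - t) exp(t + t²). For t ≤ 0 the tangent
line of exp suffices, since (1 - t)(1 + t + t²) = 1 - t³; for t ≥ 0 the quadratic Taylor bound is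
used. -/
lemma inv_sqrt_one_sub_le {s : ℝ} (hs : |s| ≤ 1 / 4) :
    (√(1 - 2 * s))⁻¹ ≤ Real.exp (s + 2 * s ^ 2) := by
  obtain ⟨h1, h2⟩ := abs_le.1 hs
  have key : 1 ≤ (1 - 2 * s) * Real.exp (2 * s + (2 * s) ^ 2) := by
    have hp : 0 < 1 - 2 * s := by linarith
    rcases le_total 0 s with h | h
    · have := Real.quadratic_le_exp_of_nonneg (x := 2 * s + (2 * s) ^ 2) (by positivity)
      nlinarith [mul_le_mul_of_nonneg_left this hp.le, mul_nonneg h h,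
        mul_nonneg (mul_nonneg h h) h, mul_nonneg (mul_nonneg h h) (sub_nonneg.2 h2),
        mul_nonneg (mul_nonneg (mul_nonneg h h) h) (sub_nonneg.2 h2),
        mul_nonneg (mul_nonneg (mul_nonneg (mul_nonneg h h) h) h) (sub_nonneg.2 h2)]
    · have := Real.add_one_le_exp (2 * s + (2 * s) ^ 2)
      nlinarith [mul_le_mul_of_nonneg_left this hp.le,
        mul_nonneg (sub_nonneg.2 h) (mul_nonneg (sub_nonneg.2 h) (sub_nonneg.2 h))]
  rw [← Real.sqrt_inv, Real.sqrt_le_left (Real.exp_pos _).le, ← Real.exp_nat_mul,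
    inv_le_iff_one_le_mul₀ (by linarith)]
  refine key.trans (le_of_eq ?_)
  rw [mul_comm]
  congr 2
  push_cast
  ring

lemma integral_exp_mul_sq_sub_one_gaussianReal_le {s : ℝ} (hs : |s| ≤ 1 / 4) :
    ∫ x, Real.exp (s * (x ^ 2 - 1)) ∂(gaussianReal 0 1) ≤ Real.exp (2 * s ^ 2) := by
  obtain ⟨h1, h2⟩ := abs_le.1 hs
  have : ∀ x : ℝ, Real.exp (s * (x ^ 2 - 1)) = Real.exp (-s) * Real.exp (s * x ^ 2) := by
    intro x
    rw [← Real.exp_add]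
    ring_nf
  simp_rw [this]
  rw [integral_const_mul, integral_exp_mul_sq_gaussianReal (by linarith)]
  calc _ ≤ Real.exp (-s) * Real.exp (s + 2 * s ^ 2) := by gcongr; exact inv_sqrt_one_sub_le hs
    _ = _ := by rw [← Real.exp_add]; ring_nf

/-- The centred squared norm `‖z‖² - dim E`. -/
noncomputable def chiDev (E : Type*) [NormedAddCommGroup E] [InnerProductSpace ℝ E] (z : E) : ℝ :=
  ‖z‖ ^ 2 - Module.finrank ℝ E

lemma measurable_chiDev {E : Type*} [NormedAddCommGroup E] [InnerProductSpace ℝ E]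
    [MeasurableSpace E] [BorelSpace E] : Measurable (chiDev E) := by
  unfold chiDev; fun_prop

lemma chiDev_neg {E : Type*} [NormedAddCommGroup E] [InnerProductSpace ℝ E] (z : E) :
    chiDev E (-z) = chiDev E z := by simp [chiDev]

lemma chiDev_sum_smul {E : Type*} [NormedAddCommGroup E] [InnerProductSpace ℝ E]
    {ι : Type*} [Fintype ι] (b : OrthonormalBasis ι ℝ E) (x : ι → ℝ) :
    chiDev E (∑ i, x i • b i) = ∑ i, (x i ^ 2 - 1) := by
  have h : ‖∑ i, x i • b i‖ ^ 2 = ∑ i, x i ^ 2 := by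
    have := b.sum_sq_norm_inner_right (∑ i, x i • b i)
    rw [← this]
    refine Finset.sum_congr rfl fun i _ => ?_
    rw [b.orthonormal.inner_right_fintype]
    simp
  rw [chiDev, h, Finset.sum_sub_distrib, Module.finrank_eq_card_basis b.toBasis]
  simp

/-! ### Moments of a standard Gaussian vector. -/

section stdGaussian

variable {E : Type*} [NormedAddCommGroup E] [InnerProductSpace ℝ E] [FiniteDimensional ℝ E]
  [MeasurableSpace E] [BorelSpace E]

lemma stdGaussian_map_inner {x : E} (hx : ‖x‖ = 1) :
    (stdGaussian E).map (fun z => ⟪z, x⟫) = gaussianReal 0 1 := by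
  have h := IsGaussian.map_eq_gaussianReal (μ := stdGaussian E) (innerSL ℝ x)
  rw [integral_strongDual_stdGaussian, variance_dual_stdGaussian] at h
  simp only [innerSL_apply_norm, hx, one_pow, Real.toNNReal_one] at h
  rw [← h]
  congr 1
  ext z
  simp [real_inner_comm]

lemma stdGaussian_map_neg : (stdGaussian E).map (fun z => -z) = stdGaussian E := by
  have := stdGaussian_map (LinearIsometryEquiv.neg ℝ (E := E))
  simpa using this

lemma integral_comp_inner_stdGaussian {x : E} (hx : ‖x‖ = 1) {f : ℝ → ℝ} (hf : Measurable f) :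
    ∫ z, f ⟪z, x⟫ ∂(stdGaussian E) = ∫ t, f t ∂(gaussianReal 0 1) := by
  rw [← stdGaussian_map_inner hx, integral_map (by fun_prop) (by fun_prop)]

lemma integrable_comp_inner_stdGaussian {x : E} (hx : ‖x‖ = 1) {f : ℝ → ℝ}
    (hf : Integrable f (gaussianReal 0 1)) :
    Integrable (fun z => f ⟪z, x⟫) (stdGaussian E) := by
  rw [← stdGaussian_map_inner hx] at hf
  exact hf.comp_measurable (by fun_prop)

lemma integrable_exp_mul_chiDev {s : ℝ} (hs : s < 1 / 2) :
    Integrable (fun z : E => Real.exp (s * chiDev E z)) (stdGaussian E) := by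
  rw [stdGaussian_eq_map_pi_orthonormalBasis (stdOrthonormalBasis ℝ E)]
  rw [integrable_map_measure ((measurable_chiDev.const_mul s).exp.aestronglyMeasurable)
    (Measurable.aemeasurable (by fun_prop))]
  have : ((fun z : E => Real.exp (s * chiDev E z)) ∘
      fun x : Fin (Module.finrank ℝ E) → ℝ => ∑ i, x i • stdOrthonormalBasis ℝ E i) =
      fun x => ∏ i, (Real.exp (-s) * Real.exp (s * x i ^ 2)) := by
    ext x
    simp only [Function.comp, chiDev_sum_smul, ← Real.exp_add, ← Real.exp_sum, Finset.mul_sum]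
    congr 1
    exact Finset.sum_congr rfl fun i _ => by ring
  rw [this]
  exact Integrable.fintype_prod (f := fun _ x => Real.exp (-s) * Real.exp (s * x ^ 2))
    fun _ => (integrable_exp_mul_sq_gaussianReal hs).const_mul _

lemma integral_exp_mul_chiDev_le {s : ℝ} (hs : |s| ≤ 1 / 4) :
    ∫ z : E, Real.exp (s * chiDev E z) ∂(stdGaussian E) ≤
      Real.exp (2 * s ^ 2 * Module.finrank ℝ E) := by
  rw [stdGaussian_eq_map_pi_orthonormalBasis (stdOrthonormalBasis ℝ E)]
  rw [integral_map (Measurable.aemeasurable (by fun_prop))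
    ((measurable_chiDev.const_mul s).exp.aestronglyMeasurable)]
  have : ∀ x : Fin (Module.finrank ℝ E) → ℝ,
      Real.exp (s * chiDev E (∑ i, x i • stdOrthonormalBasis ℝ E i)) =
      ∏ i, Real.exp (s * (x i ^ 2 - 1)) := by
    intro x
    rw [chiDev_sum_smul, ← Real.exp_sum, Finset.mul_sum]
  simp_rw [this]
  rw [integral_fintype_prod_eq_pow (f := fun x => Real.exp (s * (x ^ 2 - 1)))]
  calc _ ≤ (Real.exp (2 * s ^ 2)) ^ (Fintype.card (Fin (Module.finrank ℝ E))) := by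
        gcongr
        exact integral_exp_mul_sq_sub_one_gaussianReal_le hs
    _ = _ := by rw [← Real.exp_nat_mul]; simp; ring


lemma integral_sq_gaussianReal : ∫ x, x ^ 2 ∂(gaussianReal 0 1) = 1 := by
  have h := variance_fun_id_gaussianReal (μ := 0) (v := 1)
  rw [variance_of_integral_eq_zero (by fun_prop) integral_id_gaussianReal] at h
  simpa using h

lemma integral_pow_four_gaussianReal : ∫ x, x ^ 4 ∂(gaussianReal 0 1) = 3 := by
  have h := iteratedDeriv_mgf_zero (X := id) (μ := gaussianReal 0 1)
    (by rw [integrableExpSet_id_gaussianReal]; simp) 4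
  rw [mgf_id_gaussianReal] at h
  -- Differentiating p(t) exp(t²/2) replaces p by p' + X p, so the fourth derivative of the moment
  -- generating function takes four polynomial steps from p = 1.
  have e (p : Polynomial ℝ) : deriv (fun t => p.eval t * Real.exp (t ^ 2 / 2)) =
      fun t => (p.derivative + p * Polynomial.X).eval t * Real.exp (t ^ 2 / 2) := by
    ext t
    have h1 : HasDerivAt (fun t : ℝ => Real.exp (t ^ 2 / 2)) (Real.exp (t ^ 2 / 2) * t) t := by
      have := ((hasDerivAt_pow 2 t).div_const 2).exp
      convert this using 1
      simp
    rw [((p.hasDerivAt t).fun_mul h1).deriv]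
    simp
    ring
  have h0 : (fun t : ℝ => Real.exp (0 * t + ((1 : ℝ≥0) : ℝ) * t ^ 2 / 2)) =
      fun t => (1 : Polynomial ℝ).eval t * Real.exp (t ^ 2 / 2) := by
    ext t; simp
  rw [h0, iteratedDeriv_succ', e, iteratedDeriv_succ', e, iteratedDeriv_succ', e,
    iteratedDeriv_succ', e] at h
  simp at h
  rw [← h]
  norm_num

lemma integrable_pow_gaussianReal (k : ℕ) :
    Integrable (fun x => x ^ k) (gaussianReal 0 1) := by
  have h := (memLp_id_gaussianReal (μ := 0) (v := 1) k).integrable_norm_pow'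
  refine (integrable_norm_iff (by fun_prop)).1 (h.congr (ae_of_all _ fun x => ?_))
  simp

/-- The covariance of `‖z‖²` and `⟪z, x⟫²`, for a standard Gaussian `z` and a unit vector `x`. -/
lemma integral_chiDev_mul_inner_sq {x : E} (hx : ‖x‖ = 1) :
    ∫ z : E, chiDev E z * ⟪z, x⟫ ^ 2 ∂(stdGaussian E) = 2 := by
  classical
  have hd : 0 < Module.finrank ℝ E := by
    rw [Module.finrank_pos_iff_exists_ne_zero]
    exact ⟨x, fun h => by simp [h] at hx⟩
  let i₀ : Fin (Module.finrank ℝ E) := ⟨0, hd⟩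
  -- With x as a basis vector, ⟪z, x⟫ is a coordinate and `chiDev` is a sum of independent centred
  -- terms. Only the term of i₀ is correlated with ⟪z, x⟫², and it contributes 3 - 1.
  obtain ⟨b, hb⟩ := Orthonormal.exists_orthonormalBasis_extension_of_card_eq (𝕜 := ℝ)
    (ι := Fin (Module.finrank ℝ E)) (by simp) (v := fun _ => x) (s := {i₀})
    ⟨fun _ => hx, fun i j hij => (hij (Subsingleton.elim _ _)).elim⟩
  have hb0 : b i₀ = x := hb i₀ rfl
  rw [stdGaussian_eq_map_pi_orthonormalBasis b, integral_map (Measurable.aemeasurable (by fun_prop))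
    (Measurable.aestronglyMeasurable (measurable_chiDev.fun_mul (by fun_prop)))]
  have h1 : ∀ t : Fin (Module.finrank ℝ E) → ℝ, chiDev E (∑ i, t i • b i) *
      ⟪∑ i, t i • b i, x⟫ ^ 2 = ∑ i, (t i ^ 2 - 1) * t i₀ ^ 2 := by
    intro t
    rw [chiDev_sum_smul, ← hb0, real_inner_comm, b.orthonormal.inner_right_fintype, Finset.sum_mul]
  simp_rw [h1]
  have hint1 : Integrable (fun x : ℝ => x ^ 2 - 1) (gaussianReal 0 1) :=
    (integrable_pow_gaussianReal 2).sub (integrable_const 1)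
  have hI : ∫ x, (x ^ 2 - 1) ∂(gaussianReal 0 1) = 0 := by
    rw [integral_sub (integrable_pow_gaussianReal 2) (integrable_const 1), integral_sq_gaussianReal]
    simp
  have hint2 : Integrable (fun x : ℝ => (x ^ 2 - 1) * x ^ 2) (gaussianReal 0 1) := by
    have := (integrable_pow_gaussianReal 4).sub (integrable_pow_gaussianReal 2)
    refine this.congr (ae_of_all _ fun x => ?_)
    simp only [Pi.sub_apply]
    ring
  have hind : ∀ i, i ≠ i₀ → IndepFun (fun t : Fin (Module.finrank ℝ E) → ℝ => t i ^ 2 - 1)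
      (fun t => t i₀ ^ 2) (Measure.pi fun _ => gaussianReal 0 1) := by
    intro i hi
    have h := (iIndepFun_pi (μ := fun _ : Fin (Module.finrank ℝ E) => gaussianReal 0 1)
      (X := fun _ (x : ℝ) => x) (fun _ => by fun_prop)).indepFun hi
    exact h.comp (φ := fun x => x ^ 2 - 1) (ψ := fun x => x ^ 2) (by fun_prop) (by fun_prop)
  have hce : ∀ i (f : ℝ → ℝ), Measurable f →
      ∫ t, f (t i) ∂(Measure.pi fun _ : Fin (Module.finrank ℝ E) => gaussianReal 0 1) =
        ∫ y, f y ∂(gaussianReal 0 1) := fun i f hf =>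
    integral_comp_eval (X := fun _ => ℝ) hf.aestronglyMeasurable
  have hie : ∀ i (f : ℝ → ℝ), Integrable f (gaussianReal 0 1) →
      Integrable (fun t => f (t i))
        (Measure.pi fun _ : Fin (Module.finrank ℝ E) => gaussianReal 0 1) := fun i f hf =>
    integrable_comp_eval (X := fun _ => ℝ) (μ := fun _ => gaussianReal 0 1) (i := i) hf
  rw [integral_finsetSum, Finset.sum_eq_single i₀]
  · rw [hce i₀ (fun x : ℝ => (x ^ 2 - 1) * x ^ 2) (by fun_prop)]
    have h3 : ∀ x : ℝ, (x ^ 2 - 1) * x ^ 2 = x ^ 4 - x ^ 2 := fun x => by ring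
    simp_rw [h3]
    rw [integral_sub (integrable_pow_gaussianReal 4) (integrable_pow_gaussianReal 2),
      integral_pow_four_gaussianReal, integral_sq_gaussianReal]
    norm_num
  · intro i _ hi
    rw [(hind i hi).integral_fun_mul_eq_mul_integral
      (Measurable.aestronglyMeasurable (by fun_prop))
      (Measurable.aestronglyMeasurable (by fun_prop)),
      hce i (fun x : ℝ => x ^ 2 - 1) (by fun_prop), hI, zero_mul]
  · simp
  · intro i _
    by_cases hi : i = i₀
    · subst hi
      exact hie _ _ hint2
    · exact (hind i hi).integrable_mul
        (hie _ _ hint1)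
        (hie _ _ (integrable_pow_gaussianReal 2))

end stdGaussian

/-! ### Bernstein bounds for sums over independent rows. -/

/-- Bernstein's tail bound for a random variable whose moment generating function is
sub-Gaussian on the interval `[-1/b, 1/b]`. -/
lemma measureReal_abs_ge_le_of_mgf_le {Ω : Type*} [MeasurableSpace Ω] {μ : Measure Ω}
    [IsProbabilityMeasure μ] {S : Ω → ℝ} {V b s : ℝ} (hb : 0 < b) (hs : 0 < s)
    (h : ∀ θ, |θ| * b ≤ 1 → Integrable (fun ω => Real.exp (θ * S ω)) μ ∧
      ∫ ω, Real.exp (θ * S ω) ∂μ ≤ Real.exp (V * θ ^ 2)) :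
    μ.real {ω | 2 * √(V * s) + 2 * b * s ≤ |S ω|} ≤ 2 * Real.exp (-s) := by
  -- The minimiser √(s/V) of V θ² - 2θ√(Vs) is admissible unless V is at most s b²; in that case the
  -- endpoint 1/b works, thanks to the term 2bs.
  obtain ⟨θ, hθ, hθb, h1⟩ : ∃ θ, 0 ≤ θ ∧ |θ| * b ≤ 1 ∧
      V * θ ^ 2 - θ * (2 * √(V * s) + 2 * b * s) ≤ -s := by
    rcases le_or_gt V (s * b ^ 2) with hc | hc
    · refine ⟨1 / b, by positivity, ?_, ?_⟩
      · rw [abs_of_pos (by positivity)]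
        field_simp
        rfl
      · have h1 : V * (1 / b) ^ 2 ≤ s := by
          rw [one_div, inv_pow, ← div_eq_mul_inv, div_le_iff₀ (by positivity)]
          exact hc
        have h2 : 1 / b * (2 * √(V * s) + 2 * b * s) = 2 / b * √(V * s) + 2 * s := by
          field_simp
        have h3 : 0 ≤ 2 / b * √(V * s) := by positivity
        linarith
    · have hVp : 0 < V := lt_of_le_of_lt (by positivity) hc
      refine ⟨√(s / V), by positivity, ?_, ?_⟩
      · rw [abs_of_nonneg (by positivity)]
        have : √(s / V) * b = √(s / V * b ^ 2) := by
          rw [Real.sqrt_mul (by positivity), Real.sqrt_sq hb.le]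
        rw [this, Real.sqrt_le_left zero_le_one, one_pow, div_mul_eq_mul_div, div_le_one hVp]
        exact hc.le
      · have h2 : √(s / V) * √(V * s) = s := by
          rw [← Real.sqrt_mul (by positivity)]
          rw [show s / V * (V * s) = s ^ 2 by field_simp, Real.sqrt_sq hs.le]
        rw [Real.sq_sqrt (by positivity)]
        have h3 : V * (s / V) = s := by field_simp
        have h4 : 0 ≤ √(s / V) * (2 * b * s) := by positivity
        nlinarith
  have hup := measure_ge_le_exp_mul_mgf (X := S) (2 * √(V * s) + 2 * b * s) hθ (h θ hθb).1
  have hlo := measure_le_le_exp_mul_mgf (X := S) (-(2 * √(V * s) + 2 * b * s))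
    (neg_nonpos.2 hθ) (h (-θ) (by rwa [abs_neg])).1
  have e1 := (h θ hθb).2
  have e2 := (h (-θ) (by rwa [abs_neg])).2
  have hup' : μ.real {ω | 2 * √(V * s) + 2 * b * s ≤ S ω} ≤ Real.exp (-s) := by
    refine hup.trans ((mul_le_mul_of_nonneg_left e1 (Real.exp_pos _).le).trans ?_)
    rw [← Real.exp_add]
    exact Real.exp_le_exp.2 (by linarith)
  have hlo' : μ.real {ω | S ω ≤ -(2 * √(V * s) + 2 * b * s)} ≤ Real.exp (-s) := by
    refine hlo.trans ((mul_le_mul_of_nonneg_left e2 (Real.exp_pos _).le).trans ?_)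
    rw [← Real.exp_add]
    exact Real.exp_le_exp.2 (by rw [neg_sq]; linarith)
  calc μ.real {ω | 2 * √(V * s) + 2 * b * s ≤ |S ω|}
      ≤ μ.real ({ω | 2 * √(V * s) + 2 * b * s ≤ S ω} ∪
          {ω | S ω ≤ -(2 * √(V * s) + 2 * b * s)}) := by
        refine measureReal_mono fun ω hω => ?_
        simp only [Set.mem_ofPred_eq, Set.mem_union, le_abs] at hω ⊢
        exact hω.imp id (fun h => by linarith)
    _ ≤ _ := measureReal_union_le _ _
    _ ≤ 2 * Real.exp (-s) := by linarith

/-- Moment generating functions multiply over the product measure: the variance proxies add up to K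
∑ c_i², and the range of θ shrinks by the factor c₁. -/
lemma measureReal_abs_sum_ge_le {I E : Type*} [Fintype I] [MeasurableSpace E] {γ : Measure E}
    [IsProbabilityMeasure γ] {F : E → ℝ} {K b : ℝ} (hb : 0 < b)
    (h : ∀ θ, |θ| * b ≤ 1 → Integrable (fun z => Real.exp (θ * F z)) γ ∧
      ∫ z, Real.exp (θ * F z) ∂γ ≤ Real.exp (K * θ ^ 2))
    {c : I → ℝ} {c₁ s : ℝ} (hc₁ : 0 < c₁) (hc : ∀ i, |c i| ≤ c₁) (hs : 0 < s) :
    (Measure.pi fun _ : I => γ).real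
      {ω | 2 * √(K * (∑ i, c i ^ 2) * s) + 2 * (b * c₁) * s ≤ |∑ i, c i * F (ω i)|} ≤
      2 * Real.exp (-s) := by
  refine measureReal_abs_ge_le_of_mgf_le (by positivity) hs fun θ hθ => ?_
  have hθ' : ∀ i, |θ * c i| * b ≤ 1 := fun i => by
    rw [abs_mul]
    calc |θ| * |c i| * b ≤ |θ| * c₁ * b := by gcongr; exact hc i
      _ = |θ| * (b * c₁) := by ring
      _ ≤ 1 := hθ
  have he : ∀ ω : I → E, Real.exp (θ * ∑ i, c i * F (ω i)) =
      ∏ i, Real.exp (θ * c i * F (ω i)) := fun ω => by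
    rw [← Real.exp_sum, Finset.mul_sum]
    congr 1
    exact Finset.sum_congr rfl fun i _ => by ring
  simp_rw [he]
  refine ⟨Integrable.fintype_prod (f := fun i z => Real.exp (θ * c i * F z))
    fun i => (h _ (hθ' i)).1, ?_⟩
  rw [integral_fintype_prod_eq_prod (f := fun i z => Real.exp (θ * c i * F z))]
  calc ∏ i, ∫ z, Real.exp (θ * c i * F z) ∂γ ≤ ∏ i, Real.exp (K * (θ * c i) ^ 2) :=
        Finset.prod_le_prod (fun i _ => integral_nonneg fun _ => (Real.exp_pos _).le)
          fun i _ => (h _ (hθ' i)).2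
    _ = _ := by
        rw [← Real.exp_sum, mul_assoc, Finset.sum_mul, Finset.mul_sum]
        congr 1
        exact Finset.sum_congr rfl fun i _ => by ring

lemma exp_le_one_add_add_sq_mul_exp_abs (y : ℝ) :
    Real.exp y ≤ 1 + y + y ^ 2 * Real.exp |y| := by
  have h := Complex.norm_exp_sub_sum_le_norm_mul_exp (y : ℂ) 2
  have e : Complex.exp (y : ℂ) - ∑ m ∈ Finset.range 2, (y : ℂ) ^ m / (m.factorial : ℂ) =
      ((Real.exp y - (1 + y) : ℝ) : ℂ) := by
    simp [Finset.sum_range_succ]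
  rw [e, Complex.norm_real, Complex.norm_real, Real.norm_eq_abs, Real.norm_eq_abs, sq_abs] at h
  linarith [le_abs_self (Real.exp y - (1 + y))]

/-- A bound on the exponential moments of a centred variable by those of a dominating function. -/
lemma integrable_and_integral_exp_mul_sub_le {E : Type*} [MeasurableSpace E] {γ : Measure E}
    [IsProbabilityMeasure γ] {F Φ : E → ℝ} {θ K : ℝ} (hF : Measurable F) (hΦ : Integrable Φ γ)
    (hFΦ : ∀ z, F z ^ 2 * Real.exp |θ * F z| ≤ Φ z) (hK : ∫ z, Φ z ∂γ ≤ K) :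
    Integrable (fun z => Real.exp (θ * (F z - ∫ w, F w ∂γ))) γ ∧
      ∫ z, Real.exp (θ * (F z - ∫ w, F w ∂γ)) ∂γ ≤ Real.exp (K * θ ^ 2) := by
  have hF2 : ∀ z, F z ^ 2 ≤ Φ z := fun z =>
    le_trans (le_mul_of_one_le_right (sq_nonneg _) (Real.one_le_exp (abs_nonneg _))) (hFΦ z)
  have hFi : Integrable F γ := by
    refine ((integrable_const (1 : ℝ)).add hΦ).mono' hF.aestronglyMeasurable
      (ae_of_all _ fun z => ?_)
    have := hF2 z
    rw [Real.norm_eq_abs, Pi.add_apply]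
    nlinarith [sq_abs (F z), sq_nonneg (|F z| - 1), abs_nonneg (F z)]
  -- Taylor's bound to second order. The linear term cancels against the subtracted mean, which
  -- leaves θ² ∫ Φ.
  have hb : ∀ z, Real.exp (θ * F z) ≤ 1 + θ * F z + θ ^ 2 * Φ z := fun z => by
    have h1 := exp_le_one_add_add_sq_mul_exp_abs (θ * F z)
    have h2 := mul_le_mul_of_nonneg_left (hFΦ z) (by positivity : 0 ≤ θ ^ 2)
    nlinarith
  have hli : Integrable (fun z => 1 + θ * F z) γ := (integrable_const 1).add (hFi.const_mul θ)
  have hgi : Integrable (fun z => 1 + θ * F z + θ ^ 2 * Φ z) γ := hli.add (hΦ.const_mul _)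
  have hei : Integrable (fun z => Real.exp (θ * F z)) γ := by
    refine hgi.mono' (by fun_prop) (ae_of_all _ fun z => ?_)
    rw [Real.norm_eq_abs, Real.abs_exp]
    exact hb z
  have he : ∀ z, Real.exp (θ * (F z - ∫ w, F w ∂γ)) =
      Real.exp (-(θ * ∫ w, F w ∂γ)) * Real.exp (θ * F z) := fun z => by
    rw [← Real.exp_add]; ring_nf
  simp_rw [he]
  refine ⟨hei.const_mul _, ?_⟩
  rw [integral_const_mul]
  have h3 : ∫ z, Real.exp (θ * F z) ∂γ ≤ Real.exp (θ * ∫ w, F w ∂γ + K * θ ^ 2) := by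
    calc ∫ z, Real.exp (θ * F z) ∂γ ≤ ∫ z, (1 + θ * F z + θ ^ 2 * Φ z) ∂γ :=
          integral_mono hei hgi hb
      _ = 1 + θ * ∫ w, F w ∂γ + θ ^ 2 * ∫ z, Φ z ∂γ := by
          rw [integral_add hli (hΦ.const_mul _),
            integral_add (integrable_const _) (hFi.const_mul θ), integral_const_mul,
            integral_const_mul]
          simp
      _ ≤ θ * ∫ w, F w ∂γ + K * θ ^ 2 + 1 := by
          have := mul_le_mul_of_nonneg_left hK (by positivity : 0 ≤ θ ^ 2)
          linarith
      _ ≤ _ := Real.add_one_le_exp _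
  calc _ ≤ Real.exp (-(θ * ∫ w, F w ∂γ)) * Real.exp (θ * ∫ w, F w ∂γ + K * θ ^ 2) := by gcongr
    _ = _ := by rw [← Real.exp_add]; ring_nf

/-! ### Truncated squared norms and their exponential moments. -/

/-- The centred squared norm, replaced by `0` where it exceeds `R` in absolute value. -/
noncomputable def truncDev (E : Type*) [NormedAddCommGroup E] [InnerProductSpace ℝ E] (R : ℝ)
    (z : E) : ℝ :=
  if |chiDev E z| ≤ R then chiDev E z else 0

section truncDev

variable {E : Type*} [NormedAddCommGroup E] [InnerProductSpace ℝ E] {R : ℝ}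

lemma truncDev_of_le {z : E} (h : |chiDev E z| ≤ R) : truncDev E R z = chiDev E z := if_pos h

lemma truncDev_neg (z : E) : truncDev E R (-z) = truncDev E R z := by
  simp [truncDev, chiDev_neg]

lemma abs_truncDev_le (hR : 0 ≤ R) (z : E) : |truncDev E R z| ≤ R := by
  unfold truncDev
  split_ifs with h
  · exact h
  · simpa using hR

lemma truncDev_sq_le (z : E) : truncDev E R z ^ 2 ≤ chiDev E z ^ 2 := by
  unfold truncDev
  split_ifs with h
  · exact le_rfl
  · simpa using sq_nonneg _

lemma measurable_truncDev [MeasurableSpace E] [BorelSpace E] : Measurable (truncDev E R) :=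
  Measurable.ite (measurableSet_le measurable_chiDev.abs measurable_const) measurable_chiDev
    measurable_const

lemma sq_le_two_mul_exp {y : ℝ} (hy : 0 ≤ y) : y ^ 2 ≤ 2 * Real.exp y := by
  linarith [Real.quadratic_le_exp_of_nonneg hy]

lemma chiDev_sq_le {D : ℝ} (hD1 : 1 ≤ D) (z : E) :
    chiDev E z ^ 2 ≤ 128 * D * Real.exp (|chiDev E z| / (8 * √D)) := by
  have hD0 : 0 < D := by linarith
  have h := sq_le_two_mul_exp (y := |chiDev E z| / (8 * √D)) (by positivity)
  rw [div_pow, mul_pow, Real.sq_sqrt hD0.le, sq_abs, div_le_iff₀ (by positivity)] at h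
  linarith

/-- An exponentially growing function that dominates polynomials in `chiDev E z` and `⟪z, x⟫`. -/
noncomputable def expDom (D : ℝ) (x z : E) : ℝ :=
  Real.exp (|chiDev E z| / (4 * √D)) + Real.exp (⟪z, x⟫ ^ 2 / 4)

/-- The two factors are not independent, so 2pq ≤ p² + q² is used to separate an exponential in
`chiDev` from one in ⟪z, x⟫². This doubles both rates, which stay integrable. The constant is
128·512/2. -/
lemma chiDev_sq_mul_le_expDom {D : ℝ} (hD1 : 1 ≤ D) {x z : E} {y : ℝ}
    (hy : y ≤ 512 * Real.exp (⟪z, x⟫ ^ 2 / 8)) :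
    chiDev E z ^ 2 * y ≤ 32768 * D * expDom D x z := by
  have hD0 : 0 < D := by linarith
  have e1 : Real.exp (|chiDev E z| / (4 * √D)) = Real.exp (|chiDev E z| / (8 * √D)) ^ 2 := by
    rw [← Real.exp_nat_mul]; congr 1; push_cast; field_simp; ring
  have e2 : Real.exp (⟪z, x⟫ ^ 2 / 4) = Real.exp (⟪z, x⟫ ^ 2 / 8) ^ 2 := by
    rw [← Real.exp_nat_mul]; congr 1; push_cast; ring
  rw [expDom, e1, e2]
  set p := Real.exp (|chiDev E z| / (8 * √D))
  set q := Real.exp (⟪z, x⟫ ^ 2 / 8)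
  calc chiDev E z ^ 2 * y ≤ chiDev E z ^ 2 * (512 * q) := by gcongr
    _ ≤ 128 * D * p * (512 * q) := by gcongr; exact chiDev_sq_le hD1 z
    _ = 32768 * D * (2 * p * q) := by ring
    _ ≤ 32768 * D * (p ^ 2 + q ^ 2) := by gcongr; nlinarith [sq_nonneg (p - q)]

end truncDev

section truncDevMoments

variable {E : Type*} [NormedAddCommGroup E] [InnerProductSpace ℝ E] [FiniteDimensional ℝ E]
  [MeasurableSpace E] [BorelSpace E]

/-- D is only an upper bound for the dimension: the rows have dimension n - 1, which may be 0,
whereas later estimates divide by √D and take D = n. -/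
lemma chiDev_mgf_le {D : ℝ} (hD : Module.finrank ℝ E ≤ D) {θ : ℝ} (hθ : |θ| * 4 ≤ 1) :
    Integrable (fun z : E => Real.exp (θ * chiDev E z)) (stdGaussian E) ∧
      ∫ z : E, Real.exp (θ * chiDev E z) ∂(stdGaussian E) ≤ Real.exp (2 * D * θ ^ 2) := by
  have h : |θ| ≤ 1 / 4 := by linarith
  refine ⟨integrable_exp_mul_chiDev (by linarith [(abs_le.1 h).2]),
    (integral_exp_mul_chiDev_le h).trans (Real.exp_le_exp.2 ?_)⟩
  nlinarith [mul_le_mul_of_nonneg_left hD (sq_nonneg θ)]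

lemma inner_mgf_le {x : E} (hx : ‖x‖ = 1) (θ : ℝ) :
    Integrable (fun z : E => Real.exp (θ * ⟪z, x⟫)) (stdGaussian E) ∧
      ∫ z : E, Real.exp (θ * ⟪z, x⟫) ∂(stdGaussian E) ≤ Real.exp (1 / 2 * θ ^ 2) := by
  refine ⟨integrable_comp_inner_stdGaussian hx (f := fun t => Real.exp (θ * t))
    (integrable_exp_mul_gaussianReal θ), le_of_eq ?_⟩
  rw [integral_comp_inner_stdGaussian hx (f := fun t => Real.exp (θ * t)) (by fun_prop)]
  have := congrFun (mgf_fun_id_gaussianReal (μ := 0) (v := 1)) θ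
  simp only [mgf] at this
  rw [this]
  congr 1
  simp
  ring

lemma inner_sq_sub_one_mgf_le {x : E} (hx : ‖x‖ = 1) {θ : ℝ} (hθ : |θ| * 4 ≤ 1) :
    Integrable (fun z : E => Real.exp (θ * (⟪z, x⟫ ^ 2 - 1))) (stdGaussian E) ∧
      ∫ z : E, Real.exp (θ * (⟪z, x⟫ ^ 2 - 1)) ∂(stdGaussian E) ≤ Real.exp (2 * θ ^ 2) := by
  have h : |θ| ≤ 1 / 4 := by linarith
  constructor
  · refine integrable_comp_inner_stdGaussian hx (f := fun t => Real.exp (θ * (t ^ 2 - 1))) ?_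
    refine ((integrable_exp_mul_sq_gaussianReal (s := θ)
      (by linarith [(abs_le.1 h).2])).const_mul (Real.exp (-θ))).congr (ae_of_all _ fun t => ?_)
    dsimp only
    rw [← Real.exp_add]
    ring_nf
  · rw [integral_comp_inner_stdGaussian hx (f := fun t => Real.exp (θ * (t ^ 2 - 1)))
      (by fun_prop)]
    exact integral_exp_mul_sq_sub_one_gaussianReal_le h

lemma integrable_expDom {D : ℝ} (hD1 : 1 ≤ D) {x : E} (hx : ‖x‖ = 1) :
    Integrable (expDom D x) (stdGaussian E) := by
  have hs : 1 ≤ √D := Real.one_le_sqrt.2 hD1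
  have hs' : 1 / (4 * √D) ≤ 1 / 4 := by
    apply one_div_le_one_div_of_le <;> linarith
  refine Integrable.add ?_ ?_
  · refine ((integrable_exp_mul_chiDev (E := E) (s := 1 / (4 * √D)) (by linarith)).add
      (integrable_exp_mul_chiDev (E := E) (s := -(1 / (4 * √D)))
        (by linarith [show 0 ≤ 1 / (4 * √D) by positivity]))).mono'
      (Measurable.aestronglyMeasurable (by have := measurable_chiDev (E := E); fun_prop))
      (ae_of_all _ fun z => ?_)
    rw [Real.norm_eq_abs, Real.abs_exp, Pi.add_apply]
    have := Real.exp_abs_le (chiDev E z / (4 * √D))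
    rw [abs_div, abs_of_pos (by positivity : 0 < 4 * √D)] at this
    convert this using 3 <;> ring
  · have := integrable_comp_inner_stdGaussian (E := E) hx
      (integrable_exp_mul_sq_gaussianReal (s := 1 / 4) (by norm_num))
    refine this.congr (ae_of_all _ fun z => ?_)
    dsimp only
    ring_nf

lemma integral_expDom_le {D : ℝ} (hD : Module.finrank ℝ E ≤ D) (hD1 : 1 ≤ D) {x : E}
    (hx : ‖x‖ = 1) : ∫ z : E, expDom D x z ∂(stdGaussian E) ≤ 10 := by
  have hs : 1 ≤ √D := Real.one_le_sqrt.2 hD1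
  have hs' : 1 / (4 * √D) ≤ 1 / 4 := by
    apply one_div_le_one_div_of_le <;> linarith
  have hs0 : 0 < 1 / (4 * √D) := by positivity
  have h1 := chiDev_mgf_le (E := E) hD (θ := 1 / (4 * √D))
    (by rw [abs_of_pos hs0]; linarith)
  have h2 := chiDev_mgf_le (E := E) hD (θ := -(1 / (4 * √D)))
    (by rw [abs_neg, abs_of_pos hs0]; linarith)
  have h3 := integrable_comp_inner_stdGaussian (E := E) hx
      (integrable_exp_mul_sq_gaussianReal (s := 1 / 4) (by norm_num))
  -- At the rate 1/(4√D) the variance proxy 2D yields a constant free of the dimension.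
  have hV : 2 * D * (1 / (4 * √D)) ^ 2 = 1 / 8 := by
    rw [div_pow, mul_pow, Real.sq_sqrt (by linarith)]
    field_simp
    norm_num
  rw [neg_sq, hV] at h2
  rw [hV] at h1
  calc ∫ z : E, expDom D x z ∂(stdGaussian E)
      ≤ ∫ z : E, (Real.exp (1 / (4 * √D) * chiDev E z) + Real.exp (-(1 / (4 * √D)) * chiDev E z) +
          Real.exp (1 / 4 * ⟪z, x⟫ ^ 2)) ∂(stdGaussian E) := by
        refine integral_mono (integrable_expDom hD1 hx) ((h1.1.add h2.1).add h3) fun z => ?_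
        have := Real.exp_abs_le (chiDev E z / (4 * √D))
        rw [abs_div, abs_of_pos (by positivity : 0 < 4 * √D)] at this
        simp only [expDom]
        refine add_le_add (this.trans (le_of_eq ?_)) (le_of_eq ?_) <;> ring_nf
    _ ≤ Real.exp (1 / 8) + Real.exp (1 / 8) + Real.exp (1 / 4 + 2 * (1 / 4) ^ 2) := by
        have h12 : Integrable (fun z : E => Real.exp (1 / (4 * √D) * chiDev E z) +
            Real.exp (-(1 / (4 * √D)) * chiDev E z)) (stdGaussian E) := h1.1.add h2.1
        rw [integral_add h12 h3, integral_add h1.1 h2.1,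
          integral_comp_inner_stdGaussian hx (f := fun t => Real.exp (1 / 4 * t ^ 2)) (by fun_prop),
          integral_exp_mul_sq_gaussianReal (by norm_num)]
        exact add_le_add (add_le_add h1.2 h2.2) (inv_sqrt_one_sub_le (by norm_num [abs_of_pos]))
    _ ≤ 10 := by
        have h : ∀ t : ℝ, t ≤ 1 → Real.exp t ≤ 3 := fun t ht =>
          (Real.exp_le_exp.2 ht).trans (by linarith [Real.exp_one_lt_d9])
        linarith [h (1 / 8) (by norm_num), h (1 / 4 + 2 * (1 / 4) ^ 2) (by norm_num)]

lemma sq_le_exp_sq_div (w : ℝ) : w ^ 2 ≤ 16 * Real.exp (w ^ 2 / 16) := by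
  have := Real.add_one_le_exp (w ^ 2 / 16)
  linarith

lemma pow_four_le_exp_sq_div (w : ℝ) : w ^ 4 ≤ 512 * Real.exp (w ^ 2 / 16) := by
  have := sq_le_two_mul_exp (y := w ^ 2 / 16) (by positivity)
  nlinarith

/-- With the first factor bounded by R and |θ| ≤ 1/(16R), the exponent is at most ⟪z, x⟫²/16, which
is integrable; without truncation no exponential moment with θ > 0 exists. The variance proxy stays
of order D, the size of the second moment of `chiDev`, instead of R². The constant is 10·32768, with
10 from `integral_expDom_le`. -/
lemma truncDev_mul_inner_sq_mgf_le {D : ℝ} (hD : Module.finrank ℝ E ≤ D) (hD1 : 1 ≤ D) (hR : 0 ≤ R)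
    {x : E} (hx : ‖x‖ = 1) {θ : ℝ} (hθ : |θ| * (16 * R) ≤ 1) :
    Integrable (fun z : E => Real.exp (θ * (truncDev E R z * ⟪z, x⟫ ^ 2 -
        ∫ w, truncDev E R w * ⟪w, x⟫ ^ 2 ∂(stdGaussian E)))) (stdGaussian E) ∧
      ∫ z : E, Real.exp (θ * (truncDev E R z * ⟪z, x⟫ ^ 2 -
        ∫ w, truncDev E R w * ⟪w, x⟫ ^ 2 ∂(stdGaussian E))) ∂(stdGaussian E) ≤
        Real.exp (327680 * D * θ ^ 2) := by
  refine integrable_and_integral_exp_mul_sub_le (Φ := fun z => 32768 * D * expDom D x z)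
    (measurable_truncDev.mul (by fun_prop)) ((integrable_expDom hD1 hx).const_mul _)
    (fun z => ?_) ?_
  · have h1 : |θ * (truncDev E R z * ⟪z, x⟫ ^ 2)| ≤ ⟪z, x⟫ ^ 2 / 16 := by
      rw [abs_mul, abs_mul, abs_of_nonneg (sq_nonneg ⟪z, x⟫)]
      calc |θ| * (|truncDev E R z| * ⟪z, x⟫ ^ 2) ≤ |θ| * (R * ⟪z, x⟫ ^ 2) := by
            gcongr; exact abs_truncDev_le hR z
        _ = (|θ| * (16 * R)) * ⟪z, x⟫ ^ 2 / 16 := by ring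
        _ ≤ 1 * ⟪z, x⟫ ^ 2 / 16 := by gcongr
        _ = _ := by ring
    calc (truncDev E R z * ⟪z, x⟫ ^ 2) ^ 2 * Real.exp |θ * (truncDev E R z * ⟪z, x⟫ ^ 2)|
        ≤ (truncDev E R z * ⟪z, x⟫ ^ 2) ^ 2 * Real.exp (⟪z, x⟫ ^ 2 / 16) := by gcongr
      _ = truncDev E R z ^ 2 * (⟪z, x⟫ ^ 4 * Real.exp (⟪z, x⟫ ^ 2 / 16)) := by ring
      _ ≤ chiDev E z ^ 2 * (⟪z, x⟫ ^ 4 * Real.exp (⟪z, x⟫ ^ 2 / 16)) := by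
          exact mul_le_mul_of_nonneg_right (truncDev_sq_le z) (by positivity)
      _ ≤ _ := by
          refine chiDev_sq_mul_le_expDom hD1 ?_
          calc _ ≤ 512 * Real.exp (⟪z, x⟫ ^ 2 / 16) * Real.exp (⟪z, x⟫ ^ 2 / 16) := by
                gcongr; exact pow_four_le_exp_sq_div _
            _ = _ := by rw [mul_assoc, ← Real.exp_add]; ring_nf
  · rw [integral_const_mul]
    have := integral_expDom_le hD hD1 hx
    nlinarith

/-- The integrand is odd and the Gaussian measure is symmetric. -/
lemma integral_truncDev_mul_inner (x : E) :
    ∫ z : E, truncDev E R z * ⟪z, x⟫ ∂(stdGaussian E) = 0 := by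
  have h : ∫ z : E, truncDev E R z * ⟪z, x⟫ ∂(stdGaussian E) =
      ∫ z : E, truncDev E R (-z) * ⟪-z, x⟫ ∂(stdGaussian E) := by
    have hm : Measurable fun z : E => truncDev E R z * ⟪z, x⟫ :=
      measurable_truncDev.mul (by fun_prop)
    conv_lhs => rw [← stdGaussian_map_neg]
    rw [integral_map (by fun_prop) hm.aestronglyMeasurable]
  simp only [truncDev_neg, inner_neg_left, mul_neg, integral_neg] at h
  linarith

lemma truncDev_mul_inner_mgf_le {D : ℝ} (hD : Module.finrank ℝ E ≤ D) (hD1 : 1 ≤ D) (hR : 0 ≤ R)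
    {x : E} (hx : ‖x‖ = 1) {θ : ℝ} (hθ : |θ| * (16 * R) ≤ 1) :
    Integrable (fun z : E => Real.exp (θ * (truncDev E R z * ⟪z, x⟫))) (stdGaussian E) ∧
      ∫ z : E, Real.exp (θ * (truncDev E R z * ⟪z, x⟫)) ∂(stdGaussian E) ≤
        Real.exp (327680 * D * θ ^ 2) := by
  have key := integrable_and_integral_exp_mul_sub_le (γ := stdGaussian E) (θ := θ)
    (K := 327680 * D) (F := fun z => truncDev E R z * ⟪z, x⟫)
    (Φ := fun z => 32768 * D * expDom D x z)
    (measurable_truncDev.mul (by fun_prop)) ((integrable_expDom hD1 hx).const_mul _)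
    (fun z => ?_) ?_
  · simpa only [integral_truncDev_mul_inner, sub_zero] using key
  · have h1 : |θ * (truncDev E R z * ⟪z, x⟫)| ≤ ⟪z, x⟫ ^ 2 / 16 + 1 := by
      rw [abs_mul, abs_mul]
      calc |θ| * (|truncDev E R z| * |⟪z, x⟫|) ≤ |θ| * (R * |⟪z, x⟫|) := by
            gcongr; exact abs_truncDev_le hR z
        _ = (|θ| * (16 * R)) * |⟪z, x⟫| / 16 := by ring
        _ ≤ 1 * |⟪z, x⟫| / 16 := by gcongr
        _ ≤ _ := by nlinarith [sq_abs ⟪z, x⟫, sq_nonneg (|⟪z, x⟫| - 1)]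
    calc (truncDev E R z * ⟪z, x⟫) ^ 2 * Real.exp |θ * (truncDev E R z * ⟪z, x⟫)|
        ≤ (truncDev E R z * ⟪z, x⟫) ^ 2 * Real.exp (⟪z, x⟫ ^ 2 / 16 + 1) := by gcongr
      _ = truncDev E R z ^ 2 * (⟪z, x⟫ ^ 2 * Real.exp (⟪z, x⟫ ^ 2 / 16 + 1)) := by ring
      _ ≤ chiDev E z ^ 2 * (⟪z, x⟫ ^ 2 * Real.exp (⟪z, x⟫ ^ 2 / 16 + 1)) := by
          exact mul_le_mul_of_nonneg_right (truncDev_sq_le z) (by positivity)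
      _ ≤ _ := by
          refine chiDev_sq_mul_le_expDom hD1 ?_
          calc _ ≤ 16 * Real.exp (⟪z, x⟫ ^ 2 / 16) * (Real.exp (⟪z, x⟫ ^ 2 / 16) * 3) := by
                rw [Real.exp_add]
                gcongr
                · exact sq_le_exp_sq_div _
                · linarith [Real.exp_one_lt_d9]
            _ = 48 * Real.exp (⟪z, x⟫ ^ 2 / 8) := by
                rw [show ⟪z, x⟫ ^ 2 / 8 = ⟪z, x⟫ ^ 2 / 16 + ⟪z, x⟫ ^ 2 / 16 by ring, Real.exp_add]
                ring
            _ ≤ _ := by gcongr; norm_num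
  · rw [integral_const_mul]
    have := integral_expDom_le hD hD1 hx
    nlinarith

/-- A purely sub-Gaussian alternative to `truncDev_mul_inner_mgf_le`, better when the dimension
exceeds the logarithm. For R²θ² ≤ 1/2, symmetry replaces exp by cosh, and cosh t ≤ exp(t²/2) reduces
to a Gaussian square. For larger y = R²θ², Young's inequality is enough, since 3y absorbs the
additive constant. -/
lemma truncDev_mul_inner_mgf_le' (hR : 0 ≤ R) {x : E} (hx : ‖x‖ = 1) (θ : ℝ) :
    Integrable (fun z : E => Real.exp (θ * (truncDev E R z * ⟪z, x⟫))) (stdGaussian E) ∧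
      ∫ z : E, Real.exp (θ * (truncDev E R z * ⟪z, x⟫)) ∂(stdGaussian E) ≤
        Real.exp (3 * R ^ 2 * θ ^ 2) := by
  have hm : Measurable fun z : E => truncDev E R z * ⟪z, x⟫ :=
    measurable_truncDev.mul (by fun_prop)
  have hle : ∀ z : E, |truncDev E R z * ⟪z, x⟫| ≤ R * |⟪z, x⟫| := fun z => by
    rw [abs_mul]; gcongr; exact abs_truncDev_le hR z
  have hpt : ∀ (θ : ℝ) (z : E), Real.exp (θ * (truncDev E R z * ⟪z, x⟫)) ≤
      Real.exp (2 * (R ^ 2 * θ ^ 2)) * Real.exp (1 / 8 * ⟪z, x⟫ ^ 2) := fun θ z => by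
    rw [← Real.exp_add]
    refine Real.exp_le_exp.2 ((le_abs_self _).trans ?_)
    rw [abs_mul]
    calc |θ| * |truncDev E R z * ⟪z, x⟫| ≤ |θ| * (R * |⟪z, x⟫|) := by gcongr; exact hle z
      _ ≤ _ := by
        rw [← sq_abs θ, ← sq_abs ⟪z, x⟫]
        nlinarith [sq_nonneg (4 * (R * |θ|) - |⟪z, x⟫|)]
  have hI : Integrable (fun z : E => Real.exp (1 / 8 * ⟪z, x⟫ ^ 2)) (stdGaussian E) :=
    integrable_comp_inner_stdGaussian (E := E) hx
      (integrable_exp_mul_sq_gaussianReal (s := 1 / 8) (by norm_num))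
  have hint : ∀ θ : ℝ, Integrable (fun z : E => Real.exp (θ * (truncDev E R z * ⟪z, x⟫)))
      (stdGaussian E) := fun θ => by
    refine (hI.const_mul (Real.exp (2 * (R ^ 2 * θ ^ 2)))).mono'
      (hm.const_mul θ).exp.aestronglyMeasurable (ae_of_all _ fun z => ?_)
    rw [Real.norm_eq_abs, Real.abs_exp]
    exact hpt θ z
  refine ⟨hint θ, ?_⟩
  have hgauss : ∀ s : ℝ, |s| ≤ 1 / 4 → ∫ z : E, Real.exp (s * ⟪z, x⟫ ^ 2) ∂(stdGaussian E) ≤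
      Real.exp (s + 2 * s ^ 2) := fun s hs => by
    rw [integral_comp_inner_stdGaussian hx (f := fun t => Real.exp (s * t ^ 2)) (by fun_prop),
      integral_exp_mul_sq_gaussianReal (by linarith [(abs_le.1 hs).2])]
    exact inv_sqrt_one_sub_le hs
  set y := R ^ 2 * θ ^ 2 with hy
  have hy0 : 0 ≤ y := by positivity
  rcases le_or_gt y (1 / 2) with h | h
  · have hsymm : ∫ z : E, Real.exp (θ * (truncDev E R z * ⟪z, x⟫)) ∂(stdGaussian E) =
        ∫ z : E, Real.exp (-θ * (truncDev E R z * ⟪z, x⟫)) ∂(stdGaussian E) := by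
      conv_lhs => rw [← stdGaussian_map_neg]
      rw [integral_map (by fun_prop) (hm.const_mul θ).exp.aestronglyMeasurable]
      simp only [truncDev_neg, inner_neg_left, mul_neg, neg_mul]
    have h2 : Integrable (fun z : E => Real.exp (y / 2 * ⟪z, x⟫ ^ 2)) (stdGaussian E) :=
      integrable_comp_inner_stdGaussian (E := E) hx
        (integrable_exp_mul_sq_gaussianReal (s := y / 2) (by linarith))
    have h3 : ∫ z : E, (Real.exp (θ * (truncDev E R z * ⟪z, x⟫)) +
        Real.exp (-θ * (truncDev E R z * ⟪z, x⟫))) ∂(stdGaussian E) ≤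
        ∫ z : E, 2 * Real.exp (y / 2 * ⟪z, x⟫ ^ 2) ∂(stdGaussian E) := by
      refine integral_mono ((hint θ).add (hint (-θ))) (h2.const_mul 2) fun z => ?_
      have h4 := Real.cosh_le_exp_half_sq (θ * (truncDev E R z * ⟪z, x⟫))
      rw [Real.cosh_eq] at h4
      have h5 : Real.exp ((θ * (truncDev E R z * ⟪z, x⟫)) ^ 2 / 2) ≤
          Real.exp (y / 2 * ⟪z, x⟫ ^ 2) := by
        refine Real.exp_le_exp.2 ?_
        have h6 : truncDev E R z ^ 2 ≤ R ^ 2 := by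
          rw [← sq_abs (truncDev E R z)]
          have := abs_truncDev_le hR z
          gcongr
        have := mul_le_mul_of_nonneg_right h6 (by positivity : 0 ≤ θ ^ 2 * ⟪z, x⟫ ^ 2)
        rw [hy]
        nlinarith
      dsimp only
      rw [neg_mul]
      linarith
    rw [integral_add (hint θ) (hint (-θ)), ← hsymm, integral_const_mul] at h3
    calc _ ≤ ∫ z : E, Real.exp (y / 2 * ⟪z, x⟫ ^ 2) ∂(stdGaussian E) := by linarith
      _ ≤ Real.exp (y / 2 + 2 * (y / 2) ^ 2) :=
          hgauss _ (by rw [abs_of_nonneg (by positivity)]; linarith)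
      _ ≤ _ := Real.exp_le_exp.2 (by nlinarith)
  · calc ∫ z : E, Real.exp (θ * (truncDev E R z * ⟪z, x⟫)) ∂(stdGaussian E)
        ≤ ∫ z : E, Real.exp (2 * y) * Real.exp (1 / 8 * ⟪z, x⟫ ^ 2) ∂(stdGaussian E) :=
          integral_mono (hint θ) (hI.const_mul _) (hpt θ)
      _ = Real.exp (2 * y) * ∫ z : E, Real.exp (1 / 8 * ⟪z, x⟫ ^ 2) ∂(stdGaussian E) :=
          integral_const_mul _ _
      _ ≤ Real.exp (2 * y) * Real.exp (1 / 8 + 2 * (1 / 8) ^ 2) := by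
          gcongr; exact hgauss _ (by rw [abs_of_pos] <;> norm_num)
      _ ≤ _ := by
          rw [← Real.exp_add]
          exact Real.exp_le_exp.2 (by nlinarith)

/-- The effect of the truncation on the mean of `chiDev E z * ⟪z, x⟫ ^ 2`. -/
lemma abs_integral_truncDev_mul_inner_sq_sub_two_le {D : ℝ} (hD : Module.finrank ℝ E ≤ D)
    (hD1 : 1 ≤ D) {x : E} (hx : ‖x‖ = 1) {q : ℝ} (hq : 0 < q) :
    |∫ z : E, truncDev E R z * ⟪z, x⟫ ^ 2 ∂(stdGaussian E) - 2| ≤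
      q * (stdGaussian E).real {z | R < |chiDev E z|} + 327680 * D / q := by
  have hdom : Integrable (fun z : E => 32768 * D * expDom D x z) (stdGaussian E) :=
    (integrable_expDom hD1 hx).const_mul _
  have hA : MeasurableSet {z : E | R < |chiDev E z|} :=
    measurableSet_lt measurable_const measurable_chiDev.abs
  have hsq : ∀ z : E, chiDev E z ^ 2 * ⟪z, x⟫ ^ 4 ≤ 32768 * D * expDom D x z := fun z => by
    refine chiDev_sq_mul_le_expDom hD1 ((pow_four_le_exp_sq_div _).trans ?_)
    gcongr
    norm_num
  have h1 : Integrable (fun z : E => chiDev E z * ⟪z, x⟫ ^ 2) (stdGaussian E) := by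
    refine ((integrable_const (1 : ℝ)).add hdom).mono'
      (Measurable.aestronglyMeasurable (measurable_chiDev.mul (by fun_prop)))
      (ae_of_all _ fun z => ?_)
    rw [Pi.add_apply, Real.norm_eq_abs]
    have := hsq z
    have e : chiDev E z ^ 2 * ⟪z, x⟫ ^ 4 = |chiDev E z * ⟪z, x⟫ ^ 2| ^ 2 := by
      rw [sq_abs]; ring
    nlinarith [sq_nonneg (|chiDev E z * ⟪z, x⟫ ^ 2| - 1)]
  have h2 : Integrable (fun z : E => truncDev E R z * ⟪z, x⟫ ^ 2) (stdGaussian E) := by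
    refine h1.abs.mono' (Measurable.aestronglyMeasurable (measurable_truncDev.mul (by fun_prop)))
      (ae_of_all _ fun z => ?_)
    rw [Real.norm_eq_abs, abs_mul, abs_mul]
    gcongr ?_ * _
    exact sq_le_sq.1 (truncDev_sq_le z)
  have h3 : Integrable (fun z : E => q * ({z | R < |chiDev E z|} : Set E).indicator 1 z +
      1 / q * (32768 * D * expDom D x z)) (stdGaussian E) :=
    (((integrable_const (1 : ℝ)).indicator hA).const_mul q).add (hdom.const_mul _)
  rw [← integral_chiDev_mul_inner_sq hx, ← integral_sub h2 h1]
  calc _ ≤ ∫ z : E, |truncDev E R z * ⟪z, x⟫ ^ 2 - chiDev E z * ⟪z, x⟫ ^ 2| ∂(stdGaussian E) :=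
        abs_integral_le_integral_abs
    _ ≤ ∫ z : E, (q * ({z | R < |chiDev E z|} : Set E).indicator 1 z +
          1 / q * (32768 * D * expDom D x z)) ∂(stdGaussian E) := by
        refine integral_mono (h2.sub h1).abs h3 fun z => ?_
        dsimp only
        by_cases hz : |chiDev E z| ≤ R
        · rw [truncDev_of_le hz, Set.indicator_of_notMem (by simpa using hz)]
          simp only [sub_self, abs_zero, mul_zero, zero_add]
          exact mul_nonneg (by positivity) (le_trans (by positivity) (hsq z))
        · rw [truncDev, if_neg hz, Set.indicator_of_mem (by simpa using hz), Pi.one_apply]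
          have hm := mul_le_mul_of_nonneg_left (hsq z) (by positivity : 0 ≤ 1 / q)
          refine le_trans ?_ (add_le_add_right hm _)
          set t := chiDev E z * ⟪z, x⟫ ^ 2
          have ht : chiDev E z ^ 2 * ⟪z, x⟫ ^ 4 = |t| ^ 2 := by rw [sq_abs]; ring
          rw [ht, zero_mul, zero_sub, abs_neg]
          -- Where the truncation acts, 2|t| ≤ q + t²/q: the event is charged with weight q and the
          -- second moment with 1/q.
          have : 0 ≤ 1 / q * (|t| - q) ^ 2 := by positivity
          have e : 1 / q * (|t| - q) ^ 2 = 1 / q * |t| ^ 2 - 2 * |t| + q := by field_simp; ring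
          linarith [abs_nonneg t]
    _ = q * (stdGaussian E).real {z | R < |chiDev E z|} +
          1 / q * (32768 * D * ∫ z : E, expDom D x z ∂(stdGaussian E)) := by
        have hAi : Integrable (fun z : E => q * ({z | R < |chiDev E z|} : Set E).indicator 1 z)
            (stdGaussian E) := ((integrable_const (1 : ℝ)).indicator hA).const_mul q
        rw [integral_add hAi (hdom.const_mul _), integral_const_mul, integral_const_mul,
          integral_const_mul,
          integral_indicator_one hA]
    _ ≤ _ := by
        have := mul_le_mul_of_nonneg_left (integral_expDom_le hD hD1 hx)
          (by positivity : 0 ≤ 1 / q * (32768 * D))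
        have e : 1 / q * (32768 * D) * 10 = 327680 * D / q := by ring
        linarith

end truncDevMoments

/-! ### Nets of the sphere, norms and quadratic forms. -/

section net

variable {E : Type*} [NormedAddCommGroup E] [InnerProductSpace ℝ E]

/-- A `1/2`-net of the unit sphere of cardinality at most `5 ^ dim E`. -/
lemma exists_half_net_sphere [FiniteDimensional ℝ E] :
    ∃ S : Finset E, (∀ x ∈ S, ‖x‖ = 1) ∧ S.card ≤ 5 ^ Module.finrank ℝ E ∧
      ∀ x : E, ‖x‖ = 1 → ∃ y ∈ S, ‖x - y‖ ≤ 1 / 2 := by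
  classical
  -- The net is half of a largest 1-separated subset of the sphere of radius 2: Besicovitch's
  -- cardinality bound is for 1-separated points in the ball of radius 2.
  let good : Finset E → Prop := fun T =>
    (∀ c ∈ T, ‖c‖ = 2) ∧ ∀ c ∈ T, ∀ d ∈ T, c ≠ d → 1 ≤ ‖c - d‖
  have hcard : ∀ T, good T → T.card ≤ 5 ^ Module.finrank ℝ E := fun T hT =>
    Besicovitch.card_le_of_separated T (fun c hc => (hT.1 c hc).le) hT.2
  obtain ⟨T, hT, hmax⟩ : ∃ T, good T ∧ ∀ T', good T' → T'.card ≤ T.card := by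
    let Q : ℕ → Prop := fun k => ∃ T, good T ∧ T.card = k
    have h0 : Q 0 := ⟨∅, ⟨by simp, by simp⟩, rfl⟩
    obtain ⟨T, hT, hk⟩ := Nat.findGreatest_spec (P := Q) (Nat.zero_le (5 ^ Module.finrank ℝ E)) h0
    exact ⟨T, hT, fun T' hT' => hk ▸ Nat.le_findGreatest (hcard T' hT') ⟨T', hT', rfl⟩⟩
  refine ⟨T.image fun c => (1 / 2 : ℝ) • c, ?_, Finset.card_image_le.trans (hcard T hT), ?_⟩
  · intro x hx
    obtain ⟨c, hc, rfl⟩ := Finset.mem_image.1 hx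
    rw [norm_smul, hT.1 c hc]
    norm_num
  · intro x hx
    obtain ⟨c, hc, hlt⟩ : ∃ c ∈ T, ‖(2 : ℝ) • x - c‖ < 1 := by
      by_contra! hcon
      have hnot : (2 : ℝ) • x ∉ T := fun hmem => by
        have := hcon _ hmem
        simp at this
        linarith
      have hgood : good (insert ((2 : ℝ) • x) T) := by
        refine ⟨fun c hc => ?_, fun c hc d hd hcd => ?_⟩
        · rcases Finset.mem_insert.1 hc with rfl | hc
          · rw [norm_smul, hx]; norm_num
          · exact hT.1 c hc
        · rcases Finset.mem_insert.1 hc with rfl | hc <;>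
          rcases Finset.mem_insert.1 hd with rfl | hd
          · exact (hcd rfl).elim
          · exact hcon d hd
          · rw [norm_sub_rev]; exact hcon c hc
          · exact hT.2 c hc d hd hcd
      have := hmax _ hgood
      rw [Finset.card_insert_of_notMem hnot] at this
      omega
    refine ⟨(1 / 2 : ℝ) • c, Finset.mem_image_of_mem _ hc, ?_⟩
    have e : x - (1 / 2 : ℝ) • c = (1 / 2 : ℝ) • ((2 : ℝ) • x - c) := by
      rw [smul_sub, smul_smul]; norm_num
    rw [e, norm_smul]
    norm_num
    linarith

/-- Test β against its own direction; moving to the nearest net point loses at most ‖β‖/2. -/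
lemma norm_le_of_half_net {S : Finset E} (hS : ∀ x : E, ‖x‖ = 1 → ∃ y ∈ S, ‖x - y‖ ≤ 1 / 2)
    {β : E} {t : ℝ} (ht : 0 ≤ t) (h : ∀ y ∈ S, |⟪β, y⟫| ≤ t) : ‖β‖ ≤ 2 * t := by
  by_cases hβ : β = 0
  · simpa [hβ] using ht
  have hn : 0 < ‖β‖ := norm_pos_iff.2 hβ
  obtain ⟨y, hy, hxy⟩ := hS (‖β‖⁻¹ • β) (by rw [norm_smul]; simp [hn.ne'])
  have h1 : ‖β‖ = ⟪β, ‖β‖⁻¹ • β - y⟫ + ⟪β, y⟫ := by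
    rw [inner_sub_right, real_inner_smul_right, real_inner_self_eq_norm_sq]
    field_simp
    ring
  have h2 : ⟪β, ‖β‖⁻¹ • β - y⟫ ≤ ‖β‖ * (1 / 2) :=
    (real_inner_le_norm _ _).trans (by gcongr)
  linarith [le_abs_self ⟪β, y⟫, h y hy]

/-- Polarization: a bound on the quadratic form of a symmetric map bounds its bilinear form. -/
lemma LinearMap.IsSymmetric.abs_inner_le {T : E →ₗ[ℝ] E} (hT : T.IsSymmetric) {m : ℝ}
    (h : ∀ x, |⟪T x, x⟫| ≤ m * ‖x‖ ^ 2) (p q : E) : |⟪T p, q⟫| ≤ m * (‖p‖ * ‖q‖) := by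
  have key : ∀ p q : E, ‖p‖ = 1 → ‖q‖ = 1 → |⟪T p, q⟫| ≤ m := fun p q hp hq => by
    have e : 4 * ⟪T p, q⟫ = ⟪T (p + q), p + q⟫ - ⟪T (p - q), p - q⟫ := by
      have h1 : ⟪T q, p⟫ = ⟪T p, q⟫ := by rw [hT, real_inner_comm]
      simp only [map_add, map_sub, inner_add_left, inner_add_right, inner_sub_left,
        inner_sub_right, h1]
      ring
    have hp1 := abs_le.1 (h (p + q))
    have hp2 := abs_le.1 (h (p - q))
    have hpar := parallelogram_law_with_norm ℝ p q
    rw [hp, hq] at hpar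
    have hpar' : m * ‖p + q‖ ^ 2 + m * ‖p - q‖ ^ 2 = 4 * m := by
      rw [← mul_add]; linear_combination m * hpar
    rw [abs_le]
    constructor <;> linarith [hp1.1, hp1.2, hp2.1, hp2.2]
  by_cases hp : p = 0
  · simp [hp]
  by_cases hq : q = 0
  · simp [hq]
  have hp' : 0 < ‖p‖ := norm_pos_iff.2 hp
  have hq' : 0 < ‖q‖ := norm_pos_iff.2 hq
  have := key (‖p‖⁻¹ • p) (‖q‖⁻¹ • q) (by rw [norm_smul]; simp [hp'.ne'])
    (by rw [norm_smul]; simp [hq'.ne'])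
  rw [map_smul, real_inner_smul_left, real_inner_smul_right, abs_mul, abs_mul,
    abs_of_pos (inv_pos.2 hp'), abs_of_pos (inv_pos.2 hq')] at this
  field_simp at this
  linarith

lemma LinearMap.IsSymmetric.norm_apply_le {T : E →ₗ[ℝ] E} (hT : T.IsSymmetric) {m : ℝ}
    (h : ∀ x, |⟪T x, x⟫| ≤ m * ‖x‖ ^ 2) (p : E) : ‖T p‖ ≤ m * ‖p‖ := by
  have := hT.abs_inner_le h p (T p)
  rw [real_inner_self_eq_norm_sq, abs_of_nonneg (sq_nonneg _)] at this
  rcases (norm_nonneg (T p)).eq_or_lt with h0 | h0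
  · rw [← h0]
    by_cases hp : p = 0
    · simp [hp]
    · have h1 := (abs_nonneg _).trans (h p)
      have h2 : 0 < ‖p‖ := norm_pos_iff.2 hp
      nlinarith [nonneg_of_mul_nonneg_left h1 (by positivity)]
  · nlinarith

/-- Compare the maximiser p of the form on the sphere with a net point y, by ⟪T p, p⟫ - ⟪T y, y⟫ =
⟪T (p - y), p + y⟫. The triangle inequality for ‖p - y‖ ‖p + y‖ gives only 1, which is useless; the
parallelogram law gives (15/16)^(1/2) ≤ 31/32, and hence the factor 32. -/
lemma LinearMap.IsSymmetric.abs_inner_self_le_of_half_net [FiniteDimensional ℝ E] {S : Finset E}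
    (hS1 : ∀ x ∈ S, ‖x‖ = 1) (hS : ∀ x : E, ‖x‖ = 1 → ∃ y ∈ S, ‖x - y‖ ≤ 1 / 2)
    {T : E →ₗ[ℝ] E} (hT : T.IsSymmetric) {t : ℝ} (h : ∀ y ∈ S, |⟪T y, y⟫| ≤ t) (x : E) :
    |⟪T x, x⟫| ≤ 32 * t * ‖x‖ ^ 2 := by
  by_cases hx : x = 0
  · simp [hx]
  have hx' : 0 < ‖x‖ := norm_pos_iff.2 hx
  have hTc : Continuous T := T.continuous_of_finiteDimensional
  obtain ⟨p, hp, hmax⟩ := (isCompact_sphere (0 : E) 1).exists_isMaxOn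
    ⟨‖x‖⁻¹ • x, by simp [norm_smul, hx'.ne']⟩
    (f := fun y => |⟪T y, y⟫|) (Continuous.continuousOn (by fun_prop))
  rw [mem_sphere_zero_iff_norm] at hp
  set m := |⟪T p, p⟫| with hm
  have hm0 : 0 ≤ m := abs_nonneg _
  have hb : ∀ y, |⟪T y, y⟫| ≤ m * ‖y‖ ^ 2 := fun y => by
    by_cases hy : y = 0
    · simp [hy]
    have hy' : 0 < ‖y‖ := norm_pos_iff.2 hy
    have := hmax (a := ‖y‖⁻¹ • y) (by simp [norm_smul, hy'.ne'])
    simp only [map_smul, real_inner_smul_left, real_inner_smul_right, abs_mul,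
      abs_of_pos (inv_pos.2 hy'), Set.mem_ofPred_eq] at this
    rw [← hm] at this
    field_simp at this
    linarith
  obtain ⟨y, hy, hpy⟩ := hS p hp
  have hy1 := hS1 y hy
  have e : ⟪T p, p⟫ = ⟪T y, y⟫ + ⟪T (p - y), p + y⟫ := by
    have h1 : ⟪T y, p⟫ = ⟪T p, y⟫ := by rw [hT, real_inner_comm]
    simp only [map_sub, inner_sub_left, inner_add_right, h1]
    ring
  have h1 : ‖p - y‖ * ‖p + y‖ ≤ 31 / 32 := by
    have hpar := parallelogram_law_with_norm ℝ p y
    rw [hp, hy1] at hpar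
    have hn := norm_nonneg (p - y)
    refine le_of_sq_le_sq ?_ (by norm_num)
    have e2 : (‖p - y‖ * ‖p + y‖) ^ 2 = ‖p - y‖ ^ 2 * (4 - ‖p - y‖ ^ 2) := by
      rw [mul_pow]; congr 1; linarith
    rw [e2]
    have h4 : ‖p - y‖ ^ 2 ≤ 1 / 4 := by nlinarith
    nlinarith [sq_nonneg (‖p - y‖)]
  have h2 : m ≤ t + m * (31 / 32) := by
    calc m = |⟪T y, y⟫ + ⟪T (p - y), p + y⟫| := by rw [hm, e]
      _ ≤ |⟪T y, y⟫| + |⟪T (p - y), p + y⟫| := abs_add_le _ _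
      _ ≤ t + m * (‖p - y‖ * ‖p + y‖) := add_le_add (h y hy) (hT.abs_inner_le hb _ _)
      _ ≤ _ := by gcongr
  refine (hb x).trans ?_
  gcongr
  linarith

end net

/-! ### From fixed directions to all directions. -/

section

variable {E : Type*} [NormedAddCommGroup E] [InnerProductSpace ℝ E]
  {Ω : Type*} [MeasurableSpace Ω] {μ : Measure Ω}

/-- Since 5 ≤ e², the term 2D in the exponent pays for the union over the net. -/
lemma measureReal_exists_mem_net_le {S : Finset E} {D u : ℝ} (hD : Module.finrank ℝ E ≤ D)
    (hS : S.card ≤ 5 ^ Module.finrank ℝ E) {p : E → Ω → Prop}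
    (h : ∀ y ∈ S, μ.real {ω | p y ω} ≤ 2 * Real.exp (-(2 * D + u))) :
    μ.real {ω | ∃ y ∈ S, p y ω} ≤ 2 * Real.exp (-u) := by
  have e : {ω | ∃ y ∈ S, p y ω} = ⋃ y ∈ S, {ω | p y ω} := by ext; simp
  have h5 : (5 : ℝ) ≤ Real.exp 2 := by
    have := Real.quadratic_le_exp_of_nonneg (x := 2) (by norm_num)
    linarith
  have hc : (S.card : ℝ) ≤ Real.exp (2 * D) := by
    calc (S.card : ℝ) ≤ 5 ^ Module.finrank ℝ E := by exact_mod_cast hS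
      _ ≤ Real.exp 2 ^ Module.finrank ℝ E := by gcongr
      _ = Real.exp (2 * Module.finrank ℝ E) := by rw [← Real.exp_nat_mul]; ring_nf
      _ ≤ _ := Real.exp_le_exp.2 (by linarith)
  rw [e]
  calc _ ≤ ∑ y ∈ S, μ.real {ω | p y ω} := measureReal_biUnion_finset_le _ _
    _ ≤ ∑ _y ∈ S, 2 * Real.exp (-(2 * D + u)) := Finset.sum_le_sum h
    _ = S.card * (2 * Real.exp (-(2 * D + u))) := by rw [Finset.sum_const, nsmul_eq_mul]
    _ ≤ Real.exp (2 * D) * (2 * Real.exp (-(2 * D + u))) := by gcongr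
    _ = 2 * (Real.exp (2 * D) * Real.exp (-(2 * D + u))) := by ring
    _ = _ := by rw [← Real.exp_add]; ring_nf

lemma measureReal_norm_gt_le [FiniteDimensional ℝ E] [IsProbabilityMeasure μ]
    {D u t : ℝ} (hD : Module.finrank ℝ E ≤ D) (ht : 0 ≤ t) {β : Ω → E}
    (h : ∀ x : E, ‖x‖ = 1 → μ.real {ω | t ≤ |⟪β ω, x⟫|} ≤ 2 * Real.exp (-(2 * D + u))) :
    μ.real {ω | ¬ ‖β ω‖ ≤ 2 * t} ≤ 2 * Real.exp (-u) := by
  obtain ⟨S, hS1, hSc, hS⟩ := exists_half_net_sphere (E := E)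
  refine (measureReal_mono fun ω hω => ?_).trans
    (measureReal_exists_mem_net_le hD hSc fun y hy => h y (hS1 y hy))
  by_contra hcon
  simp only [Set.mem_ofPred_eq, not_exists, not_and, not_le] at hcon
  exact hω (norm_le_of_half_net hS ht fun y hy => (hcon y hy).le)

lemma measureReal_quadraticForm_gt_le [FiniteDimensional ℝ E] [IsProbabilityMeasure μ]
    {D u t : ℝ} (hD : Module.finrank ℝ E ≤ D)
    {T : Ω → E →ₗ[ℝ] E} (hT : ∀ ω, (T ω).IsSymmetric)
    (h : ∀ x : E, ‖x‖ = 1 → μ.real {ω | t ≤ |⟪T ω x, x⟫|} ≤ 2 * Real.exp (-(2 * D + u))) :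
    μ.real {ω | ¬ ∀ x, |⟪T ω x, x⟫| ≤ 32 * t * ‖x‖ ^ 2} ≤ 2 * Real.exp (-u) := by
  obtain ⟨S, hS1, hSc, hS⟩ := exists_half_net_sphere (E := E)
  refine (measureReal_mono fun ω hω => ?_).trans
    (measureReal_exists_mem_net_le hD hSc fun y hy => h y (hS1 y hy))
  by_contra hcon
  simp only [Set.mem_ofPred_eq, not_exists, not_and, not_le] at hcon
  exact hω ((hT ω).abs_inner_self_le_of_half_net hS1 hS fun y hy => (hcon y hy).le)

end

/-! ### Weighted Gram operators. -/

/-- The operator `x ↦ ∑ i, c i ⟪z i, x⟫ z i - κ x`. -/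
noncomputable def gramOp {I E : Type*} [NormedAddCommGroup E] [InnerProductSpace ℝ E]
    (s : Finset I) (c : I → ℝ) (z : I → E) (κ : ℝ) : E →ₗ[ℝ] E :=
  ∑ i ∈ s, c i • (innerₛₗ ℝ (z i)).smulRight (z i) - κ • LinearMap.id

section gramOp

variable {I E : Type*} [NormedAddCommGroup E] [InnerProductSpace ℝ E]
    (s : Finset I) (c : I → ℝ) (z : I → E) (κ : ℝ)

lemma gramOp_apply (x : E) : gramOp s c z κ x = ∑ i ∈ s, (c i * ⟪z i, x⟫) • z i - κ • x := by
  simp [gramOp, smul_smul]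

lemma inner_gramOp (x y : E) :
    ⟪gramOp s c z κ x, y⟫ = ∑ i ∈ s, c i * ⟪z i, x⟫ * ⟪z i, y⟫ - κ * ⟪x, y⟫ := by
  simp [gramOp_apply, inner_sub_left, sum_inner, real_inner_smul_left]

lemma gramOp_isSymmetric : (gramOp s c z κ).IsSymmetric := fun x y => by
  have h := inner_gramOp s c z κ y x
  rw [real_inner_comm] at h
  rw [h, inner_gramOp, real_inner_comm x y]
  congr 1
  exact Finset.sum_congr rfl fun i _ => by ring

lemma inner_gramOp_self (x : E) :
    ⟪gramOp s c z κ x, x⟫ = ∑ i ∈ s, c i * ⟪z i, x⟫ ^ 2 - κ * ‖x‖ ^ 2 := by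
  rw [inner_gramOp, real_inner_self_eq_norm_sq]
  congr 1
  exact Finset.sum_congr rfl fun i _ => by ring

end gramOp

/-- With no restriction on θ the parameter b of Bernstein's bound is free; it is chosen to make the
linear term equal to the square root term. -/
lemma measureReal_abs_sum_ge_le_of_forall {I E : Type*} [Fintype I] [MeasurableSpace E]
    {γ : Measure E} [IsProbabilityMeasure γ] {F : E → ℝ} {K : ℝ} (hK : 0 < K)
    (h : ∀ θ, Integrable (fun z => Real.exp (θ * F z)) γ ∧
      ∫ z, Real.exp (θ * F z) ∂γ ≤ Real.exp (K * θ ^ 2))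
    {c : I → ℝ} {s : ℝ} (hc : 0 < ∑ i, c i ^ 2) (hs : 0 < s) :
    (Measure.pi fun _ : I => γ).real
      {ω | 4 * √(K * (∑ i, c i ^ 2) * s) ≤ |∑ i, c i * F (ω i)|} ≤ 2 * Real.exp (-s) := by
  set c₁ := √(∑ i, c i ^ 2) with hc₁
  have hc₁0 : 0 < c₁ := Real.sqrt_pos.2 hc
  have hle : ∀ i, |c i| ≤ c₁ := fun i =>
    Real.abs_le_sqrt (Finset.single_le_sum (f := fun i => c i ^ 2)
      (fun i _ => sq_nonneg _) (Finset.mem_univ i))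
  have hr : 0 < √(K * (∑ i, c i ^ 2) * s) := by positivity
  have := measureReal_abs_sum_ge_le (b := √(K * (∑ i, c i ^ 2) * s) / (c₁ * s)) (by positivity)
    (fun θ _ => h θ) hc₁0 hle hs
  convert this using 5
  field_simp
  ring

/-! ### Concentration of the sums that make up the blocks. -/

section concentration

variable {E : Type*} [NormedAddCommGroup E] [InnerProductSpace ℝ E] [FiniteDimensional ℝ E]
  [MeasurableSpace E] [BorelSpace E] {I : Type*} [Fintype I] {D u : ℝ}

lemma stdGaussian_chiDev_gt_le (hD : Module.finrank ℝ E ≤ D) (hu : 0 < u) :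
    (stdGaussian E).real {z | 2 * √(2 * D * u) + 2 * 4 * u < |chiDev E z|} ≤
      2 * Real.exp (-u) := by
  refine le_trans (measureReal_mono (fun _ hz => ?_) (measure_ne_top _ _))
    (measureReal_abs_ge_le_of_mgf_le (by norm_num) hu fun _ hθ => chiDev_mgf_le hD hθ)
  rw [Set.mem_ofPred_eq] at hz ⊢
  exact hz.le

lemma pi_stdGaussian_chiDev_gt_le (hD : Module.finrank ℝ E ≤ D) (hu : 0 < u) :
    (Measure.pi fun _ : I => stdGaussian E).real
      {z | ¬ ∀ i, |chiDev E (z i)| ≤ 2 * √(2 * D * u) + 2 * 4 * u} ≤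
      Fintype.card I * (2 * Real.exp (-u)) := by
  have e : {z : I → E | ¬ ∀ i, |chiDev E (z i)| ≤ 2 * √(2 * D * u) + 2 * 4 * u} =
      ⋃ i ∈ Finset.univ, (fun z : I → E => z i) ⁻¹'
        {z | 2 * √(2 * D * u) + 2 * 4 * u < |chiDev E z|} := by
    ext; simp
  rw [e]
  calc _ ≤ ∑ i : I, (Measure.pi fun _ : I => stdGaussian E).real ((fun z : I → E => z i) ⁻¹'
        {z | 2 * √(2 * D * u) + 2 * 4 * u < |chiDev E z|}) := measureReal_biUnion_finset_le _ _
    _ ≤ ∑ _i : I, 2 * Real.exp (-u) := by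
        refine Finset.sum_le_sum fun i _ => ?_
        have hm := (measurePreserving_eval (fun _ : I => stdGaussian E) i).measureReal_preimage
          (measurableSet_lt measurable_const measurable_chiDev.abs).nullMeasurableSet
          (s := {z | 2 * √(2 * D * u) + 2 * 4 * u < |chiDev E z|})
        exact hm.le.trans (stdGaussian_chiDev_gt_le hD hu)
    _ = _ := by simp

lemma pi_stdGaussian_sum_chiDev_le (hD : Module.finrank ℝ E ≤ D) (hu : 0 < u) {v : I → ℝ} {m : ℝ}
    (hm : 0 < m) (hv : ∀ i, |v i| ≤ m) :
    (Measure.pi fun _ : I => stdGaussian E).real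
      {z | ¬ |∑ i, v i ^ 2 * chiDev E (z i)| ≤
        2 * √(2 * D * (∑ i, (v i ^ 2) ^ 2) * u) + 2 * (4 * m ^ 2) * u} ≤ 2 * Real.exp (-u) :=
  (measureReal_mono fun _ hz => (not_le.1 hz).le).trans
    (measureReal_abs_sum_ge_le (c := fun i => v i ^ 2) (by norm_num)
      (fun _ hθ => chiDev_mgf_le hD hθ) (by positivity)
      (fun i => by rw [abs_pow]; gcongr; exact hv i) hu)

lemma pi_stdGaussian_norm_sum_smul_le (hD : Module.finrank ℝ E ≤ D) (hs : 0 < 2 * D + u)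
    {c : I → ℝ} (hc : 0 < ∑ i, c i ^ 2) :
    (Measure.pi fun _ : I => stdGaussian E).real
      {z | ¬ ‖∑ i, c i • z i‖ ≤ 2 * (4 * √(1 / 2 * (∑ i, c i ^ 2) * (2 * D + u)))} ≤
      2 * Real.exp (-u) := by
  refine measureReal_norm_gt_le hD (by positivity) fun x hx => ?_
  simp only [sum_inner, real_inner_smul_left]
  exact measureReal_abs_sum_ge_le_of_forall (F := fun z => ⟪z, x⟫) (by norm_num)
    (inner_mgf_le hx) hc hs

lemma pi_stdGaussian_norm_sum_truncDev_smul_le (hD : Module.finrank ℝ E ≤ D) (hs : 0 < 2 * D + u)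
    {R : ℝ} (hR : 0 < R) {c : I → ℝ} (hc : 0 < ∑ i, c i ^ 2) :
    (Measure.pi fun _ : I => stdGaussian E).real
      {z | ¬ ‖∑ i, (c i * truncDev E R (z i)) • z i‖ ≤
        2 * (4 * √(3 * R ^ 2 * (∑ i, c i ^ 2) * (2 * D + u)))} ≤ 2 * Real.exp (-u) := by
  refine measureReal_norm_gt_le hD (by positivity) fun x hx => ?_
  simp only [sum_inner, real_inner_smul_left, mul_assoc (c _)]
  exact measureReal_abs_sum_ge_le_of_forall (F := fun z => truncDev E R z * ⟪z, x⟫)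
    (by positivity) (truncDev_mul_inner_mgf_le' hR.le hx) hc hs

lemma pi_stdGaussian_norm_sum_truncDev_smul_le' (hD : Module.finrank ℝ E ≤ D) (hD1 : 1 ≤ D)
    (hs : 0 < 2 * D + u) {R : ℝ} (hR : 0 < R) {c : I → ℝ} {m : ℝ} (hm : 0 < m)
    (hc : ∀ i, |c i| ≤ m) :
    (Measure.pi fun _ : I => stdGaussian E).real
      {z | ¬ ‖∑ i, (c i * truncDev E R (z i)) • z i‖ ≤
        2 * (2 * √(327680 * D * (∑ i, c i ^ 2) * (2 * D + u)) + 2 * (16 * R * m) * (2 * D + u))} ≤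
      2 * Real.exp (-u) := by
  refine measureReal_norm_gt_le hD (by positivity) fun x hx => ?_
  simp only [sum_inner, real_inner_smul_left, mul_assoc (c _)]
  exact measureReal_abs_sum_ge_le (F := fun z => truncDev E R z * ⟪z, x⟫)
    (by positivity) (fun θ hθ => truncDev_mul_inner_mgf_le hD hD1 hR.le hx hθ) hm hc hs

lemma pi_stdGaussian_gramOp_le (hD : Module.finrank ℝ E ≤ D) (hs : 0 < 2 * D + u)
    {c : I → ℝ} {m : ℝ} (hm : 0 < m) (hc : ∀ i, |c i| ≤ m) :
    (Measure.pi fun _ : I => stdGaussian E).real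
      {z | ¬ ∀ x, |⟪gramOp Finset.univ c z (∑ i, c i) x, x⟫| ≤
        32 * (2 * √(2 * (∑ i, c i ^ 2) * (2 * D + u)) + 2 * (4 * m) * (2 * D + u)) * ‖x‖ ^ 2} ≤
      2 * Real.exp (-u) := by
  refine measureReal_quadraticForm_gt_le hD (fun _ => gramOp_isSymmetric _ _ _ _) fun x hx => ?_
  simp only [inner_gramOp_self, hx, one_pow, mul_one, ← Finset.sum_sub_distrib]
  have e : ∀ (i : I) (z : I → E), c i * ⟪z i, x⟫ ^ 2 - c i = c i * (⟪z i, x⟫ ^ 2 - 1) :=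
    fun i z => by ring
  simp only [e]
  exact measureReal_abs_sum_ge_le (F := fun z => ⟪z, x⟫ ^ 2 - 1) (by norm_num)
    (fun θ hθ => inner_sq_sub_one_mgf_le hx hθ) hm hc hs

/-- Each summand has mean near 2, hence the shift by twice the number of rows. The last term of the
bound is the bias caused by truncating at R, a level exceeded with probability at most 2e^(-u). -/
lemma pi_stdGaussian_gramOp_truncDev_le (hD : Module.finrank ℝ E ≤ D) (hD1 : 1 ≤ D) (hu : 0 < u)
    {R : ℝ} (hR : R = 2 * √(2 * D * u) + 2 * 4 * u) :
    (Measure.pi fun _ : I => stdGaussian E).real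
      {z | ¬ ∀ x, |⟪gramOp Finset.univ (fun i => truncDev E R (z i)) z (2 * Fintype.card I) x, x⟫| ≤
        32 * (2 * √(327680 * D * Fintype.card I * (2 * D + u)) + 2 * (16 * R) * (2 * D + u) +
          Fintype.card I * (327682 * √D * Real.exp (-(u / 2)))) * ‖x‖ ^ 2} ≤
      2 * Real.exp (-u) := by
  have hR0 : 0 < R := by rw [hR]; positivity
  have hs : 0 < 2 * D + u := by positivity
  refine measureReal_quadraticForm_gt_le hD (fun _ => gramOp_isSymmetric _ _ _ _) fun x hx => ?_
  simp only [inner_gramOp_self, hx, one_pow, mul_one]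
  set M := ∫ w, truncDev E R w * ⟪w, x⟫ ^ 2 ∂(stdGaussian E) with hM
  have hM2 : |M - 2| ≤ 327682 * √D * Real.exp (-(u / 2)) := by
    have hD0 : 0 < √D := by positivity
    -- This q balances q e^(-u) against D/q.
    have h := abs_integral_truncDev_mul_inner_sq_sub_two_le (R := R) hD hD1 hx
      (q := √D * Real.exp (u / 2)) (by positivity)
    refine h.trans ?_
    have h1 : (stdGaussian E).real {z | R < |chiDev E z|} ≤ 2 * Real.exp (-u) := by
      rw [hR]; exact stdGaussian_chiDev_gt_le hD hu
    have h2 : √D * Real.exp (u / 2) * (2 * Real.exp (-u)) = 2 * √D * Real.exp (-(u / 2)) := by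
      rw [show -(u / 2) = u / 2 + -u by ring, Real.exp_add]; ring
    have h3 : 327680 * D / (√D * Real.exp (u / 2)) = 327680 * √D * Real.exp (-(u / 2)) := by
      rw [Real.exp_neg]
      field_simp
      rw [Real.sq_sqrt (by linarith)]
    rw [h3]
    have h4 := mul_le_mul_of_nonneg_left h1 (by positivity : 0 ≤ √D * Real.exp (u / 2))
    rw [h2] at h4
    linarith
  have key := measureReal_abs_sum_ge_le (I := I) (γ := stdGaussian E) (c := fun _ => 1) (c₁ := 1)
    (F := fun z => truncDev E R z * ⟪z, x⟫ ^ 2 - M) (b := 16 * R) (s := 2 * D + u)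
    (K := 327680 * D) (by positivity)
    (fun θ hθ => truncDev_mul_inner_sq_mgf_le hD hD1 hR0.le hx hθ) one_pos (by simp) hs
  refine (measureReal_mono fun z hz => ?_).trans key
  simp only [Set.mem_ofPred_eq, one_pow, one_mul, mul_one, Finset.sum_const, Finset.card_univ,
    nsmul_eq_mul, Finset.sum_sub_distrib] at hz ⊢
  set S := ∑ i, truncDev E R (z i) * ⟪z i, x⟫ ^ 2
  have h5 : |S - 2 * Fintype.card I| ≤ |S - Fintype.card I * M| + Fintype.card I * |M - 2| := by
    calc |S - 2 * Fintype.card I| = |(S - Fintype.card I * M) + Fintype.card I * (M - 2)| := by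
          ring_nf
      _ ≤ |S - Fintype.card I * M| + |Fintype.card I * (M - 2)| := abs_add_le _ _
      _ = _ := by rw [abs_mul, Nat.abs_cast]
  have h6 := mul_le_mul_of_nonneg_left hM2 (Nat.cast_nonneg (α := ℝ) (Fintype.card I))
  linarith

end concentration

/-! ### A row against vectors independent of it. -/

section leaveOneOut

variable {E : Type*} [NormedAddCommGroup E] [InnerProductSpace ℝ E] [FiniteDimensional ℝ E]
  [MeasurableSpace E] [BorelSpace E] {I : Type*} [Fintype I]

lemma stdGaussian_abs_inner_gt_le {s : ℝ} (hs : 0 < s) (h : E) :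
    (stdGaussian E) {z | 4 * √s * ‖h‖ < |⟪z, h⟫|} ≤ ENNReal.ofReal (2 * Real.exp (-s)) := by
  by_cases hh : h = 0
  · simp [hh]
  have hn : 0 < ‖h‖ := norm_pos_iff.2 hh
  -- The choice b = 1/√s turns the linear term 2bs into 2√s.
  have h1 := measureReal_abs_ge_le_of_mgf_le (b := √(1 / s)) (V := 1 / 2) (by positivity) hs
    (fun θ _ => inner_mgf_le (x := ‖h‖⁻¹ • h) (by simp [norm_smul, hn.ne']) θ)
  rw [← ofReal_measureReal]
  refine ENNReal.ofReal_le_ofReal ((measureReal_mono fun z hz => ?_).trans h1)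
  simp only [Set.mem_ofPred_eq, real_inner_smul_right, abs_mul, abs_of_pos (inv_pos.2 hn)] at hz ⊢
  have e1 : √(1 / s) * s = √s := by
    rw [Real.sqrt_div zero_le_one, Real.sqrt_one, one_div, inv_mul_eq_div, Real.div_sqrt]
  have e2 : √(1 / 2 * s) ≤ √s := Real.sqrt_le_sqrt (by linarith)
  rw [← div_eq_inv_mul, le_div_iff₀ hn]
  refine le_trans ?_ hz.le
  gcongr
  rw [mul_assoc, e1]
  linarith

/-- A Gaussian row is nearly orthogonal to every vector that does not depend on that row. -/
lemma pi_stdGaussian_abs_inner_gt_le [DecidableEq I] {s : ℝ} (hs : 0 < s) (j : I)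
    {h : (I → E) → E} (hm : Measurable h) (hj : ∀ z, h (Function.update z j 0) = h z) :
    (Measure.pi fun _ : I => stdGaussian E) {z | 4 * √s * ‖h z‖ < |⟪z j, h z⟫|} ≤
      ENNReal.ofReal (2 * Real.exp (-s)) := by
  set P := Measure.pi fun _ : I => stdGaussian E with hP
  -- By `hj`, h is a function of the other rows, with 0 in place of row j.
  have hind : IndepFun (fun z : I → E => z j) h P := by
    have h0 : iIndepFun (fun i (z : I → E) => z i) P :=
      iIndepFun_pi (μ := fun _ : I => stdGaussian E) (X := fun _ z => z) fun _ => by fun_prop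
    have h1 := h0.indepFun_finset {j} (Finset.univ.erase j) (by simp) (fun i => by fun_prop)
    have hφ : Measurable fun r : ({j} : Finset I) → E => r ⟨j, by simp⟩ := measurable_pi_apply _
    have h2 := h1.comp (φ := fun r : ({j} : Finset I) → E => r ⟨j, by simp⟩)
      (ψ := fun r => h fun i => if hi : i ∈ Finset.univ.erase j then r ⟨i, hi⟩ else 0)
      hφ
      (hm.comp (measurable_pi_lambda _ fun i => by
        by_cases hi : i ∈ Finset.univ.erase j
        · simp only [hi, dite_true]; fun_prop
        · simp only [hi, dite_false]; fun_prop))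
    have e : (fun r : {i // i ∈ Finset.univ.erase j} → E =>
        h fun i => if hi : i ∈ Finset.univ.erase j then r ⟨i, hi⟩ else 0) ∘
        (fun (z : I → E) (i : {i // i ∈ Finset.univ.erase j}) => z i) = h := by
      ext1 z
      simp only [Function.comp]
      rw [← hj z]
      congr 1
      ext1 i
      by_cases hi : i = j
      · subst hi; simp
      · simp [hi]
    rw [e] at h2
    exact h2
  have hlaw := (indepFun_iff_map_prod_eq_prod_map_map
    (measurable_pi_apply j).aemeasurable hm.aemeasurable).1 hind
  have hpi : P.map (fun z => z j) = stdGaussian E :=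
    (measurePreserving_eval (fun _ : I => stdGaussian E) j).map_eq
  rw [hpi] at hlaw
  have hset : MeasurableSet {p : E × E | 4 * √s * ‖p.2‖ < |⟪p.1, p.2⟫|} :=
    measurableSet_lt (by fun_prop) (by fun_prop)
  have hpm : IsProbabilityMeasure (P.map h) := Measure.isProbabilityMeasure_map hm.aemeasurable
  calc P {z | 4 * √s * ‖h z‖ < |⟪z j, h z⟫|}
      = P.map (fun z => (z j, h z)) {p : E × E | 4 * √s * ‖p.2‖ < |⟪p.1, p.2⟫|} := by
        rw [Measure.map_apply (by fun_prop) hset]; rfl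
    -- The joint law is a product, so h can be frozen and the bound for a fixed vector applies.
    _ = ∫⁻ y, stdGaussian E {x | 4 * √s * ‖y‖ < |⟪x, y⟫|} ∂(P.map h) := by
        rw [hlaw, Measure.prod_apply_symm hset]; rfl
    _ ≤ ∫⁻ _y, ENNReal.ofReal (2 * Real.exp (-s)) ∂(P.map h) :=
        lintegral_mono fun y => stdGaussian_abs_inner_gt_le hs y
    _ = _ := by simp

/-- The factor k + 1 in the threshold makes the failure probabilities decay like e^(-(k+1)u), so one
geometric sum covers every term of a Neumann series. -/
lemma pi_stdGaussian_forall_abs_inner_le [DecidableEq I] {u : ℝ} (hu : 1 ≤ u)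
    {h : I → ℕ → (I → E) → E} (hm : ∀ j k, Measurable (h j k))
    (hj : ∀ j k z, h j k (Function.update z j 0) = h j k z) :
    (Measure.pi fun _ : I => stdGaussian E).real
      {z | ¬ ∀ j k, |⟪z j, h j k z⟫| ≤ 4 * √u * (k + 1) * ‖h j k z‖} ≤
      Fintype.card I * (4 * Real.exp (-u)) := by
  set P := Measure.pi fun _ : I => stdGaussian E with hP
  have hu0 : 0 < u := by linarith
  have hsub : {z | ¬ ∀ j k, |⟪z j, h j k z⟫| ≤ 4 * √u * (k + 1) * ‖h j k z‖} ⊆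
      ⋃ j ∈ Finset.univ, ⋃ k : ℕ, {z | 4 * √((k + 1) * u) * ‖h j k z‖ < |⟪z j, h j k z⟫|} := by
    intro z hz
    simp only [Set.mem_ofPred_eq, not_forall, not_le] at hz
    obtain ⟨j, k, hjk⟩ := hz
    simp only [Set.mem_iUnion, Set.mem_ofPred_eq]
    refine ⟨j, Finset.mem_univ _, k, lt_of_le_of_lt ?_ hjk⟩
    have hk : √((k + 1) * u) ≤ √u * (k + 1) := by
      rw [Real.sqrt_mul (by positivity), mul_comm]
      gcongr
      rw [Real.sqrt_le_left (by positivity)]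
      nlinarith [Nat.cast_nonneg (α := ℝ) k]
    rw [mul_assoc 4 (√u)]
    gcongr
  have hexp : Real.exp (-u) ≤ 1 / 2 := by
    have h1 : Real.exp (-u) ≤ Real.exp (-1) := Real.exp_le_exp.2 (by linarith)
    linarith [Real.exp_neg_one_lt_d9]
  have hgeom : HasSum (fun k : ℕ => 2 * Real.exp (-u) * Real.exp (-u) ^ k)
      (2 * Real.exp (-u) * (1 - Real.exp (-u))⁻¹) :=
    (hasSum_geometric_of_lt_one (Real.exp_pos _).le (by linarith)).mul_left _
  have hk : ∀ j, P (⋃ k : ℕ, {z | 4 * √((k + 1) * u) * ‖h j k z‖ < |⟪z j, h j k z⟫|}) ≤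
      ENNReal.ofReal (4 * Real.exp (-u)) := fun j => by
    calc _ ≤ ∑' k : ℕ, P {z | 4 * √((k + 1) * u) * ‖h j k z‖ < |⟪z j, h j k z⟫|} :=
          measure_iUnion_le _
      _ ≤ ∑' k : ℕ, ENNReal.ofReal (2 * Real.exp (-u) * Real.exp (-u) ^ k) := by
          refine ENNReal.tsum_le_tsum fun k => ?_
          refine (pi_stdGaussian_abs_inner_gt_le (by positivity) j (hm j k) (hj j k)).trans ?_
          refine ENNReal.ofReal_le_ofReal (le_of_eq ?_)
          rw [mul_assoc, ← Real.exp_nat_mul, ← Real.exp_add]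
          ring_nf
      _ = ENNReal.ofReal (2 * Real.exp (-u) * (1 - Real.exp (-u))⁻¹) := by
          rw [← ENNReal.ofReal_tsum_of_nonneg (fun k => by positivity) hgeom.summable,
            hgeom.tsum_eq]
      _ ≤ _ := by
          refine ENNReal.ofReal_le_ofReal ?_
          have h2 : (1 - Real.exp (-u))⁻¹ ≤ 2 := by
            rw [inv_le_comm₀ (by linarith) (by norm_num)]; linarith
          calc _ ≤ 2 * Real.exp (-u) * 2 := by gcongr
            _ = _ := by ring
  refine (measureReal_mono hsub (measure_ne_top _ _)).trans
    ((measureReal_biUnion_finset_le _ _).trans ?_)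
  calc _ ≤ ∑ _j : I, 4 * Real.exp (-u) := Finset.sum_le_sum fun j _ =>
        ENNReal.toReal_le_of_le_ofReal (by positivity) (hk j)
    _ = _ := by simp

end leaveOneOut

/-! ### Deterministic entrywise perturbation. -/

section perturbation

variable {E : Type*} [NormedAddCommGroup E] [InnerProductSpace ℝ E]

/-- The subtracted term closes the induction; afterwards only the bound 2 matters. -/
lemma sum_range_succ_mul_quarter_pow_le (K : ℕ) :
    ∑ k ∈ Finset.range K, ((k : ℝ) + 1) * (1 / 4) ^ k ≤ 2 - (4 / 3 * K + 2) * (1 / 4) ^ K := by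
  induction K with
  | zero => simp
  | succ K ih =>
    rw [Finset.sum_range_succ]
    have : (0 : ℝ) < (1 / 4) ^ K := by positivity
    have hK : (0 : ℝ) ≤ K := K.cast_nonneg
    rw [pow_succ]
    push_cast
    nlinarith

lemma norm_iterate_le {T : E →ₗ[ℝ] E} {ρ : ℝ} (hρ : 0 ≤ ρ) (hT : ∀ x, ‖T x‖ ≤ ρ * ‖x‖) (k : ℕ)
    (x : E) : ‖T^[k] x‖ ≤ ρ ^ k * ‖x‖ := by
  induction k with
  | zero => simp
  | succ k ih =>
    rw [Function.iterate_succ_apply']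
    calc _ ≤ ρ * ‖T^[k] x‖ := hT _
      _ ≤ ρ * (ρ ^ k * ‖x‖) := by gcongr
      _ = _ := by ring

/-- Neumann series bound for a linear functional of the solution `w` of `l w = T w + b`. -/
lemma abs_inner_le_of_resolvent {T : E →ₗ[ℝ] E} {ρ l H : ℝ} (hl : 0 < |l|) (hρ : 0 ≤ ρ)
    (hρl : 4 * ρ ≤ |l|) (hT : ∀ x, ‖T x‖ ≤ ρ * ‖x‖) {w b g : E} (hw : l • w = T w + b)
    (hH : ∀ k : ℕ, |⟪g, T^[k] b⟫| ≤ (k + 1) * ρ ^ k * H) : |⟪g, w⟫| ≤ 2 * H / |l| := by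
  have hH0 : 0 ≤ H := by
    have := (abs_nonneg _).trans (hH 0)
    simpa using this
  have hl0 : l ≠ 0 := abs_pos.1 hl
  have hr : ρ / |l| ≤ 1 / 4 := by rw [div_le_iff₀ hl]; linarith
  have hr0 : 0 ≤ ρ / |l| := by positivity
  -- Applying T^K to the equation expresses one remainder by the next and the K-th Neumann term.
  have step : ∀ K : ℕ, l * ⟪g, T^[K] w⟫ = ⟪g, T^[K + 1] w⟫ + ⟪g, T^[K] b⟫ := fun K => by
    have h1 : T^[K] (l • w) = T^[K] (T w) + T^[K] b := by
      rw [hw, ← Module.End.pow_apply, map_add]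
      simp [Module.End.pow_apply]
    have h2 : T^[K] (l • w) = l • T^[K] w := by
      rw [← Module.End.pow_apply, map_smul, Module.End.pow_apply]
    rw [h2] at h1
    have h3 := congrArg (fun y => ⟪g, y⟫) h1
    simp only [real_inner_smul_right, inner_add_right] at h3
    rw [h3, Function.iterate_succ_apply]
  have main : ∀ K : ℕ, |⟪g, w⟫| ≤
      H / |l| * ∑ k ∈ Finset.range K, ((k : ℝ) + 1) * (1 / 4) ^ k + |⟪g, T^[K] w⟫| / |l| ^ K := by
    intro K
    induction K with
    | zero => simp
    | succ K ih =>
      refine ih.trans ?_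
      rw [Finset.sum_range_succ, mul_add, add_assoc]
      gcongr
      have h1 : |l| * |⟪g, T^[K] w⟫| ≤ |⟪g, T^[K + 1] w⟫| + (K + 1) * ρ ^ K * H := by
        rw [← abs_mul, step K]
        exact (abs_add_le _ _).trans (by gcongr; exact hH K)
      have h2 : ρ ^ K / |l| ^ K ≤ (1 / 4) ^ K := by rw [← div_pow]; gcongr
      calc |⟪g, T^[K] w⟫| / |l| ^ K = (|l| * |⟪g, T^[K] w⟫|) / |l| ^ (K + 1) := by
            rw [pow_succ]; field_simp
        _ ≤ (|⟪g, T^[K + 1] w⟫| + (K + 1) * ρ ^ K * H) / |l| ^ (K + 1) := by gcongr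
        _ = H / |l| * ((K + 1) * (ρ ^ K / |l| ^ K)) + |⟪g, T^[K + 1] w⟫| / |l| ^ (K + 1) := by
            rw [pow_succ]; field_simp; ring
        _ ≤ _ := by gcongr
  -- The remainder is O(4^(-K)); letting K grow leaves only the series.
  have hbound : ∀ K : ℕ, |⟪g, w⟫| ≤ 2 * H / |l| + ‖g‖ * ‖w‖ * (1 / 4) ^ K := by
    intro K
    have h2 : ρ ^ K / |l| ^ K ≤ (1 / 4) ^ K := by rw [← div_pow]; gcongr
    calc _ ≤ _ := main K
      _ ≤ H / |l| * 2 + ‖g‖ * ‖w‖ * (ρ ^ K / |l| ^ K) := by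
          gcongr
          · refine (sum_range_succ_mul_quarter_pow_le K).trans ?_
            have : (0 : ℝ) ≤ (4 / 3 * K + 2) * (1 / 4) ^ K := by positivity
            linarith
          · rw [← mul_div_assoc]
            gcongr
            calc |⟪g, T^[K] w⟫| ≤ ‖g‖ * ‖T^[K] w‖ := abs_real_inner_le_norm _ _
              _ ≤ ‖g‖ * (ρ ^ K * ‖w‖) := by gcongr; exact norm_iterate_le hρ hT K w
              _ = _ := by ring
      _ ≤ 2 * H / |l| + ‖g‖ * ‖w‖ * (1 / 4) ^ K := by
          gcongr
          exact le_of_eq (by ring)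
  have hlim : Tendsto (fun K : ℕ => 2 * H / |l| + ‖g‖ * ‖w‖ * (1 / 4 : ℝ) ^ K) atTop
      (nhds (2 * H / |l| + ‖g‖ * ‖w‖ * 0)) :=
    ((tendsto_pow_atTop_nhds_zero_of_lt_one (by norm_num) (by norm_num)).const_mul _).const_add _
  have := ge_of_tendsto' hlim hbound
  simpa using this

variable {I : Type*} [Fintype I] [DecidableEq I]

lemma gramOp_univ_eq_add (a : I → ℝ) (g : I → E) (κ : ℝ) (j : I) (x : E) :
    gramOp Finset.univ a g κ x = gramOp (Finset.univ.erase j) a g κ x + (a j * ⟪g j, x⟫) • g j := by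
  rw [gramOp_apply, gramOp_apply, ← Finset.sum_erase_add _ _ (Finset.mem_univ j)]
  abel

/-- Entrywise perturbation bound for an eigenvector `(u₁, w)` of a block matrix whose corner
dominates its other blocks, by comparison with the matrices that leave out one row. -/
lemma exists_sign_entrywise_close {a v : I → ℝ} {g : I → E} {κ lam η Q l u₁ : ℝ} {w : E}
    (hη : 0 ≤ η) (hηlam : 32 * η ≤ |lam|) (hlam : 0 < |lam|) (hQ : 0 ≤ Q)
    (hl : |lam| - η ≤ |l|) (hunit : u₁ ^ 2 + ‖w‖ ^ 2 = 1)
    (hw : l • w = gramOp Finset.univ a g κ w + u₁ • ∑ i, (a i * v i) • g i)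
    (hT : ∀ x, ‖gramOp Finset.univ a g κ x‖ ≤ η * ‖x‖) (hβ : ‖∑ i, (a i * v i) • g i‖ ≤ η)
    (ha : ∀ j, |a j| * ‖g j‖ ^ 2 ≤ η) (hav : ∀ j, |a j * v j| * ‖g j‖ ≤ η)
    (hloo : ∀ (j : I) (k : ℕ), |⟪g j, (gramOp (Finset.univ.erase j) a g κ)^[k]
        (∑ i ∈ Finset.univ.erase j, (a i * v i) • g i)⟫| ≤
      Q * (k + 1) * ‖(gramOp (Finset.univ.erase j) a g κ)^[k]
        (∑ i ∈ Finset.univ.erase j, (a i * v i) • g i)‖) :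
    ∃ s : ℝ, (s = 1 ∨ s = -1) ∧
      ∀ j, |s * (v j * u₁ + ⟪g j, w⟫) - v j| ≤ 32 * η / |lam| * (|v j| + Q) := by
  have hl2 : |lam| / 2 ≤ |l| := by linarith
  have hlpos : 0 < |l| := by linarith
  have hl16 : 16 * η ≤ |l| := by linarith
  have hu1 : |u₁| ≤ 1 := by
    rw [← sq_le_one_iff_abs_le_one]
    nlinarith [sq_nonneg ‖w‖]
  -- The tail equation gives |l| ‖w‖ ≤ η (‖w‖ + 1), and |l| is at least |lam| - η.
  have hwn : ‖w‖ ≤ 4 * η / |lam| := by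
    have h1 : |l| * ‖w‖ ≤ η * ‖w‖ + η := by
      rw [← Real.norm_eq_abs, ← norm_smul, hw]
      refine (norm_add_le _ _).trans (add_le_add (hT w) ?_)
      rw [norm_smul, Real.norm_eq_abs]
      calc |u₁| * _ ≤ 1 * η := by gcongr
        _ = η := one_mul _
    rw [le_div_iff₀ hlam]
    nlinarith [norm_nonneg w]
  have hw1 : ‖w‖ ≤ 1 := by nlinarith [sq_nonneg u₁, norm_nonneg w]
  -- 1 - |u₁| ≤ 1 - u₁² = ‖w‖² ≤ ‖w‖.
  have hu1' : 1 - |u₁| ≤ 4 * η / |lam| := by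
    have h1 : 1 - |u₁| ≤ 1 - u₁ ^ 2 := by
      rw [← sq_abs]; nlinarith [abs_nonneg u₁]
    nlinarith [norm_nonneg w]
  have hx : ∀ j, |⟪g j, w⟫| ≤ 16 * η / |lam| * (|v j| + Q) := by
    intro j
    set Tj := gramOp (Finset.univ.erase j) a g κ with hTj
    set βj := ∑ i ∈ Finset.univ.erase j, (a i * v i) • g i with hβj
    -- Deleting row j costs at most one more η, by `ha`.
    have hTjn : ∀ x, ‖Tj x‖ ≤ 2 * η * ‖x‖ := fun x => by
      have h1 := gramOp_univ_eq_add a g κ j x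
      have h2 : Tj x = gramOp Finset.univ a g κ x - (a j * ⟪g j, x⟫) • g j := by
        rw [h1]; abel
      rw [h2]
      refine (norm_sub_le _ _).trans ?_
      rw [norm_smul, Real.norm_eq_abs, abs_mul]
      have h3 : |a j| * |⟪g j, x⟫| * ‖g j‖ ≤ η * ‖x‖ := by
        calc |a j| * |⟪g j, x⟫| * ‖g j‖ ≤ |a j| * (‖g j‖ * ‖x‖) * ‖g j‖ := by
              gcongr; exact abs_real_inner_le_norm _ _
          _ = |a j| * ‖g j‖ ^ 2 * ‖x‖ := by ring
          _ ≤ _ := by gcongr; exact ha j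
      linarith [hT x]
    have hβjn : ‖βj‖ ≤ 2 * η := by
      have h2 : βj = ∑ i, (a i * v i) • g i - (a j * v j) • g j := by
        rw [← Finset.sum_erase_add _ _ (Finset.mem_univ j)]; simp [hβj]
      rw [h2]
      refine (norm_sub_le _ _).trans ?_
      rw [norm_smul, Real.norm_eq_abs]
      linarith [hav j]
    set x := |⟪g j, w⟫| with hxdef
    have hx0 : 0 ≤ x := abs_nonneg _
    -- The deleted row re-enters only through its full entry v_j u₁ + ⟪g_j, w⟫ times g_j. Apart from
    -- that term, g_j meets only vectors built from the other rows.
    have hwj : l • w = Tj w + (u₁ • βj + (a j * (v j * u₁ + ⟪g j, w⟫)) • g j) := by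
      rw [hw, gramOp_univ_eq_add a g κ j w, ← Finset.sum_erase_add _ _ (Finset.mem_univ j)]
      rw [← hTj, ← hβj]
      module
    have key := abs_inner_le_of_resolvent (g := g j) (H := Q * (2 * η) + η * (|v j| + x)) hlpos
      (by positivity : 0 ≤ 2 * η) (by linarith) hTjn hwj fun k => ?_
    -- The unknown x also occurs on the right, with coefficient 2η ≤ |l|/8, and is absorbed.
    · rw [← hxdef, le_div_iff₀ hlpos] at key
      have h5 : 0 ≤ η * (|v j| + Q) := by positivity
      rw [div_mul_eq_mul_div, le_div_iff₀ hlam]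
      nlinarith [abs_nonneg (v j)]
    · have hlin : Tj^[k] (u₁ • βj + (a j * (v j * u₁ + ⟪g j, w⟫)) • g j) =
          u₁ • Tj^[k] βj + (a j * (v j * u₁ + ⟪g j, w⟫)) • Tj^[k] (g j) := by
        simp only [← Module.End.pow_apply, map_add, map_smul]
      rw [hlin, inner_add_right, real_inner_smul_right, real_inner_smul_right]
      have hk1 : (1 : ℝ) ≤ k + 1 := by linarith [k.cast_nonneg (α := ℝ)]
      have t1 : |u₁ * ⟪g j, Tj^[k] βj⟫| ≤ (k + 1) * (2 * η) ^ k * (Q * (2 * η)) := by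
        rw [abs_mul]
        calc |u₁| * |⟪g j, Tj^[k] βj⟫| ≤ 1 * (Q * (k + 1) * ‖Tj^[k] βj‖) := by
              gcongr; exact hloo j k
          _ ≤ 1 * (Q * (k + 1) * ((2 * η) ^ k * (2 * η))) := by
              gcongr
              exact (norm_iterate_le (by positivity) hTjn k βj).trans (by gcongr)
          _ = _ := by ring
      have t2 : |a j * (v j * u₁ + ⟪g j, w⟫) * ⟪g j, Tj^[k] (g j)⟫| ≤
          (k + 1) * (2 * η) ^ k * (η * (|v j| + x)) := by
        rw [abs_mul, abs_mul]
        have e1 : |v j * u₁ + ⟪g j, w⟫| ≤ |v j| + x := by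
          refine (abs_add_le _ _).trans ?_
          rw [abs_mul]
          gcongr
          exact mul_le_of_le_one_right (abs_nonneg _) hu1
        have e2 : |⟪g j, Tj^[k] (g j)⟫| ≤ (2 * η) ^ k * ‖g j‖ ^ 2 := by
          calc _ ≤ ‖g j‖ * ‖Tj^[k] (g j)‖ := abs_real_inner_le_norm _ _
            _ ≤ ‖g j‖ * ((2 * η) ^ k * ‖g j‖) := by
                gcongr; exact norm_iterate_le (by positivity) hTjn k _
            _ = _ := by ring
        calc _ ≤ |a j| * (|v j| + x) * ((2 * η) ^ k * ‖g j‖ ^ 2) := by gcongr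
          _ = 1 * (2 * η) ^ k * ((|a j| * ‖g j‖ ^ 2) * (|v j| + x)) := by ring
          _ ≤ _ := by gcongr; exact ha j
      refine (abs_add_le _ _).trans ?_
      rw [mul_add ((k + 1) * (2 * η) ^ k)]
      exact add_le_add t1 t2
  -- With s the sign of u₁, the error consists of v_j (1 - |u₁|) and ⟪g_j, w⟫ only.
  have hfin : ∀ (s : ℝ), |s| = 1 → s * u₁ = |u₁| → ∀ j,
      |s * (v j * u₁ + ⟪g j, w⟫) - v j| ≤ 32 * η / |lam| * (|v j| + Q) := by
    intro s hs hsu j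
    have e : s * (v j * u₁ + ⟪g j, w⟫) - v j = -(v j * (1 - |u₁|)) + s * ⟪g j, w⟫ := by
      rw [← hsu]; ring
    rw [e]
    refine (abs_add_le _ _).trans ?_
    rw [abs_neg, abs_mul, abs_mul, hs, one_mul, abs_of_nonneg (sub_nonneg.2 hu1)]
    have h1 : |v j| * (1 - |u₁|) ≤ |v j| * (4 * η / |lam|) := by gcongr
    have h2 : 0 ≤ η / |lam| := by positivity
    have h3 := hx j
    have e2 : 16 * η / |lam| * (|v j| + Q) = 16 * (η / |lam|) * |v j| + 16 * (η / |lam|) * Q := by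
      ring
    have e3 : 32 * η / |lam| * (|v j| + Q) = 32 * (η / |lam|) * |v j| + 32 * (η / |lam|) * Q := by
      ring
    have e4 : |v j| * (4 * η / |lam|) = 4 * (η / |lam|) * |v j| := by ring
    rw [e2] at h3
    rw [e4] at h1
    rw [e3]
    nlinarith [mul_nonneg h2 hQ, mul_nonneg h2 (abs_nonneg (v j))]
  rcases le_total 0 u₁ with h | h
  · exact ⟨1, Or.inl rfl, hfin 1 (by simp) (by rw [abs_of_nonneg h, one_mul])⟩
  · exact ⟨-1, Or.inr rfl, hfin (-1) (by simp) (by rw [abs_of_nonpos h]; ring)⟩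

end perturbation

/-! ### The ℓ^p norms as sums. -/

section ellNorm

variable {k : ℕ}

lemma ellNorm_two_sq (x : Fin k → ℝ) : ellNorm 2 x ^ 2 = ∑ i, x i ^ 2 := by
  rw [ellNorm, EuclideanSpace.real_norm_sq_eq]

lemma ellNorm_pow_nat (p : ℕ) (hp : p ≠ 0) (x : Fin k → ℝ) :
    ellNorm (p : ℝ≥0∞) x ^ p = ∑ i, |x i| ^ p := by
  have hp' : 0 < ((p : ℝ≥0∞)).toReal := by simpa using Nat.pos_of_ne_zero hp
  rw [ellNorm, PiLp.norm_eq_sum hp']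
  simp only [ENNReal.toReal_natCast, Real.rpow_natCast, Real.norm_eq_abs]
  rw [← Real.rpow_natCast, ← Real.rpow_mul (Finset.sum_nonneg fun i _ => by positivity)]
  rw [one_div, inv_mul_cancel₀ (by exact_mod_cast hp), Real.rpow_one]

lemma ellNorm_four_pow (x : Fin k → ℝ) : ellNorm 4 x ^ 4 = ∑ i, x i ^ 4 := by
  have := ellNorm_pow_nat 4 (by norm_num) x
  simpa only [Nat.cast_ofNat, (show Even 4 by decide).pow_abs] using this

lemma ellNorm_six_pow (x : Fin k → ℝ) : ellNorm 6 x ^ 6 = ∑ i, x i ^ 6 := by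
  have := ellNorm_pow_nat 6 (by norm_num) x
  simpa only [Nat.cast_ofNat, (show Even 6 by decide).pow_abs] using this

lemma ellNorm_nonneg (p : ℝ≥0∞) [Fact (1 ≤ p)] (x : Fin k → ℝ) : 0 ≤ ellNorm p x := norm_nonneg _

lemma abs_le_ellNorm_top (x : Fin k → ℝ) (i : Fin k) : |x i| ≤ ellNorm ∞ x :=
  PiLp.norm_apply_le (WithLp.toLp ∞ x : PiLp ∞ fun _ : Fin k => ℝ) i

end ellNorm

/-! ### The spectral matrix: invariance and block form. -/

section spectralMatrix

variable {N n : ℕ}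

lemma spectralMatrix_isHermitian (A : Matrix (Fin N) (Fin n) ℝ) :
    (spectralMatrix A).IsHermitian := by
  ext i j
  simp [spectralMatrix, Matrix.sum_apply, Matrix.vecMulVec_apply, Matrix.one_apply, mul_comm,
    eq_comm]

lemma spectralMatrix_mulVec (A : Matrix (Fin N) (Fin n) ℝ) (u : Fin n → ℝ) :
    spectralMatrix A *ᵥ u = ∑ i, ((ellNorm 2 (A i) ^ 2 - ((n : ℝ) - 1) / N) * (A i ⬝ᵥ u)) • A i
      - (3 / (N : ℝ)) • u := by
  rw [spectralMatrix, Matrix.sub_mulVec, Matrix.sum_mulVec, Matrix.smul_mulVec, Matrix.one_mulVec]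
  congr 1
  refine Finset.sum_congr rfl fun i _ => ?_
  rw [Matrix.smul_mulVec, Matrix.vecMulVec_mulVec, mul_smul]
  simp [op_smul_eq_smul]

lemma ellNorm_two_sq_eq_dotProduct (x : Fin n → ℝ) : ellNorm 2 x ^ 2 = x ⬝ᵥ x := by
  rw [ellNorm_two_sq, dotProduct]
  exact Finset.sum_congr rfl fun i _ => by ring

lemma mul_row_eq (A : Matrix (Fin N) (Fin n) ℝ) (Q : Matrix (Fin n) (Fin n) ℝ) (j : Fin N) :
    (A * Q) j = Qᵀ *ᵥ A j := by
  rw [Matrix.mulVec_transpose]; rfl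

lemma orthogonal_mulVec_dotProduct {Q : Matrix (Fin n) (Fin n) ℝ}
    (hQ : Q ∈ Matrix.orthogonalGroup (Fin n) ℝ) (x y : Fin n → ℝ) :
    (Q *ᵥ x) ⬝ᵥ (Q *ᵥ y) = x ⬝ᵥ y := by
  rw [Matrix.dotProduct_mulVec, Matrix.vecMul_mulVec,
    show Qᵀ * Q = 1 from (Matrix.mem_orthogonalGroup_iff' _ _).1 hQ, Matrix.vecMul_one]

/-- Row norms, hence weights, do not change under Q, and multiples of the identity commute with it.
-/
lemma spectralMatrix_mul_orthogonal (A : Matrix (Fin N) (Fin n) ℝ) {Q : Matrix (Fin n) (Fin n) ℝ}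
    (hQ : Q ∈ Matrix.orthogonalGroup (Fin n) ℝ) (u : Fin n → ℝ) :
    spectralMatrix (A * Q) *ᵥ u = Qᵀ *ᵥ (spectralMatrix A *ᵥ (Q *ᵥ u)) := by
  have hQQ : Qᵀ * Q = 1 := (Matrix.mem_orthogonalGroup_iff' _ _).1 hQ
  have hQ' : Qᵀ ∈ Matrix.orthogonalGroup (Fin n) ℝ :=
    (Matrix.mem_orthogonalGroup_iff _ _).2 (by rwa [Matrix.transpose_transpose])
  rw [spectralMatrix_mulVec, spectralMatrix_mulVec, Matrix.mulVec_sub, Matrix.mulVec_sum,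
    Matrix.mulVec_smul, Matrix.mulVec_mulVec, hQQ, Matrix.one_mulVec]
  congr 1
  refine Finset.sum_congr rfl fun i _ => ?_
  rw [Matrix.mulVec_smul, mul_row_eq, ellNorm_two_sq_eq_dotProduct, ellNorm_two_sq_eq_dotProduct,
    orthogonal_mulVec_dotProduct hQ', Matrix.mulVec_transpose, ← Matrix.dotProduct_mulVec]

/-- The estimate for an observed matrix does not depend on the choice of basis. -/
lemma EntrywiseClose.mul_orthogonal {A : Matrix (Fin N) (Fin n) ℝ} {v r : Fin N → ℝ}
    (h : EntrywiseClose A v r) {Q : Matrix (Fin n) (Fin n) ℝ}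
    (hQ : Q ∈ Matrix.orthogonalGroup (Fin n) ℝ) : EntrywiseClose (A * Q) v r := by
  have hQQ : Q * Qᵀ = 1 := (Matrix.mem_orthogonalGroup_iff _ _).1 hQ
  have hQQ' : Qᵀ * Q = 1 := (Matrix.mem_orthogonalGroup_iff' _ _).1 hQ
  rintro u ⟨hu, l, hl, hmax⟩
  have hlead : IsLeadingEigenvector (spectralMatrix A) (Q *ᵥ u) := by
    refine ⟨?_, l, ?_, fun l' hl' => hmax l' ?_⟩
    · have h1 : ellNorm 2 (Q *ᵥ u) ^ 2 = ellNorm 2 u ^ 2 := by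
        rw [ellNorm_two_sq_eq_dotProduct, ellNorm_two_sq_eq_dotProduct,
          orthogonal_mulVec_dotProduct hQ]
      rw [hu, one_pow] at h1
      exact (pow_eq_one_iff_of_nonneg (ellNorm_nonneg 2 _) two_ne_zero).1 h1
    · rw [spectralMatrix_mul_orthogonal A hQ] at hl
      have := congrArg (fun x => Q *ᵥ x) hl
      simpa only [Matrix.mulVec_mulVec, hQQ, Matrix.one_mulVec, Matrix.mulVec_smul,
        ← Matrix.mul_assoc, one_mul, Matrix.one_mul] using this
    · obtain ⟨x, hx, hx0⟩ := hl'.exists_hasEigenvector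
      rw [Module.End.mem_eigenspace_iff, Matrix.toLin'_apply] at hx
      refine Module.End.hasEigenvalue_of_hasEigenvector (x := Qᵀ *ᵥ x) ⟨?_, fun h0 => hx0 ?_⟩
      · have hx' : Q *ᵥ (Qᵀ *ᵥ x) = x := by rw [Matrix.mulVec_mulVec, hQQ, Matrix.one_mulVec]
        rw [Module.End.mem_eigenspace_iff, Matrix.toLin'_apply, spectralMatrix_mul_orthogonal A hQ,
          hx', hx, Matrix.mulVec_smul]
      · have := congrArg (fun x => Q *ᵥ x) h0
        simpa only [Matrix.mulVec_mulVec, hQQ, Matrix.one_mulVec, Matrix.mulVec_zero] using this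
  obtain ⟨s, hs, hj⟩ := h _ hlead
  refine ⟨s, hs, fun j => ?_⟩
  rw [mul_row_eq, Matrix.mulVec_transpose, ← Matrix.dotProduct_mulVec, Matrix.mulVec_smul]
  exact hj j

/-- Expansion in an orthonormal eigenbasis. It bounds the leading eigenvalue from below by any
diagonal entry. -/
lemma abs_dotProduct_mulVec_le {M : Matrix (Fin n) (Fin n) ℝ} (hM : M.IsHermitian) {l : ℝ}
    (hl : ∀ l' : ℝ, Module.End.HasEigenvalue (Matrix.toLin' M) l' → |l'| ≤ |l|)
    (x : Fin n → ℝ) : |x ⬝ᵥ M *ᵥ x| ≤ |l| * (x ⬝ᵥ x) := by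
  set b := hM.eigenvectorBasis
  set X : EuclideanSpace ℝ (Fin n) := WithLp.toLp 2 x with hX
  have hTsym := Matrix.isSymmetric_toEuclideanLin_iff.mpr hM
  have hTb : ∀ i, M.toEuclideanLin (b i) = hM.eigenvalues i • b i := fun i => by
    ext k
    have := congrFun (hM.mulVec_eigenvectorBasis i) k
    simpa [Matrix.toLpLin_apply] using this
  have heig : ∀ i, |hM.eigenvalues i| ≤ |l| := fun i => by
    refine hl _ (Module.End.hasEigenvalue_of_hasEigenvector (x := ⇑(b i)) ⟨?_, fun h0 => ?_⟩)
    · rw [Module.End.mem_eigenspace_iff, Matrix.toLin'_apply]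
      exact hM.mulVec_eigenvectorBasis i
    · have h1 := b.orthonormal.1 i
      have : b i = 0 := by ext k; exact congrFun h0 k
      rw [this] at h1
      simp at h1
  have e1 : x ⬝ᵥ M *ᵥ x = ⟪X, M.toEuclideanLin X⟫ := by
    simp [hX, Matrix.toLpLin_apply, EuclideanSpace.inner_eq_star_dotProduct, dotProduct_comm]
  have e2 : ⟪X, M.toEuclideanLin X⟫ = ∑ i, hM.eigenvalues i * ⟪b i, X⟫ ^ 2 := by
    rw [← b.sum_inner_mul_inner]
    refine Finset.sum_congr rfl fun i _ => ?_
    rw [← hTsym, hTb, real_inner_smul_left, real_inner_comm]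
    ring
  have e3 : x ⬝ᵥ x = ∑ i, ⟪b i, X⟫ ^ 2 := by
    rw [b.sum_sq_inner_right, EuclideanSpace.real_norm_sq_eq, dotProduct]
    exact Finset.sum_congr rfl fun i _ => by simp [hX, sq]
  rw [e1, e2, e3, Finset.mul_sum]
  refine (Finset.abs_sum_le_sum_abs _ _).trans (Finset.sum_le_sum fun i _ => ?_)
  rw [abs_mul, abs_of_nonneg (sq_nonneg ⟪b i, X⟫)]
  exact mul_le_mul_of_nonneg_right (heig i) (sq_nonneg _)

/-- The part of a row that lies outside of the first column. -/
noncomputable def rowTail (A : Matrix (Fin N) (Fin n) ℝ) (i : Fin N) :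
    EuclideanSpace ℝ {k : Fin n // (k : ℕ) ≠ 0} :=
  WithLp.toLp 2 fun k => A i k

lemma sum_eq_zero_add_sum_subtype {M : Type*} [AddCommMonoid M] (hn : 0 < n) (f : Fin n → M) :
    ∑ k, f k = f ⟨0, hn⟩ + ∑ k : {k : Fin n // (k : ℕ) ≠ 0}, f k := by
  rw [Fintype.sum_eq_add_sum_subtype_ne f ⟨0, hn⟩]
  congr 1
  exact Fintype.sum_equiv (Equiv.subtypeEquivRight fun k => by simp [Fin.ext_iff]) _ _
    fun _ => rfl

/-- The weight of row `i` in the spectral matrix, in terms of its first entry and its tail. -/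
noncomputable def rowWeight {I E : Type*} [NormedAddCommGroup E] (v : I → ℝ) (κ : ℝ) (g : I → E)
    (i : I) : ℝ := v i ^ 2 + ‖g i‖ ^ 2 - κ

/-- The first coordinate and the tail of an eigenvector satisfy the block equations of
`exists_sign_entrywise_close`. Indexing tails by k ≠ 0 also covers n = 1, where they are empty. -/
lemma entrywiseClose_of_bounds (hn : 0 < n) {A : Matrix (Fin N) (Fin n) ℝ} {v : Fin N → ℝ}
    (hA : ∀ i, A i ⟨0, hn⟩ = v i) {lam η Q : ℝ}
    (hη : 0 ≤ η) (hηlam : 32 * η ≤ |lam|) (hlam : 0 < |lam|) (hQ : 0 ≤ Q)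
    {g : Fin N → EuclideanSpace ℝ {k : Fin n // (k : ℕ) ≠ 0}} (hg : g = rowTail A) {a : Fin N → ℝ}
    (hadef : a = rowWeight v (((n : ℝ) - 1) / N) g)
    (hcorner : |∑ i, a i * v i ^ 2 - 3 / (N : ℝ) - lam| ≤ η)
    (hT : ∀ x, ‖gramOp Finset.univ a g (3 / (N : ℝ)) x‖ ≤ η * ‖x‖)
    (hβ : ‖∑ i, (a i * v i) • g i‖ ≤ η)
    (ha : ∀ j, |a j| * ‖g j‖ ^ 2 ≤ η) (hav : ∀ j, |a j * v j| * ‖g j‖ ≤ η)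
    (hloo : ∀ (j : Fin N) (k : ℕ), |⟪g j, (gramOp (Finset.univ.erase j) a g (3 / (N : ℝ)))^[k]
        (∑ i ∈ Finset.univ.erase j, (a i * v i) • g i)⟫| ≤
      Q * (k + 1) * ‖(gramOp (Finset.univ.erase j) a g (3 / (N : ℝ)))^[k]
        (∑ i ∈ Finset.univ.erase j, (a i * v i) • g i)‖) :
    EntrywiseClose A v fun j => 32 * η / |lam| * (|v j| + Q) := by
  have haA : ∀ i, ellNorm 2 (A i) ^ 2 - ((n : ℝ) - 1) / N = a i := fun i => by
    rw [ellNorm_two_sq, sum_eq_zero_add_sum_subtype hn, hA, hadef, rowWeight, hg,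
      EuclideanSpace.real_norm_sq_eq]
    rfl
  rintro u ⟨hu, l, hl, hmax⟩
  set w : EuclideanSpace ℝ {k : Fin n // (k : ℕ) ≠ 0} := WithLp.toLp 2 fun k => u k with hw
  have hdot : ∀ i, A i ⬝ᵥ u = v i * u ⟨0, hn⟩ + ⟪g i, w⟫ := fun i => by
    rw [dotProduct, sum_eq_zero_add_sum_subtype hn, hA, hg]
    congr 1
    rw [PiLp.inner_apply]
    refine Finset.sum_congr rfl fun k _ => ?_
    simp [rowTail, hw, mul_comm]
  -- The test vector is the first basis vector, whose quadratic form is the corner.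
  have hlge : |lam| - η ≤ |l| := by
    have h1 := abs_dotProduct_mulVec_le (spectralMatrix_isHermitian A) hmax (Pi.single ⟨0, hn⟩ 1)
    have h2 : (Pi.single (⟨0, hn⟩ : Fin n) (1 : ℝ)) ⬝ᵥ
        spectralMatrix A *ᵥ (Pi.single (⟨0, hn⟩ : Fin n) (1 : ℝ)) =
        ∑ i, a i * v i ^ 2 - 3 / (N : ℝ) := by
      rw [single_one_dotProduct, spectralMatrix_mulVec]
      simp only [Pi.sub_apply, Finset.sum_apply, Pi.smul_apply, haA, dotProduct_single_one, hA,
        smul_eq_mul, Pi.single_eq_same, mul_one]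
      congr 1
      exact Finset.sum_congr rfl fun i _ => by ring
    rw [h2, single_one_dotProduct, Pi.single_eq_same, mul_one] at h1
    have h3 := abs_sub_abs_le_abs_sub lam (∑ i, a i * v i ^ 2 - 3 / (N : ℝ))
    rw [abs_sub_comm lam] at h3
    linarith
  have hweq : l • w = gramOp Finset.univ a g (3 / (N : ℝ)) w +
      u ⟨0, hn⟩ • ∑ i, (a i * v i) • g i := by
    ext k
    have h1 := congrFun hl k
    rw [spectralMatrix_mulVec] at h1
    simp only [haA, hdot, Pi.sub_apply, Finset.sum_apply, Pi.smul_apply, smul_eq_mul] at h1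
    rw [gramOp_apply]
    simp only [PiLp.add_apply, PiLp.sub_apply, PiLp.smul_apply, smul_eq_mul, WithLp.ofLp_sum,
      Finset.sum_apply]
    have hwk : w.ofLp k = u k := rfl
    have hgk : ∀ i, (g i).ofLp k = A i k := fun i => by rw [hg]; rfl
    rw [hwk, ← h1, Finset.mul_sum, sub_add_eq_add_sub, ← Finset.sum_add_distrib]
    congr 1
    refine Finset.sum_congr rfl fun i _ => ?_
    rw [hgk]
    ring
  have hunit : u ⟨0, hn⟩ ^ 2 + ‖w‖ ^ 2 = 1 := by
    have h1 : ellNorm 2 u ^ 2 = 1 := by rw [hu, one_pow]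
    rw [ellNorm_two_sq, sum_eq_zero_add_sum_subtype hn] at h1
    rw [← h1, EuclideanSpace.real_norm_sq_eq]
  obtain ⟨s, hs, h⟩ := exists_sign_entrywise_close hη hηlam hlam hQ hlge hunit hweq hT hβ ha hav
    hloo
  refine ⟨s, hs, fun j => ?_⟩
  rw [dotProduct_smul, hdot, smul_eq_mul]
  exact h j

end spectralMatrix

/-! ### The leave-one-out Neumann vectors. -/

section looVec

variable {I E : Type*} [Fintype I] [DecidableEq I] [NormedAddCommGroup E] [InnerProductSpace ℝ E]

/-- The vectors of the Neumann series of the problem in which row `j` is left out, for the rows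
`c • z i`. -/
noncomputable def looVec (v : I → ℝ) (κ κ₀ c : ℝ) (j : I) (k : ℕ) (z : I → E) : E :=
  (gramOp (Finset.univ.erase j) (rowWeight v κ (c • z)) (c • z) κ₀)^[k]
    (∑ i ∈ Finset.univ.erase j, (rowWeight v κ (c • z) i * v i) • (c • z) i)

/-- Row j enters neither the operator nor the vector. This is the form of independence required by
`pi_stdGaussian_abs_inner_gt_le`. -/
lemma looVec_update (v : I → ℝ) (κ κ₀ c : ℝ) (j : I) (k : ℕ) (z : I → E) :
    looVec v κ κ₀ c j k (Function.update z j 0) = looVec v κ κ₀ c j k z := by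
  have hz : ∀ i ∈ Finset.univ.erase j, (c • Function.update z j 0) i = (c • z) i := fun i hi => by
    rw [Pi.smul_apply, Pi.smul_apply, Function.update_of_ne (Finset.ne_of_mem_erase hi)]
  have ha : ∀ i ∈ Finset.univ.erase j, rowWeight v κ (c • Function.update z j 0) i =
      rowWeight v κ (c • z) i := fun i hi => by
    rw [rowWeight, rowWeight, hz i hi]
  have hT : gramOp (Finset.univ.erase j) (rowWeight v κ (c • Function.update z j 0))
      (c • Function.update z j 0) κ₀ =
      gramOp (Finset.univ.erase j) (rowWeight v κ (c • z)) (c • z) κ₀ := by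
    ext x
    rw [gramOp_apply, gramOp_apply]
    congr 1
    exact Finset.sum_congr rfl fun i hi => by rw [hz i hi, ha i hi]
  rw [looVec, looVec, hT]
  congr 1
  exact Finset.sum_congr rfl fun i hi => by rw [hz i hi, ha i hi]

lemma measurable_looVec [MeasurableSpace E] [BorelSpace E] [FiniteDimensional ℝ E]
    (v : I → ℝ) (κ κ₀ c : ℝ) (j : I) (k : ℕ) :
    Measurable (looVec (E := E) v κ κ₀ c j k) := by
  have ha : ∀ i, Measurable fun z : I → E => rowWeight v κ (c • z) i := fun i => by
    simp only [rowWeight, Pi.smul_apply]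
    fun_prop
  induction k with
  | zero =>
    change Measurable fun z : I → E =>
      ∑ i ∈ Finset.univ.erase j, (rowWeight v κ (c • z) i * v i) • c • z i
    exact Finset.measurable_fun_sum _ fun i _ => ((ha i).mul_const _).smul (by fun_prop)
  | succ k ih =>
    have e : looVec (E := E) v κ κ₀ c j (k + 1) = fun z =>
        ∑ i ∈ Finset.univ.erase j, (rowWeight v κ (c • z) i *
          ⟪(c • z) i, looVec v κ κ₀ c j k z⟫) • (c • z) i - κ₀ • looVec v κ κ₀ c j k z := by
      ext1 z
      rw [looVec, Function.iterate_succ_apply', gramOp_apply]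
      rfl
    rw [e]
    simp only [Pi.smul_apply]
    refine Measurable.sub (Finset.measurable_fun_sum _ fun i _ => ?_) (ih.const_smul _)
    exact ((ha i).mul (Measurable.inner (by fun_prop) ih)).smul (by fun_prop)

end looVec

/-! ### The good events and their probability. -/

section rowEvents

variable {E : Type*} [NormedAddCommGroup E] [InnerProductSpace ℝ E] {N : ℕ}

/-- The radius within which all centred squared norms of the rows lie. -/
noncomputable def devRadius (n L : ℝ) : ℝ := 4 * √(n * L) + 16 * L

/-- The events for the Gaussian rows on which the estimates hold. -/
structure RowEvents (v : Fin N → ℝ) (n L κ κ₀ c : ℝ) (z : Fin N → E) : Prop where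
  dev : ∀ i, |chiDev E (z i)| ≤ devRadius n L
  corner : |∑ i, v i ^ 2 * chiDev E (z i)| ≤
    4 * √(n * L * ∑ i, (v i ^ 2) ^ 2) + 16 * ellNorm ∞ v ^ 2 * L
  cubic : ‖∑ i, v i ^ 3 • z i‖ ≤ 8 * √((∑ i, (v i ^ 3) ^ 2) * (n + L))
  linear : ‖∑ i, (v i * truncDev E (devRadius n L) (z i)) • z i‖ ≤
    4600 * (ellNorm 2 v * n * √L) + 5120 * (ellNorm ∞ v * L ^ 2)
  quadratic : ∀ x, |⟪gramOp Finset.univ (fun i => v i ^ 2) z (∑ i, v i ^ 2) x, x⟫| ≤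
    32 * (4 * √((∑ i, (v i ^ 2) ^ 2) * (n + L)) + 16 * ellNorm ∞ v ^ 2 * (n + L)) * ‖x‖ ^ 2
  quartic : ∀ x, |⟪gramOp Finset.univ (fun i => truncDev E (devRadius n L) (z i)) z (2 * N) x, x⟫| ≤
    32 * (1800 * √(n * N * (n + L)) + 64 * devRadius n L * (n + L) +
      N * (327682 * √n * Real.exp (-L))) * ‖x‖ ^ 2
  loo : ∀ (j : Fin N) (k : ℕ), |⟪z j, looVec v κ κ₀ c j k z⟫| ≤
    4 * √(2 * L) * (k + 1) * ‖looVec v κ κ₀ c j k z‖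

variable [FiniteDimensional ℝ E] [MeasurableSpace E] [BorelSpace E] {n L : ℝ} {v : Fin N → ℝ}

/-- The radius is the tail bound for `chiDev` at level u = 2L. For L = log(N/δ) the factor e^(-2L) =
(δ/N)² survives a union over the N rows. -/
lemma devRadius_eq : devRadius n L = 2 * √(2 * n * (2 * L)) + 2 * 4 * (2 * L) := by
  have h : √(2 * n * (2 * L)) = 2 * √(n * L) := by
    rw [show 2 * n * (2 * L) = 2 ^ 2 * (n * L) by ring,
      Real.sqrt_mul (by norm_num : (0 : ℝ) ≤ 2 ^ 2), Real.sqrt_sq (by norm_num)]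
  rw [devRadius, h]
  ring

lemma devRadius_pos (hL : 0 < L) : 0 < devRadius n L := by
  rw [devRadius]; positivity

/-- Two regimes. For L ≤ n the radius is of order √(nL), and the sub-Gaussian bound with proxy 3R²
yields n√L. For n ≤ L the radius is of order L, and Bernstein's bound with proxy of order n yields
the further term in L². -/
lemma pi_stdGaussian_norm_sum_truncDev_smul_le_of_pos (hD : Module.finrank ℝ E ≤ n) (hn : 1 ≤ n)
    (hL : 1 ≤ L) (hv : 0 < ellNorm ∞ v) (hv2 : 0 < ∑ i, v i ^ 2) :
    (Measure.pi fun _ : Fin N => stdGaussian E).real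
      {z | ¬ ‖∑ i, (v i * truncDev E (devRadius n L) (z i)) • z i‖ ≤
        4600 * (ellNorm 2 v * n * √L) + 5120 * (ellNorm ∞ v * L ^ 2)} ≤
      2 * Real.exp (-(2 * L)) := by
  have hR : 0 < devRadius n L := devRadius_pos (by linarith)
  have hs : 0 < 2 * n + 2 * L := by linarith
  have hV : 0 ≤ ellNorm 2 v := ellNorm_nonneg 2 v
  have hV2 := ellNorm_two_sq v
  have hx : 1 ≤ √n := Real.one_le_sqrt.2 hn
  have hy : 1 ≤ √L := Real.one_le_sqrt.2 hL
  have hx2 : √n ^ 2 = n := Real.sq_sqrt (by linarith)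
  have hy2 : √L ^ 2 = L := Real.sq_sqrt (by linarith)
  have hRe : devRadius n L = 4 * (√n * √L) + 16 * √L ^ 2 := by
    rw [devRadius, Real.sqrt_mul (by linarith), hy2]
  set x := √n
  set y := √L
  have hx0 : 0 < x := by linarith
  have hy0 : 0 < y := by linarith
  set V := ellNorm 2 v
  set m := ellNorm ∞ v
  have hgoal : 4600 * (V * n * y) + 5120 * (m * L ^ 2) =
      4600 * (V * x ^ 2 * y) + 5120 * (m * y ^ 4) := by rw [hx2, ← hy2]; ring
  rcases le_total L n with h | h
  · have hxy : y ≤ x := Real.sqrt_le_sqrt h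
    refine le_trans (measureReal_mono (fun z hz => ?_) (measure_ne_top _ _))
      (pi_stdGaussian_norm_sum_truncDev_smul_le hD hs hR hv2)
    rw [Set.mem_ofPred_eq] at hz ⊢
    refine fun hcon => hz (hcon.trans ?_)
    rw [hgoal]
    have h1 : √(3 * devRadius n L ^ 2 * (∑ i, v i ^ 2) * (2 * n + 2 * L)) ≤
        4 * devRadius n L * V * x := by
      rw [Real.sqrt_le_left (by positivity), ← hV2, ← hx2, ← hy2]
      have : 2 * x ^ 2 + 2 * y ^ 2 ≤ 4 * x ^ 2 := by nlinarith
      have h3 : 0 ≤ 3 * devRadius n L ^ 2 * V ^ 2 := by positivity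
      nlinarith [mul_le_mul_of_nonneg_left this h3, mul_nonneg h3 (sq_nonneg x)]
    have h2 : devRadius n L ≤ 20 * (x * y) := by rw [hRe]; nlinarith
    calc 2 * (4 * √(3 * devRadius n L ^ 2 * (∑ i, v i ^ 2) * (2 * n + 2 * L)))
        ≤ 2 * (4 * (4 * (20 * (x * y)) * V * x)) := by
          gcongr; exact h1.trans (by gcongr)
      _ = 640 * (V * x ^ 2 * y) := by ring
      _ ≤ _ := by
          have t1 : 0 ≤ V * x ^ 2 * y := by positivity
          have t2 : 0 ≤ m * y ^ 4 := by positivity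
          linarith
  · have hxy : x ≤ y := Real.sqrt_le_sqrt h
    refine le_trans (measureReal_mono (fun z hz => ?_) (measure_ne_top _ _))
      (pi_stdGaussian_norm_sum_truncDev_smul_le' hD hn hs hR hv (abs_le_ellNorm_top v))
    rw [Set.mem_ofPred_eq] at hz ⊢
    refine fun hcon => hz (hcon.trans ?_)
    rw [hgoal]
    have h1 : √(327680 * n * (∑ i, v i ^ 2) * (2 * n + 2 * L)) ≤ 1150 * (V * x * y) := by
      rw [Real.sqrt_le_left (by positivity), ← hV2, ← hx2, ← hy2]
      have : 2 * x ^ 2 + 2 * y ^ 2 ≤ 4 * y ^ 2 := by nlinarith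
      have h3 : 0 ≤ 327680 * x ^ 2 * V ^ 2 := by positivity
      nlinarith [mul_le_mul_of_nonneg_left this h3, mul_nonneg h3 (sq_nonneg y)]
    have h1' : V * x * y ≤ V * x ^ 2 * y := by
      have : x ≤ x ^ 2 := by nlinarith
      gcongr
    have h2 : devRadius n L ≤ 20 * y ^ 2 := by rw [hRe]; nlinarith
    have h4 : 2 * n + 2 * L ≤ 4 * y ^ 2 := by rw [hy2]; linarith
    calc 2 * (2 * √(327680 * n * (∑ i, v i ^ 2) * (2 * n + 2 * L)) +
          2 * (16 * devRadius n L * m) * (2 * n + 2 * L))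
        ≤ 2 * (2 * (1150 * (V * x ^ 2 * y)) + 2 * (16 * (20 * y ^ 2) * m) * (4 * y ^ 2)) := by
          gcongr
          exact h1.trans (by linarith)
      _ = _ := by ring

/-- A union bound: 2N for the row norms, 4N for the left-out rows, and 2 for each of the five
remaining events. -/
lemma measureReal_not_rowEvents_le (hD : Module.finrank ℝ E ≤ n) (hn : 1 ≤ n)
    (hL : 1 ≤ L) (hv : 0 < ellNorm ∞ v) (hv2 : 0 < ∑ i, v i ^ 2)
    (hv6 : 0 < ∑ i, (v i ^ 3) ^ 2) (κ κ₀ c : ℝ) :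
    (Measure.pi fun _ : Fin N => stdGaussian E).real {z | ¬ RowEvents v n L κ κ₀ c z} ≤
      (6 * N + 10) * Real.exp (-(2 * L)) := by
  have h2L : 0 < 2 * L := by linarith
  have hs : 0 < 2 * n + 2 * L := by linarith
  set P := Measure.pi fun _ : Fin N => stdGaussian E
  have e1 := pi_stdGaussian_chiDev_gt_le (I := Fin N) hD h2L
  have e2 := pi_stdGaussian_sum_chiDev_le hD h2L hv (abs_le_ellNorm_top v)
  have e3 := pi_stdGaussian_norm_sum_smul_le hD hs hv6
  have e4 := pi_stdGaussian_norm_sum_truncDev_smul_le_of_pos hD hn hL hv hv2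
  have e5 := pi_stdGaussian_gramOp_le (c := fun i => v i ^ 2) (m := ellNorm ∞ v ^ 2) hD hs
    (by positivity) (fun i => by rw [abs_pow]; gcongr; exact abs_le_ellNorm_top v i)
  have e6 := pi_stdGaussian_gramOp_truncDev_le (I := Fin N) hD hn h2L devRadius_eq
  have e7 := pi_stdGaussian_forall_abs_inner_le (E := E) (I := Fin N) (u := 2 * L) (by linarith)
    (fun j k => measurable_looVec v κ κ₀ c j k) (fun j k z => looVec_update v κ κ₀ c j k z)
  rw [Fintype.card_fin] at e1 e6 e7
  have hsub : {z : Fin N → E | ¬ RowEvents v n L κ κ₀ c z} ⊆ _ ∪ (_ ∪ (_ ∪ (_ ∪ (_ ∪ (_ ∪ _))))) :=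
    (show _ ⊆ {z : Fin N → E | ¬ ∀ i, |chiDev E (z i)| ≤ 2 * √(2 * n * (2 * L)) + 2 * 4 * (2 * L)} ∪
      ({z | ¬ |∑ i, v i ^ 2 * chiDev E (z i)| ≤ 2 * √(2 * n * (∑ i, (v i ^ 2) ^ 2) * (2 * L)) +
          2 * (4 * ellNorm ∞ v ^ 2) * (2 * L)} ∪
      ({z | ¬ ‖∑ i, v i ^ 3 • z i‖ ≤
          2 * (4 * √(1 / 2 * (∑ i, (v i ^ 3) ^ 2) * (2 * n + 2 * L)))} ∪
      ({z | ¬ ‖∑ i, (v i * truncDev E (devRadius n L) (z i)) • z i‖ ≤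
          4600 * (ellNorm 2 v * n * √L) + 5120 * (ellNorm ∞ v * L ^ 2)} ∪
      ({z | ¬ ∀ x, |⟪gramOp Finset.univ (fun i => v i ^ 2) z (∑ i, v i ^ 2) x, x⟫| ≤
          32 * (2 * √(2 * (∑ i, (v i ^ 2) ^ 2) * (2 * n + 2 * L)) +
            2 * (4 * ellNorm ∞ v ^ 2) * (2 * n + 2 * L)) * ‖x‖ ^ 2} ∪
      ({z | ¬ ∀ x, |⟪gramOp Finset.univ (fun i => truncDev E (devRadius n L) (z i)) z
          (2 * (N : ℝ)) x, x⟫| ≤ 32 * (2 * √(327680 * n * N * (2 * n + 2 * L)) +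
            2 * (16 * devRadius n L) * (2 * n + 2 * L) +
            N * (327682 * √n * Real.exp (-(2 * L / 2)))) * ‖x‖ ^ 2} ∪
      {z | ¬ ∀ j k, |⟪z j, looVec v κ κ₀ c j k z⟫| ≤
          4 * √(2 * L) * (k + 1) * ‖looVec v κ κ₀ c j k z‖}))))) from by
    intro z hz
    by_contra hcon
    simp only [Set.mem_union, not_or, Set.mem_ofPred_eq, not_not] at hcon hz
    obtain ⟨h1, h2, h3, h4, h5, h6, h7⟩ := hcon
    refine hz ⟨by rwa [devRadius_eq], h2.trans (le_of_eq ?_), h3.trans (le_of_eq ?_), h4,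
      fun x => (h5 x).trans (le_of_eq ?_), fun x => (h6 x).trans ?_, h7⟩
    · rw [show 2 * n * (∑ i, (v i ^ 2) ^ 2) * (2 * L) = 2 ^ 2 * (n * L * ∑ i, (v i ^ 2) ^ 2) by
        ring, Real.sqrt_mul (by norm_num), Real.sqrt_sq (by norm_num)]
      ring
    · rw [show 1 / 2 * (∑ i, (v i ^ 3) ^ 2) * (2 * n + 2 * L) = (∑ i, (v i ^ 3) ^ 2) * (n + L) by
        ring]
      ring
    · rw [show 2 * (∑ i, (v i ^ 2) ^ 2) * (2 * n + 2 * L) =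
        2 ^ 2 * ((∑ i, (v i ^ 2) ^ 2) * (n + L)) by ring, Real.sqrt_mul (by norm_num),
        Real.sqrt_sq (by norm_num)]
      ring
    · have t1 : √(327680 * n * N * (2 * n + 2 * L)) ≤ 900 * √(n * N * (n + L)) := by
        rw [show 327680 * n * N * (2 * n + 2 * L) = 655360 * (n * N * (n + L)) by ring,
          Real.sqrt_mul (by norm_num)]
        gcongr
        rw [Real.sqrt_le_left (by norm_num)]
        norm_num
      rw [show 2 * L / 2 = L by ring,
        show 2 * (16 * devRadius n L) * (2 * n + 2 * L) = 64 * devRadius n L * (n + L) by ring]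
      gcongr ?_ * ‖x‖ ^ 2
      linarith)
  have hne : ∀ s : Set (Fin N → E), P s ≠ ∞ := fun s => measure_ne_top _ _
  refine (measureReal_mono hsub (hne _)).trans ?_
  refine (measureReal_union_le _ _).trans ((add_le_add e1 ((measureReal_union_le _ _).trans
    (add_le_add e2 ((measureReal_union_le _ _).trans (add_le_add e3
    ((measureReal_union_le _ _).trans (add_le_add e4 ((measureReal_union_le _ _).trans
    (add_le_add e5 ((measureReal_union_le _ _).trans (add_le_add e6 e7))))))))))).trans ?_)
  linarith

end rowEvents

/-! ### Comparison of the bounds with the rate η. -/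

section rate

lemma rpow_three_halves {x : ℝ} (hx : 0 ≤ x) : x ^ (3 / 2 : ℝ) = √x ^ 3 := by
  rw [Real.sqrt_eq_rpow, ← Real.rpow_natCast, ← Real.rpow_mul hx]
  norm_num

/-- The error rate as a polynomial in `√n`, `√(log (N / δ))` and `1 / √N`. -/
lemma etaRate_eq (A : ℝ) {N : ℕ} (n : ℕ) (v : Fin N → ℝ) {δ : ℝ} (hN : 0 < N)
    (hL : 0 ≤ Real.log (N / δ)) :
    etaRate A n v δ = A * ((ellNorm 2 v + 1) * (√n ^ 2 * √(Real.log (N / δ)) * (√N)⁻¹ ^ 3)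
      + ellNorm 4 v ^ 2 * (√n * √(Real.log (N / δ)) * (√N)⁻¹ ^ 2)
      + ellNorm 6 v ^ 3 * ((√n + √(Real.log (N / δ))) * (√N)⁻¹)
      + ellNorm ∞ v ^ 2 * ((√n ^ 2 * √(Real.log (N / δ)) ^ 2 + √(Real.log (N / δ)) ^ 4) *
        (√N)⁻¹ ^ 2)
      + √n ^ 3 * √(Real.log (N / δ)) ^ 3 * (√N)⁻¹ ^ 4
      + (√N)⁻¹ ^ 2 * |ellNorm 2 v ^ 2 - 1|) := by
  have hn0 : (0 : ℝ) ≤ n := n.cast_nonneg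
  have hN0 : (0 : ℝ) < N := by exact_mod_cast hN
  rw [etaRate, rpow_three_halves hN0.le, rpow_three_halves (mul_nonneg hn0 hL),
    Real.sqrt_mul hn0]
  have e1 : √(n : ℝ) ^ 2 = n := Real.sq_sqrt hn0
  have e2 : √(N : ℝ) ^ 2 = N := Real.sq_sqrt hN0.le
  have e3 : √(Real.log (N / δ)) ^ 2 = Real.log (N / δ) := Real.sq_sqrt hL
  set L := Real.log (N / δ)
  have hr : √(N : ℝ) ≠ 0 := (Real.sqrt_pos.2 hN0).ne'
  rw [← e2, show √L ^ 4 = (√L ^ 2) ^ 2 by ring, e3, e1]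
  rw [Real.sqrt_sq (Real.sqrt_nonneg _)]
  field_simp

variable {x y w V m q₄ q₆ d e B : ℝ}

set_option maxHeartbeats 1000000 in
-- To be read with x = √n, y = √L, w = 1/√N, V = ‖v‖₂, m = ‖v‖_∞, q₄ = ‖v‖₄², q₆ = ‖v‖₆³ and e =
-- e^(-L). The five bounds are for the corner, β, T, |a_j| ‖g_j‖² and |a_j v_j| ‖g_j‖. The size of
-- the constant is due to the truncation bias, with 32·327682 = 10485824.
lemma rate_bounds (hx : 1 ≤ x) (hy : 1 ≤ y) (hw : 0 < w) (hw1 : w ≤ 1) (hyw : y ^ 3 * w ≤ 1)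
    (hm : 0 ≤ m) (hmV : m ≤ V) (hq₄ : 0 ≤ q₄) (hq₆ : 0 ≤ q₆) (hd : 0 ≤ d) (he : e ≤ w ^ 2)
    (hB : B = (V + 1) * (x ^ 2 * y * w ^ 3) + q₄ * (x * y * w ^ 2) + q₆ * ((x + y) * w) +
      m ^ 2 * ((x ^ 2 * y ^ 2 + y ^ 4) * w ^ 2) + x ^ 3 * y ^ 3 * w ^ 4 + w ^ 2 * d) :
    w ^ 2 * (4 * (x * y * q₄) + 16 * m ^ 2 * y ^ 2) ≤ 20000000 * B ∧
    w * (8 * (q₆ * (x + y))) + w ^ 3 * (4600 * (V * x ^ 2 * y) + 5120 * (m * y ^ 4)) ≤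
      20000000 * B ∧
    w ^ 2 * (32 * (4 * (q₄ * (x + y)) + 16 * m ^ 2 * (x ^ 2 + y ^ 2))) +
      w ^ 4 * (32 * (1800 * (x * w⁻¹ * (x + y)) + 64 * (4 * (x * y) + 16 * y ^ 2) *
        (x ^ 2 + y ^ 2) + w⁻¹ ^ 2 * (327682 * x * e))) + w ^ 2 * d ≤ 20000000 * B ∧
    (m ^ 2 + w ^ 2 * (4 * (x * y) + 16 * y ^ 2)) * (w ^ 2 * (x + 4 * y) ^ 2) ≤ 20000000 * B ∧
    (q₆ + w ^ 2 * ((4 * (x * y) + 16 * y ^ 2) * m)) * (w * (x + 4 * y)) ≤ 20000000 * B := by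
  have hV : 0 ≤ V := hm.trans hmV
  have hx0 : 0 < x := by linarith
  have hy0 : 0 < y := by linarith
  have hx2 : 1 ≤ x ^ 2 := one_le_pow₀ hx
  have hy2 : 1 ≤ y ^ 2 := one_le_pow₀ hy
  have hxy : x + y ≤ 2 * (x * y) := by nlinarith only [hx, hy]
  have hxy2 : x ^ 2 + y ^ 2 ≤ 2 * (x ^ 2 * y ^ 2) := by nlinarith only [hx2, hy2]
  -- the terms of the rate
  have t1 : 0 ≤ V * (x ^ 2 * y * w ^ 3) := by positivity
  have t1' : 0 ≤ x ^ 2 * y * w ^ 3 := by positivity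
  have t2 : 0 ≤ q₄ * (x * y * w ^ 2) := by positivity
  have t3 : 0 ≤ q₆ * (x * w) := by positivity
  have t3' : 0 ≤ q₆ * (y * w) := by positivity
  have t4 : 0 ≤ m ^ 2 * (x ^ 2 * y ^ 2 * w ^ 2) := by positivity
  have t4' : 0 ≤ m ^ 2 * (y ^ 4 * w ^ 2) := by positivity
  have t5 : 0 ≤ x ^ 3 * y ^ 3 * w ^ 4 := by positivity
  have t6 : 0 ≤ w ^ 2 * d := by positivity
  have hB' : B = V * (x ^ 2 * y * w ^ 3) + x ^ 2 * y * w ^ 3 + q₄ * (x * y * w ^ 2) +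
      q₆ * (x * w) + q₆ * (y * w) + m ^ 2 * (x ^ 2 * y ^ 2 * w ^ 2) + m ^ 2 * (y ^ 4 * w ^ 2) +
      x ^ 3 * y ^ 3 * w ^ 4 + w ^ 2 * d := by rw [hB]; ring
  -- auxiliary monomials
  have s1 : y ^ 4 * w ^ 4 ≤ x ^ 2 * y * w ^ 3 := by
    calc y ^ 4 * w ^ 4 = (y ^ 3 * w) * (y * w ^ 3) := by ring
      _ ≤ x ^ 2 * (y * w ^ 3) := by gcongr; linarith
      _ = _ := by ring
  -- The arithmetic-geometric mean inequality for m w, times y⁴ w².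
  have s2 : m * (y ^ 4 * w ^ 3) ≤ m ^ 2 * (y ^ 4 * w ^ 2) + x ^ 2 * y * w ^ 3 := by
    have : 0 ≤ (y ^ 2 * w) ^ 2 * ((m - w) ^ 2 + (m ^ 2 + w ^ 2)) := by positivity
    nlinarith only [this, s1]
  have s3 : m ^ 2 * (y ^ 2 * w ^ 2) ≤ m ^ 2 * (y ^ 4 * w ^ 2) := by
    have : y ^ 2 ≤ y ^ 4 := pow_le_pow_right₀ hy (by norm_num)
    gcongr
  have s4 : (4 * (x * y) + 16 * y ^ 2) * (x ^ 2 + y ^ 2) * w ^ 4 ≤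
      24 * (x ^ 3 * y ^ 3 * w ^ 4) + 16 * (x ^ 2 * y * w ^ 3) := by
    have a1 : x ^ 3 * y ≤ x ^ 3 * y ^ 3 := by
      gcongr; simpa using pow_le_pow_right₀ hy (show 1 ≤ 3 by norm_num)
    have a2 : x * y ^ 3 ≤ x ^ 3 * y ^ 3 := by
      gcongr; simpa using pow_le_pow_right₀ hx (show 1 ≤ 3 by norm_num)
    have a3 : x ^ 2 * y ^ 2 ≤ x ^ 3 * y ^ 3 := by gcongr <;> first | assumption | norm_num
    calc (4 * (x * y) + 16 * y ^ 2) * (x ^ 2 + y ^ 2) * w ^ 4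
        = (4 * (x ^ 3 * y) + 4 * (x * y ^ 3) + 16 * (x ^ 2 * y ^ 2)) * w ^ 4 +
          16 * (y ^ 4 * w ^ 4) := by ring
      _ ≤ (24 * (x ^ 3 * y ^ 3)) * w ^ 4 + 16 * (x ^ 2 * y * w ^ 3) := by
          gcongr; linarith
      _ = _ := by ring
  have s5 : q₄ * ((x + y) * w ^ 2) ≤ 2 * (q₄ * (x * y * w ^ 2)) := by
    calc q₄ * ((x + y) * w ^ 2) ≤ q₄ * (2 * (x * y) * w ^ 2) := by gcongr
      _ = _ := by ring
  have s6 : m ^ 2 * ((x ^ 2 + y ^ 2) * w ^ 2) ≤ 2 * (m ^ 2 * (x ^ 2 * y ^ 2 * w ^ 2)) := by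
    calc m ^ 2 * ((x ^ 2 + y ^ 2) * w ^ 2) ≤ m ^ 2 * (2 * (x ^ 2 * y ^ 2) * w ^ 2) := by gcongr
      _ = _ := by ring
  have s7 : x * (x + y) * w ^ 3 ≤ 2 * (x ^ 2 * y * w ^ 3) := by
    calc x * (x + y) * w ^ 3 ≤ x * (2 * (x * y)) * w ^ 3 := by gcongr
      _ = _ := by ring
  have s8 : w ^ 2 * (x * e) ≤ x ^ 2 * y * w ^ 3 := by
    calc w ^ 2 * (x * e) ≤ w ^ 2 * (x * w ^ 2) := by gcongr
      _ = x * 1 * (w * w ^ 3) := by ring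
      _ ≤ x * (x * y) * (1 * w ^ 3) := by gcongr; nlinarith only [hx, hy]
      _ = _ := by ring
  have s9 : (x + 4 * y) ^ 2 ≤ 20 * (x ^ 2 + y ^ 2) := by
    nlinarith only [sq_nonneg (4 * x - y), sq_nonneg x, sq_nonneg y]
  have s10 : (4 * (x * y) + 16 * y ^ 2) * (x + 4 * y) ≤ 64 * (x ^ 2 * y) + 144 * y ^ 4 := by
    have b1 : x * y ^ 2 ≤ x ^ 2 * y + y ^ 3 := by
      have := mul_nonneg hy0.le (show 0 ≤ x ^ 2 - x * y + y ^ 2 by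
        nlinarith only [sq_nonneg (x - y), sq_nonneg x, sq_nonneg y])
      nlinarith only [this]
    have b2 : y ^ 3 ≤ y ^ 4 := pow_le_pow_right₀ hy (by norm_num)
    have b3 : 0 ≤ x ^ 2 * y := by positivity
    nlinarith only [b1, b2, b3]
  have hww : w ^ 4 * w⁻¹ = w ^ 3 := by field_simp
  have hww2 : w ^ 4 * w⁻¹ ^ 2 = w ^ 2 := by field_simp
  refine ⟨?_, ?_, ?_, ?_, ?_⟩
  · calc _ = 4 * (q₄ * (x * y * w ^ 2)) + 16 * (m ^ 2 * (y ^ 2 * w ^ 2)) := by ring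
      _ ≤ _ := by rw [hB']; linarith only [t1, t1', t2, t3, t3', t4, t4', t5, t6, s3]
  · calc _ = 8 * (q₆ * (x * w)) + 8 * (q₆ * (y * w)) + 4600 * (V * (x ^ 2 * y * w ^ 3)) +
          5120 * (m * (y ^ 4 * w ^ 3)) := by ring
      _ ≤ _ := by rw [hB']; linarith only [t1, t1', t2, t3, t3', t4, t4', t5, t6, s2]
  · calc _ = 128 * (q₄ * ((x + y) * w ^ 2)) + 512 * (m ^ 2 * ((x ^ 2 + y ^ 2) * w ^ 2)) +
          57600 * (x * (x + y) * (w ^ 4 * w⁻¹)) +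
          2048 * ((4 * (x * y) + 16 * y ^ 2) * (x ^ 2 + y ^ 2) * w ^ 4) +
          10485824 * ((w ^ 4 * w⁻¹ ^ 2) * (x * e)) + w ^ 2 * d := by ring
      _ ≤ _ := by rw [hww, hww2, hB']; linarith only [t1, t1', t2, t3, t3', t4, t4', t5, t6, s4,
          s5, s6, s7, s8]
  · calc (m ^ 2 + w ^ 2 * (4 * (x * y) + 16 * y ^ 2)) * (w ^ 2 * (x + 4 * y) ^ 2)
        ≤ (m ^ 2 + w ^ 2 * (4 * (x * y) + 16 * y ^ 2)) * (w ^ 2 * (20 * (x ^ 2 + y ^ 2))) := by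
          gcongr
      _ = 20 * (m ^ 2 * ((x ^ 2 + y ^ 2) * w ^ 2)) +
          20 * ((4 * (x * y) + 16 * y ^ 2) * (x ^ 2 + y ^ 2) * w ^ 4) := by ring
      _ ≤ _ := by rw [hB']; linarith only [t1, t1', t2, t3, t3', t4, t4', t5, t6, s4, s6]
  · calc (q₆ + w ^ 2 * ((4 * (x * y) + 16 * y ^ 2) * m)) * (w * (x + 4 * y))
        = q₆ * (x * w) + 4 * (q₆ * (y * w)) +
          w ^ 3 * m * ((4 * (x * y) + 16 * y ^ 2) * (x + 4 * y)) := by ring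
      _ ≤ q₆ * (x * w) + 4 * (q₆ * (y * w)) +
          w ^ 3 * m * (64 * (x ^ 2 * y) + 144 * y ^ 4) := by gcongr
      _ = q₆ * (x * w) + 4 * (q₆ * (y * w)) + 64 * (m * (x ^ 2 * y * w ^ 3)) +
          144 * (m * (y ^ 4 * w ^ 3)) := by ring
      _ ≤ _ := by
          have : m * (x ^ 2 * y * w ^ 3) ≤ V * (x ^ 2 * y * w ^ 3) := by gcongr
          rw [hB']; linarith only [t1, t1', t2, t3, t3', t4, t4', t5, t6, s2, this]

end rate

/-! ### The estimate on the good events. -/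

section ofRowEvents

variable {N n : ℕ}

lemma EntrywiseClose.mono {A : Matrix (Fin N) (Fin n) ℝ} {v r r' : Fin N → ℝ}
    (h : EntrywiseClose A v r) (hr : ∀ j, r j ≤ r' j) : EntrywiseClose A v r' := fun u hu =>
  let ⟨s, hs, hj⟩ := h u hu
  ⟨s, hs, fun j => (hj j).trans (hr j)⟩

lemma ellNorm_top_le_two (hN : 0 < N) (v : Fin N → ℝ) : ellNorm ∞ v ≤ ellNorm 2 v := by
  have : Nonempty (Fin N) := ⟨⟨0, hN⟩⟩
  rw [ellNorm, PiLp.norm_eq_ciSup]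
  exact ciSup_le fun i => PiLp.norm_apply_le (WithLp.toLp 2 v : PiLp 2 fun _ : Fin N => ℝ) i

lemma finrank_rowTail (hn : 0 < n) :
    Module.finrank ℝ (EuclideanSpace ℝ {k : Fin n // (k : ℕ) ≠ 0}) = n - 1 := by
  rw [finrank_euclideanSpace, Fintype.card_subtype_compl,
    Fintype.card_fin]
  congr 1
  rw [Fintype.card_eq_one_iff]
  exact ⟨⟨⟨0, hn⟩, rfl⟩, fun k => by ext; exact k.2⟩

variable {v : Fin N → ℝ} {δ : ℝ} {A : Matrix (Fin N) (Fin n) ℝ}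
  {z : Fin N → EuclideanSpace ℝ {k : Fin n // (k : ℕ) ≠ 0}}

set_option maxHeartbeats 1000000 in
lemma entrywiseClose_of_rowEvents (hn : 0 < n) (hδ : 0 < δ)
    (hL : 1 ≤ Real.log (N / δ)) (hN : 0 < N) (hLN : Real.log (N / δ) ^ 3 ≤ N) (hδ1 : δ ≤ 1)
    (hA : ∀ i, A i ⟨0, hn⟩ = v i) (hz : rowTail A = (√(N : ℝ))⁻¹ • z)
    (hev : RowEvents v n (Real.log (N / δ)) (((n : ℝ) - 1) / N) (3 / N) (√(N : ℝ))⁻¹ z)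
    (hlam : ellNorm 4 v ^ 4 ≠ 3 / N)
    (hη : 32 * etaRate 20000000 n v δ ≤ |ellNorm 4 v ^ 4 - 3 / N|) :
    EntrywiseClose A v fun j => 192 * etaRate 20000000 n v δ / |ellNorm 4 v ^ 4 - 3 / N| *
      (|v j| + √(Real.log (N / δ)) / √(N : ℝ)) := by
  have hlam0 : 0 < |ellNorm 4 v ^ 4 - 3 / N| := abs_pos.2 (sub_ne_zero.2 hlam)
  have hE := etaRate_eq 20000000 n v hN (by linarith)
  have hexp : Real.exp (-Real.log (N / δ)) ≤ (√(N : ℝ))⁻¹ ^ 2 := by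
    have hN0 : (0 : ℝ) < N := by exact_mod_cast hN
    rw [Real.exp_neg, Real.exp_log (by positivity), inv_pow, Real.sq_sqrt hN0.le]
    gcongr
    rw [le_div_iff₀ hδ]
    exact mul_le_of_le_one_right hN0.le hδ1
  set η := etaRate 20000000 n v δ
  set lam := ellNorm 4 v ^ 4 - 3 / N
  set L := Real.log (N / δ)
  have hN0 : (0 : ℝ) < N := by exact_mod_cast hN
  have hN1 : (1 : ℝ) ≤ N := by exact_mod_cast hN
  have hn1 : (1 : ℝ) ≤ n := by exact_mod_cast hn
  have hx : 1 ≤ √(n : ℝ) := Real.one_le_sqrt.2 hn1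
  have hy : 1 ≤ √L := Real.one_le_sqrt.2 hL
  have hx2 : √(n : ℝ) ^ 2 = n := Real.sq_sqrt (by linarith)
  have hy2 : √L ^ 2 = L := Real.sq_sqrt (by linarith)
  have hr : 0 < √(N : ℝ) := Real.sqrt_pos.2 hN0
  have hw : 0 < (√(N : ℝ))⁻¹ := by positivity
  have hw2 : (√(N : ℝ))⁻¹ ^ 2 = 1 / N := by rw [inv_pow, Real.sq_sqrt hN0.le, one_div]
  have hyw : √L ^ 3 * (√(N : ℝ))⁻¹ ≤ 1 := by
    rw [← div_eq_mul_inv, div_le_one hr]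
    apply Real.le_sqrt_of_sq_le
    calc (√L ^ 3) ^ 2 = (√L ^ 2) ^ 3 := by ring
      _ ≤ (N : ℝ) := by rw [hy2]; exact hLN
  have hw1 : (√(N : ℝ))⁻¹ ≤ 1 := inv_le_one_of_one_le₀ (Real.one_le_sqrt.2 hN1)
  have hm : 0 ≤ ellNorm ∞ v := ellNorm_nonneg _ _
  have hV2 := ellNorm_two_sq v
  have h4 : ∑ i, (v i ^ 2) ^ 2 = (ellNorm 4 v ^ 2) ^ 2 := by
    rw [← pow_mul, ellNorm_four_pow]
    exact Finset.sum_congr rfl fun i _ => by ring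
  have h6 : ∑ i, (v i ^ 3) ^ 2 = (ellNorm 6 v ^ 3) ^ 2 := by
    rw [← pow_mul, ellNorm_six_pow]
    exact Finset.sum_congr rfl fun i _ => by ring
  have hq₄ : 0 ≤ ellNorm 4 v ^ 2 := by positivity
  have hq₆ : 0 ≤ ellNorm 6 v ^ 3 := by
    have : Fact ((1 : ℝ≥0∞) ≤ 6) := ⟨by norm_num⟩
    exact pow_nonneg (ellNorm_nonneg 6 v) 3
  have hvm : ∀ j, |v j| ≤ ellNorm ∞ v := abs_le_ellNorm_top v
  have hv6 : ∀ j, |v j| ^ 3 ≤ ellNorm 6 v ^ 3 := fun j => by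
    refine le_of_sq_le_sq ?_ hq₆
    rw [← h6, ← pow_mul, mul_comm, pow_mul, sq_abs]
    calc (v j ^ 2) ^ 3 = (v j ^ 3) ^ 2 := by ring
      _ ≤ _ := Finset.single_le_sum (f := fun i => (v i ^ 3) ^ 2) (fun i _ => sq_nonneg _)
        (Finset.mem_univ j)
  have hs : √((n : ℝ) + L) ≤ √n + √L := by
    rw [Real.sqrt_le_left (by positivity)]
    rw [add_sq, hx2, hy2]
    linarith [mul_nonneg (Real.sqrt_nonneg (n : ℝ)) (Real.sqrt_nonneg L)]
  have hR : devRadius n L = 4 * (√n * √L) + 16 * √L ^ 2 := by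
    rw [devRadius, Real.sqrt_mul (by linarith), hy2]
  obtain ⟨b1, b2, b3, b4, b5⟩ := rate_bounds hx hy hw hw1 hyw hm (ellNorm_top_le_two hN v) hq₄ hq₆
    (abs_nonneg (ellNorm 2 v ^ 2 - 1)) hexp rfl
  rw [← hE] at b1 b2 b3 b4 b5
  obtain ⟨e1, e2, e3, e4, e5, e6, e7⟩ := hev
  -- On these events no row exceeds the radius, so the truncation changes nothing.
  have etr : (fun i => truncDev (EuclideanSpace ℝ {k : Fin n // (k : ℕ) ≠ 0}) (devRadius n L) (z i))
      = fun i => chiDev (EuclideanSpace ℝ {k : Fin n // (k : ℕ) ≠ 0}) (z i) :=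
    funext fun i => truncDev_of_le (e1 i)
  have etr' := fun i => congrFun etr i
  simp only [etr'] at e4 e6
  set w := (√(N : ℝ))⁻¹
  set x := √(n : ℝ)
  set y := √L
  set X := fun i => chiDev (EuclideanSpace ℝ {k : Fin n // (k : ℕ) ≠ 0}) (z i) with hX
  have hzX : ∀ i, ‖z i‖ ^ 2 = X i + ((n : ℝ) - 1) := fun i => by
    rw [hX]
    simp only [chiDev]
    rw [finrank_rowTail hn, Nat.cast_pred hn]
    ring
  have hzn : ∀ i, ‖z i‖ ≤ x + 4 * y := fun i => by
    refine le_of_sq_le_sq ?_ (by positivity)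
    have h1 : X i ≤ _ := (le_abs_self _).trans (e1 i)
    have h2 : 0 ≤ x * y := by positivity
    rw [hR] at h1
    rw [hzX, show (x + 4 * y) ^ 2 = x ^ 2 + 8 * (x * y) + 16 * y ^ 2 by ring, hx2]
    linarith
  have haw : ∀ i, rowWeight v (((n : ℝ) - 1) / N) (w • z) i = v i ^ 2 + w ^ 2 * X i := fun i => by
    rw [rowWeight, Pi.smul_apply, norm_smul, mul_pow, hzX, Real.norm_eq_abs, sq_abs, hw2]
    ring
  have hX1 : ∀ i, |X i| ≤ 4 * (x * y) + 16 * y ^ 2 := fun i => by rw [← hR]; exact e1 i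
  have hgn : ∀ i, ‖(w • z) i‖ = w * ‖z i‖ := fun i => by
    rw [Pi.smul_apply, norm_smul, Real.norm_of_nonneg hw.le]
  have ha : ∀ i, |rowWeight v (((n : ℝ) - 1) / N) (w • z) i| ≤
      |v i| ^ 2 + w ^ 2 * (4 * (x * y) + 16 * y ^ 2) := fun i => by
    rw [haw]
    refine (abs_add_le _ _).trans ?_
    rw [abs_pow, abs_mul, abs_of_nonneg (sq_nonneg w)]
    gcongr
    exact hX1 i
  have hη0 : 0 ≤ η := le_trans (by positivity) b4
  refine (entrywiseClose_of_bounds hn hA hη0 hη hlam0 (Q := w * (4 * √(2 * L)))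
    (by positivity) hz.symm rfl ?_ ?_ ?_ ?_ ?_ ?_).mono fun j => ?_
  · simp only [haw]
    have : ∑ i, (v i ^ 2 + w ^ 2 * X i) * v i ^ 2 - 3 / (N : ℝ) - lam =
        w ^ 2 * ∑ i, v i ^ 2 * X i := by
      simp only [lam, ellNorm_four_pow, add_mul, Finset.sum_add_distrib, Finset.mul_sum]
      rw [sub_sub, show ∀ a : ℝ, 3 / (N : ℝ) + (a - 3 / N) = a from fun a => by ring,
        add_sub_right_comm, add_eq_right.2]
      · exact Finset.sum_congr rfl fun i _ => by ring
      · rw [sub_eq_zero]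
        exact Finset.sum_congr rfl fun i _ => by ring
    rw [this, abs_mul, abs_of_nonneg (sq_nonneg w)]
    refine le_trans ?_ b1
    gcongr
    refine e2.trans (le_of_eq ?_)
    rw [h4, Real.sqrt_mul (by positivity), Real.sqrt_mul (by positivity), Real.sqrt_sq hq₄, hy2]
  · refine (gramOp_isSymmetric _ _ _ _).norm_apply_le fun p => ?_
    -- The two sums are centred at w²‖v‖² and 2N w⁴ = 2w²; against the shift 3/N = 3w² there remains
    -- w² (‖v‖² - 1).
    have : ⟪gramOp Finset.univ (rowWeight v (((n : ℝ) - 1) / N) (w • z)) (w • z) (3 / N) p, p⟫ =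
        w ^ 2 * ⟪gramOp Finset.univ (fun i => v i ^ 2) z (∑ i, v i ^ 2) p, p⟫ +
        w ^ 4 * ⟪gramOp Finset.univ X z (2 * N) p, p⟫ +
        w ^ 2 * (ellNorm 2 v ^ 2 - 1) * ‖p‖ ^ 2 := by
      simp only [inner_gramOp_self, haw, hV2, Pi.smul_apply, real_inner_smul_left, add_mul,
        Finset.sum_add_distrib, mul_sub, Finset.mul_sum]
      have k1 : ∑ i, v i ^ 2 * (w * ⟪z i, p⟫) ^ 2 = ∑ i, w ^ 2 * (v i ^ 2 * ⟪z i, p⟫ ^ 2) :=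
        Finset.sum_congr rfl fun i _ => by ring
      have k2 : ∑ i, w ^ 2 * X i * (w * ⟪z i, p⟫) ^ 2 = ∑ i, w ^ 4 * (X i * ⟪z i, p⟫ ^ 2) :=
        Finset.sum_congr rfl fun i _ => by ring
      have k3 : w ^ 4 * (2 * (N : ℝ) * ‖p‖ ^ 2) = w ^ 2 * (2 * ‖p‖ ^ 2) := by
        have : w ^ 2 * (N : ℝ) = 1 := by rw [hw2]; field_simp
        linear_combination (2 * w ^ 2 * ‖p‖ ^ 2) * this
      have k4 : 3 / (N : ℝ) * ‖p‖ ^ 2 = 3 * w ^ 2 * ‖p‖ ^ 2 := by rw [hw2]; ring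
      rw [k1, k2, k3, k4, ← Finset.mul_sum (s := Finset.univ) (f := fun i => v i ^ 2) (a := w ^ 2)]
      ring
    rw [this]
    have c1 := e5 p
    have c2 := e6 p
    rw [h4, Real.sqrt_mul (by positivity), Real.sqrt_sq hq₄] at c1
    rw [Real.sqrt_mul (by positivity), Real.sqrt_mul (by positivity), hR] at c2
    have hwi : √(N : ℝ) = w⁻¹ := (inv_inv _).symm
    have hNw : (N : ℝ) = w⁻¹ ^ 2 := by rw [← hwi, Real.sq_sqrt hN0.le]
    have hnL : (n : ℝ) + L = x ^ 2 + y ^ 2 := by rw [hx2, hy2]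
    calc _ ≤ w ^ 2 * (32 * (4 * (ellNorm 4 v ^ 2 * (x + y)) + 16 * ellNorm ∞ v ^ 2 *
            (x ^ 2 + y ^ 2)) * ‖p‖ ^ 2) + w ^ 4 * (32 * (1800 * (x * w⁻¹ * (x + y)) +
            64 * (4 * (x * y) + 16 * y ^ 2) * (x ^ 2 + y ^ 2) +
            w⁻¹ ^ 2 * (327682 * x * Real.exp (-L))) * ‖p‖ ^ 2) +
            w ^ 2 * |ellNorm 2 v ^ 2 - 1| * ‖p‖ ^ 2 := by
          refine (abs_add_le _ _).trans (add_le_add ((abs_add_le _ _).trans (add_le_add ?_ ?_))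
            (le_of_eq ?_))
          · rw [abs_mul, abs_of_nonneg (sq_nonneg w), ← hnL]
            gcongr
            exact c1.trans (by gcongr)
          · rw [abs_mul, abs_of_nonneg (by positivity : 0 ≤ w ^ 4), ← hnL, ← hNw, ← hwi]
            gcongr
            exact c2.trans (by gcongr)
          · rw [abs_mul, abs_mul, abs_of_nonneg (sq_nonneg w), abs_of_nonneg (sq_nonneg ‖p‖)]
      _ ≤ _ := by
          refine le_trans (le_of_eq ?_) (mul_le_mul_of_nonneg_right b3 (sq_nonneg ‖p‖))
          ring
  · have : ∑ i, (rowWeight v (((n : ℝ) - 1) / N) (w • z) i * v i) • (w • z) i =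
        w • ∑ i, v i ^ 3 • z i + w ^ 3 • ∑ i, (v i * X i) • z i := by
      simp only [haw, Pi.smul_apply, Finset.smul_sum, smul_smul, ← Finset.sum_add_distrib,
        ← add_smul]
      exact Finset.sum_congr rfl fun i _ => by congr 1; ring
    rw [this]
    refine (norm_add_le _ _).trans (le_trans ?_ b2)
    rw [norm_smul, norm_smul, Real.norm_of_nonneg hw.le, Real.norm_of_nonneg (by positivity)]
    gcongr
    · refine e3.trans ?_
      rw [h6, Real.sqrt_mul (by positivity), Real.sqrt_sq hq₆]
      gcongr
    · refine e4.trans (le_of_eq ?_)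
      rw [hx2, show y ^ 4 = (y ^ 2) ^ 2 by ring, hy2]
  · intro j
    refine le_trans ?_ b4
    rw [hgn, mul_pow]
    gcongr
    · refine (ha j).trans ?_
      gcongr
      exact hvm j
    · exact hzn j
  · intro j
    refine le_trans ?_ b5
    rw [hgn, abs_mul]
    gcongr ?_ * (w * ?_)
    · calc _ ≤ (|v j| ^ 2 + w ^ 2 * (4 * (x * y) + 16 * y ^ 2)) * |v j| := by
            gcongr; exact ha j
        _ = |v j| ^ 3 + w ^ 2 * ((4 * (x * y) + 16 * y ^ 2) * |v j|) := by ring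
        _ ≤ _ := by
            refine add_le_add (hv6 j) ?_
            gcongr
            exact hvm j
    · exact hzn j
  · intro j k
    have := e7 j k
    rw [looVec] at this
    rw [Pi.smul_apply, real_inner_smul_left, abs_mul, abs_of_pos hw]
    calc _ ≤ w * (4 * √(2 * L) * (k + 1) * _) := by gcongr
      _ = _ := by ring
  -- 4√(2L) ≤ 6√L, whence 192 = 32·6.
  · have h2 : √(2 * L) ≤ 3 / 2 * y := by
      rw [Real.sqrt_le_left (by positivity)]
      rw [mul_pow, hy2]
      linarith
    have h3 : y / √(N : ℝ) = w * y := by rw [div_eq_mul_inv, mul_comm]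
    rw [h3]
    calc 32 * η / |lam| * (|v j| + w * (4 * √(2 * L)))
        ≤ 32 * η / |lam| * (6 * (|v j| + w * y)) := by
          gcongr
          have : w * (4 * √(2 * L)) ≤ w * (4 * (3 / 2 * y)) := by gcongr
          linarith [abs_nonneg (v j)]
      _ = _ := by ring

end ofRowEvents

/-! ### The law of the rows and the precise form. -/

section law

lemma Measure.pi_map_curry {ι κ X : Type*} [Fintype ι] [Fintype κ] [MeasurableSpace X]
    (ν : Measure X) [IsProbabilityMeasure ν] :
    (Measure.pi fun _ : ι × κ => ν).map Function.curry =
      Measure.pi fun _ : ι => Measure.pi fun _ : κ => ν := by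
  classical
  have hu : Measurable (Function.uncurry : (ι → κ → X) → ι × κ → X) := by fun_prop
  have hc : Measurable (Function.curry : (ι × κ → X) → ι → κ → X) := by fun_prop
  have h : Measure.pi (fun _ : ι × κ => ν) =
      (Measure.pi fun _ : ι => Measure.pi fun _ : κ => ν).map Function.uncurry := by
    refine Measure.pi_eq fun s hs => ?_
    rw [Measure.map_apply hu (MeasurableSet.univ_pi hs)]
    have : (Function.uncurry : (ι → κ → X) → ι × κ → X) ⁻¹' (Set.univ.pi s) =
        Set.univ.pi fun i => Set.univ.pi fun k => s (i, k) := by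
      ext f
      simp [Set.mem_pi]
    rw [this, Measure.pi_pi, Fintype.prod_prod_type]
    exact Finset.prod_congr rfl fun i _ => Measure.pi_pi _ _
  rw [h, Measure.map_map hc hu]
  exact Measure.map_id

variable {Ω : Type*} [MeasurableSpace Ω] {μ : Measure Ω} {N n : ℕ}
  {v : Fin N → ℝ} {Y : Ω → Matrix (Fin N) (Fin n) ℝ}

lemma IsGaussianBasis.hasLaw_rowTail [IsProbabilityMeasure μ] (hY : IsGaussianBasis μ v Y)
    (hN : 0 < N) :
    HasLaw (fun ω => √(N : ℝ) • rowTail (Y ω))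
      (Measure.pi fun _ : Fin N => stdGaussian (EuclideanSpace ℝ {k : Fin n // (k : ℕ) ≠ 0}))
      μ := by
  have hN0 : (0 : ℝ) < N := by exact_mod_cast hN
  have hone : HasLaw (fun y : ℝ => √(N : ℝ) * y) (gaussianReal 0 1)
      (gaussianReal 0 (1 / (N : ℝ≥0))) := by
    refine ⟨by fun_prop, ?_⟩
    rw [gaussianReal_map_const_mul, mul_zero]
    congr 1
    ext
    simp [Real.sq_sqrt hN0.le, hN0.ne']
  have hent : ∀ p : Fin N × {k : Fin n // (k : ℕ) ≠ 0},
      HasLaw (fun ω => √(N : ℝ) * Y ω p.1 p.2) (gaussianReal 0 1) μ := fun p =>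
    hone.comp (hY.gaussian p.1 p.2 p.2.2)
  have hind : iIndepFun (fun (p : Fin N × {k : Fin n // (k : ℕ) ≠ 0}) ω =>
      √(N : ℝ) * Y ω p.1 p.2) μ :=
    hY.indep.comp (fun _ y => √(N : ℝ) * y) fun _ => by fun_prop
  have h1 := hind.hasLaw_pi hent
  have h2 : HasLaw Function.curry (Measure.pi fun _ : Fin N =>
      Measure.pi fun _ : {k : Fin n // (k : ℕ) ≠ 0} => gaussianReal 0 1)
      (Measure.pi fun _ : Fin N × {k : Fin n // (k : ℕ) ≠ 0} => gaussianReal 0 1) :=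
    ⟨by fun_prop, Measure.pi_map_curry _⟩
  have h3 : HasLaw (fun (y : Fin N → {k : Fin n // (k : ℕ) ≠ 0} → ℝ) i => WithLp.toLp 2 (y i))
      (Measure.pi fun _ : Fin N => stdGaussian (EuclideanSpace ℝ {k : Fin n // (k : ℕ) ≠ 0}))
      (Measure.pi fun _ : Fin N =>
        Measure.pi fun _ : {k : Fin n // (k : ℕ) ≠ 0} => gaussianReal 0 1) := by
    refine ⟨Measurable.aemeasurable (by fun_prop), ?_⟩
    have : ∀ _ : Fin N, SigmaFinite (Measure.map (WithLp.toLp 2)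
        (Measure.pi fun _ : {k : Fin n // (k : ℕ) ≠ 0} => gaussianReal 0 1)) := fun _ => by
      rw [map_pi_eq_stdGaussian]; infer_instance
    rw [Measure.pi_map_pi fun _ => Measurable.aemeasurable (by fun_prop), map_pi_eq_stdGaussian]
  exact h3.comp (h2.comp h1)

/-- An inequality is enough and spares the measurability of S, which will be the failure set of
`RowEvents`. -/
lemma IsGaussianBasis.measure_rowTail_le [IsProbabilityMeasure μ] (hY : IsGaussianBasis μ v Y)
    (hN : 0 < N)
    (S : Set (Fin N → EuclideanSpace ℝ {k : Fin n // (k : ℕ) ≠ 0})) :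
    μ {ω | √(N : ℝ) • rowTail (Y ω) ∈ S} ≤ (Measure.pi fun _ : Fin N =>
      stdGaussian (EuclideanSpace ℝ {k : Fin n // (k : ℕ) ≠ 0})) S := by
  have h := hY.hasLaw_rowTail hN
  rw [← h.map_eq]
  exact Measure.le_map_apply h.aemeasurable S

lemma IsGaussianBasis.measure_not_rowEvents_le [IsProbabilityMeasure μ]
    (hY : IsGaussianBasis μ v Y) (hN : 16 ≤ N) (hn : 0 < n) (hv : v ≠ 0) {δ : ℝ} (hδ : 0 < δ)
    (hδ1 : δ < 1) (hL : 1 ≤ Real.log (N / δ)) :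
    μ {ω | ¬ RowEvents v n (Real.log (N / δ)) (((n : ℝ) - 1) / N) (3 / N) (√(N : ℝ))⁻¹
      (√(N : ℝ) • rowTail (Y ω))} ≤ ENNReal.ofReal δ := by
  have hN16 : (16 : ℝ) ≤ N := by exact_mod_cast hN
  obtain ⟨i₀, hi₀⟩ : ∃ i, v i ≠ 0 := Function.ne_iff.1 hv
  have hsum : ∀ p : ℕ, 0 < ∑ i, (v i ^ p) ^ 2 := fun p =>
    lt_of_lt_of_le (by positivity) (Finset.single_le_sum (f := fun i => (v i ^ p) ^ 2)
      (fun i _ => sq_nonneg _) (Finset.mem_univ i₀))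
  have hvm : 0 < ellNorm ∞ v := lt_of_lt_of_le (abs_pos.2 hi₀) (abs_le_ellNorm_top v i₀)
  have hfin : ((Module.finrank ℝ (EuclideanSpace ℝ {k : Fin n // (k : ℕ) ≠ 0}) : ℕ) : ℝ) ≤ n := by
    rw [finrank_rowTail hn]; exact_mod_cast n.sub_le 1
  have hprob := measureReal_not_rowEvents_le hfin (by exact_mod_cast hn) hL hvm
    (by simpa using hsum 1) (hsum 3) (((n : ℝ) - 1) / N) (3 / N) (√(N : ℝ))⁻¹
  set S := {z : Fin N → EuclideanSpace ℝ {k : Fin n // (k : ℕ) ≠ 0} |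
    ¬ RowEvents v n (Real.log (N / δ)) (((n : ℝ) - 1) / N) (3 / N) (√(N : ℝ))⁻¹ z}
  -- e^(-2L) = (δ/N)², while 6N + 10 ≤ N² for N ≥ 16 and δ² ≤ δ.
  have hexp : (6 * (N : ℝ) + 10) * Real.exp (-(2 * Real.log (N / δ))) ≤ δ := by
    have : Real.exp (-(2 * Real.log (N / δ))) = δ ^ 2 / N ^ 2 := by
      rw [Real.exp_neg, two_mul, Real.exp_add, Real.exp_log (by positivity)]
      field_simp
    rw [this, mul_div_assoc', div_le_iff₀ (by positivity)]
    have h1 : δ ^ 2 ≤ δ := by nlinarith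
    have h2 : 6 * (N : ℝ) + 10 ≤ N ^ 2 := by nlinarith
    calc (6 * (N : ℝ) + 10) * δ ^ 2 ≤ N ^ 2 * δ := by gcongr
      _ = _ := by ring
  calc _ ≤ _ := hY.measure_rowTail_le (by omega) S
    _ = ENNReal.ofReal ((Measure.pi fun _ : Fin N =>
          stdGaussian (EuclideanSpace ℝ {k : Fin n // (k : ℕ) ≠ 0})).real S) :=
        (ENNReal.ofReal_toReal (measure_ne_top _ _)).symm
    _ ≤ _ := ENNReal.ofReal_le_ofReal (hprob.trans hexp)

/-- The spectral estimate with probability `1 - δ`. -/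
theorem IsGaussianBasis.measure_not_entrywiseClose_le [IsProbabilityMeasure μ]
    (hY : IsGaussianBasis μ v Y) (hN : 16 ≤ N)
    (hn : 0 < n) {δ : ℝ} (hδ : 0 < δ) (hδ1 : δ < 1) (hLN : Real.log (N / δ) ^ 7 ≤ N)
    (hlam : ellNorm 4 v ^ 4 ≠ 3 / N)
    (hη : etaRate 20000000 n v δ / |ellNorm 4 v ^ 4 - 3 / N| ≤ 1 / 32) :
    μ {ω | ¬ ∀ Q ∈ Matrix.orthogonalGroup (Fin n) ℝ, EntrywiseClose (Y ω * Q) v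
      (fun j => 192 * etaRate 20000000 n v δ / |ellNorm 4 v ^ 4 - 3 / N|
        * (|v j| + √(Real.log (N / δ)) / √(N : ℝ)))} ≤ ENNReal.ofReal δ := by
  have hN' : 0 < N := by omega
  have hN16 : (16 : ℝ) ≤ N := by exact_mod_cast hN
  have hN0 : (0 : ℝ) < N := by linarith
  have hlam0 : 0 < |ellNorm 4 v ^ 4 - 3 / N| := abs_pos.2 (sub_ne_zero.2 hlam)
  have hη' : 32 * etaRate 20000000 n v δ ≤ |ellNorm 4 v ^ 4 - 3 / N| := by
    rw [div_le_iff₀ hlam0] at hη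
    linarith
  have hL : 1 ≤ Real.log (N / δ) := by
    rw [Real.le_log_iff_exp_le (by positivity), le_div_iff₀ hδ]
    have := Real.exp_one_lt_d9
    nlinarith [Real.exp_pos 1]
  have hL3 : Real.log (N / δ) ^ 3 ≤ N := (pow_le_pow_right₀ hL (by norm_num)).trans hLN
  -- For v = 0 the term with |‖v‖² - 1| alone gives η ≥ 20000000/N, against a gap of 3/N.
  have hv : v ≠ 0 := fun hv0 => by
    have e2 : ellNorm 2 v = 0 := by rw [hv0, ellNorm]; exact norm_zero
    have e4 : ellNorm 4 v ^ 4 = 0 := by rw [ellNorm_four_pow, hv0]; simp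
    rw [etaRate_eq _ _ _ hN' (by linarith), e4, e2, zero_sub, abs_neg,
      abs_of_pos (by positivity : (0 : ℝ) < 3 / N)] at hη'
    have hw2 : (√(N : ℝ))⁻¹ ^ 2 = 1 / N := by rw [inv_pow, Real.sq_sqrt hN0.le, one_div]
    have h6 : 0 ≤ ellNorm 6 v := by
      have : Fact ((1 : ℝ≥0∞) ≤ 6) := ⟨by norm_num⟩
      exact ellNorm_nonneg 6 v
    have hle : ∀ a b c d e : ℝ, 0 ≤ a → 0 ≤ b → 0 ≤ c → 0 ≤ d → 0 ≤ e →
        32 * (20000000 * (a + b + c + d + e + (√(N : ℝ))⁻¹ ^ 2 * |(0 : ℝ) ^ 2 - 1|)) ≤ 3 / N →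
        False := fun a b c d e ha hb hc hd he h => by
      rw [hw2, show |(0 : ℝ) ^ 2 - 1| = 1 by norm_num, mul_one] at h
      have h1 : 0 < 1 / (N : ℝ) := by positivity
      rw [show 3 / (N : ℝ) = 3 * (1 / N) by ring] at h
      linarith
    refine hle _ _ _ _ _ ?_ ?_ ?_ ?_ ?_ hη' <;> positivity
  refine (measure_mono fun ω hω => ?_).trans (hY.measure_not_rowEvents_le hN hn hv hδ hδ1 hL)
  rw [Set.mem_ofPred_eq] at hω ⊢
  refine fun hev => hω fun Q hQ => EntrywiseClose.mul_orthogonal ?_ hQ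
  refine entrywiseClose_of_rowEvents hn hδ hL hN' hL3 hδ1.le
    (fun i => hY.first_column ω i ⟨0, hn⟩ rfl) ?_ hev hlam hη'
  rw [smul_smul, inv_mul_cancel₀ (Real.sqrt_pos.2 hN0).ne', one_smul]

end law

/-! ### The asymptotic form. -/

section asymptotic

variable {N n : ℕ} {v : Fin N → ℝ}

lemma epsRate_eq (v : Fin N → ℝ) :
    epsRate n v = 1 / ellNorm 4 v ^ 4 * (√n ^ 2 * (√N)⁻¹ ^ 3) +
      ellNorm ∞ v / ellNorm 4 v ^ 2 * (√n * (√N)⁻¹) := by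
  rw [epsRate, rpow_three_halves N.cast_nonneg, Real.sqrt_div n.cast_nonneg,
    Real.sq_sqrt n.cast_nonneg, inv_pow, div_eq_mul_inv (n : ℝ), div_eq_mul_inv (√(n : ℝ))]

lemma ellNorm_four_sq_le (hv : ellNorm 2 v = 1) : ellNorm 4 v ^ 2 ≤ ellNorm ∞ v := by
  refine le_of_sq_le_sq ?_ (ellNorm_nonneg _ _)
  rw [← pow_mul, ellNorm_four_pow]
  have h2 := ellNorm_two_sq v
  rw [hv, one_pow] at h2
  calc ∑ i, v i ^ 4 ≤ ∑ i, ellNorm ∞ v ^ 2 * v i ^ 2 := by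
        refine Finset.sum_le_sum fun i _ => ?_
        rw [show v i ^ 4 = v i ^ 2 * v i ^ 2 by ring, ← sq_abs (v i)]
        gcongr
        exact abs_le_ellNorm_top v i
    _ = _ := by rw [← Finset.mul_sum, ← h2, mul_one]

lemma ellNorm_six_cube_le (v : Fin N → ℝ) : ellNorm 6 v ^ 3 ≤ ellNorm ∞ v * ellNorm 4 v ^ 2 := by
  refine le_of_sq_le_sq ?_ (mul_nonneg (ellNorm_nonneg _ _) (sq_nonneg _))
  rw [← pow_mul, mul_pow, ← pow_mul, ellNorm_six_pow, ellNorm_four_pow, Finset.mul_sum]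
  refine Finset.sum_le_sum fun i _ => ?_
  rw [show v i ^ 6 = v i ^ 2 * v i ^ 4 by ring, ← sq_abs (v i)]
  gcongr
  exact abs_le_ellNorm_top v i

lemma inv_sqrt_le_ellNorm_top (hv : ellNorm 2 v = 1) (hN : 0 < N) :
    (√(N : ℝ))⁻¹ ≤ ellNorm ∞ v := by
  refine le_of_sq_le_sq ?_ (ellNorm_nonneg _ _)
  have hN0 : (0 : ℝ) < N := by exact_mod_cast hN
  have h2 := ellNorm_two_sq v
  rw [hv, one_pow] at h2
  rw [inv_pow, Real.sq_sqrt hN0.le, inv_le_iff_one_le_mul₀ hN0]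
  calc (1 : ℝ) = ∑ i, v i ^ 2 := h2
    _ ≤ ∑ _i : Fin N, ellNorm ∞ v ^ 2 := by
        refine Finset.sum_le_sum fun i _ => ?_
        rw [← sq_abs]
        gcongr
        exact abs_le_ellNorm_top v i
    _ = _ := by simp [mul_comm]

lemma ellNorm_four_pos (hv : ellNorm 2 v = 1) : 0 < ellNorm 4 v := by
  have : Fact ((1 : ℝ≥0∞) ≤ 4) := ⟨by norm_num⟩
  refine norm_pos_iff.2 fun h => ?_
  have h0 : v = 0 := congrArg WithLp.ofLp h
  rw [h0, ellNorm, WithLp.toLp_zero, norm_zero] at hv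
  exact zero_ne_one hv

/-- Since ‖v‖₄² ≤ ‖v‖_∞ for a unit vector, the second summand of `epsRate` is at least √(n/N). This
keeps the rate from being too small when N is bounded. -/
lemma inv_sqrt_le_epsRate (hv : ellNorm 2 v = 1) (hn : 0 < n) :
    (√(N : ℝ))⁻¹ ≤ epsRate n v := by
  have hq := ellNorm_four_pos hv
  have hn1 : 1 ≤ √(n : ℝ) := Real.one_le_sqrt.2 (by exact_mod_cast hn)
  rw [epsRate_eq]
  have h1 : 1 ≤ ellNorm ∞ v / ellNorm 4 v ^ 2 := by
    rw [one_le_div (by positivity)]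
    exact ellNorm_four_sq_le hv
  have h2 : 0 ≤ 1 / ellNorm 4 v ^ 4 * (√(n : ℝ) ^ 2 * (√(N : ℝ))⁻¹ ^ 3) := by positivity
  calc (√(N : ℝ))⁻¹ = 1 * (1 * (√(N : ℝ))⁻¹) := by ring
    _ ≤ ellNorm ∞ v / ellNorm 4 v ^ 2 * (√n * (√N)⁻¹) := by gcongr
    _ ≤ _ := by linarith

/-- With a = n/N^(3/2) and b = ‖v‖₄² ‖v‖_∞ √(n/N) one has ‖v‖₄⁴ ε = a + b, and the terms of η are at
most L² times 2a, b, 2b, 2b, a and 0. The assumption ε ≤ 1 gives ‖v‖_∞ √(n/N) ≤ ‖v‖₄², which handles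
the term in ‖v‖_∞². -/
lemma etaRate_le_epsRate (hv : ellNorm 2 v = 1) (hn : 0 < n) (hnN : n ≤ N) {δ : ℝ}
    (hL : 1 ≤ Real.log (N / δ)) (hε : epsRate n v ≤ 1) {A : ℝ} (hA : 0 ≤ A) :
    etaRate A n v δ ≤ A * (8 * Real.log (N / δ) ^ 2 * (ellNorm 4 v ^ 4 * epsRate n v)) := by
  have hN : 0 < N := hn.trans_le hnN
  have hx : 1 ≤ √(n : ℝ) := Real.one_le_sqrt.2 (by exact_mod_cast hn)
  have hy : 1 ≤ √(Real.log (N / δ)) := Real.one_le_sqrt.2 hL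
  have hm := inv_sqrt_le_ellNorm_top hv hN
  have hq := ellNorm_four_pos hv
  have h6 := ellNorm_six_cube_le v
  have hr : 0 < √(N : ℝ) := Real.sqrt_pos.2 (by exact_mod_cast hN)
  have hxw : √(n : ℝ) * (√(N : ℝ))⁻¹ ≤ 1 := by
    rw [← div_eq_mul_inv, div_le_one hr]
    exact Real.sqrt_le_sqrt (by exact_mod_cast hnN)
  rw [etaRate_eq A n v hN (by linarith), hv]
  rw [show Real.log (N / δ) ^ 2 = √(Real.log (N / δ)) ^ 4 by
    rw [show √(Real.log (N / δ)) ^ 4 = (√(Real.log (N / δ)) ^ 2) ^ 2 by ring,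
      Real.sq_sqrt (by linarith)]]
  have hw : 0 < (√(N : ℝ))⁻¹ := by positivity
  rw [epsRate_eq] at hε ⊢
  rw [show ellNorm 4 v ^ 4 = (ellNorm 4 v ^ 2) ^ 2 by ring] at hε ⊢
  have hq2 : 0 < ellNorm 4 v ^ 2 := by positivity
  generalize √(n : ℝ) = x at *
  generalize √(Real.log (N / δ)) = y at *
  generalize (√(N : ℝ))⁻¹ = w at *
  generalize ellNorm ∞ v = m at *
  generalize ellNorm 4 v ^ 2 = q at *
  generalize ellNorm 6 v ^ 3 = q₆ at *
  have hm0 : 0 < m := hw.trans_le hm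
  have hx0 : 0 < x := by linarith
  have hy0 : 0 < y := by linarith
  set a := x ^ 2 * w ^ 3
  set b := q * (m * (x * w))
  have ha : 0 < a := by positivity
  have hb : 0 < b := by positivity
  have e1 : q ^ 2 * (1 / q ^ 2 * a + m / q * (x * w)) = a + b := by
    simp only [b]; field_simp
  rw [e1]
  have hε' : m * (x * w) ≤ q := by
    have h1 : m / q * (x * w) ≤ 1 := le_trans (le_add_of_nonneg_left (by positivity)) hε
    rw [div_mul_eq_mul_div, div_le_one hq2] at h1
    exact h1
  have hy14 : y ≤ y ^ 4 := le_self_pow₀ hy (by norm_num)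
  have hy34 : y ^ 3 ≤ y ^ 4 := pow_le_pow_right₀ hy (by norm_num)
  have hy24 : y ^ 2 ≤ y ^ 4 := pow_le_pow_right₀ hy (by norm_num)
  have f1 : x ^ 2 * y * w ^ 3 ≤ y ^ 4 * a := by
    calc x ^ 2 * y * w ^ 3 = y * a := by simp only [a]; ring
      _ ≤ _ := by gcongr
  have f2 : q * (x * y * w ^ 2) ≤ y ^ 4 * b := by
    calc q * (x * y * w ^ 2) = y * (q * (w * (x * w))) := by ring
      _ ≤ y ^ 4 * (q * (m * (x * w))) := by gcongr
  have f3 : q₆ * ((x + y) * w) ≤ 2 * (y ^ 4 * b) := by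
    calc q₆ * ((x + y) * w) ≤ m * q * ((2 * (x * y)) * w) := by
          gcongr
          nlinarith only [hx, hy]
      _ = 2 * (y * b) := by simp only [b]; ring
      _ ≤ _ := by gcongr
  have f4 : m ^ 2 * ((x ^ 2 * y ^ 2 + y ^ 4) * w ^ 2) ≤ 2 * (y ^ 4 * b) := by
    have hx2 : 1 ≤ x ^ 2 := one_le_pow₀ hx
    calc m ^ 2 * ((x ^ 2 * y ^ 2 + y ^ 4) * w ^ 2)
        ≤ m ^ 2 * ((x ^ 2 * y ^ 4 + x ^ 2 * y ^ 4) * w ^ 2) := by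
          gcongr
          exact le_mul_of_one_le_left (by positivity) hx2
      _ = 2 * (y ^ 4 * (m * (x * w) * (m * (x * w)))) := by ring
      _ ≤ 2 * (y ^ 4 * (q * (m * (x * w)))) := by gcongr
  have f5 : x ^ 3 * y ^ 3 * w ^ 4 ≤ y ^ 4 * a := by
    calc x ^ 3 * y ^ 3 * w ^ 4 = y ^ 3 * (x * w * a) := by simp only [a]; ring
      _ ≤ y ^ 4 * (1 * a) := by gcongr
      _ = _ := by ring
  have f6 : 0 < y ^ 4 * a := by positivity
  have f7 : 0 < y ^ 4 * b := by positivity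
  refine mul_le_mul_of_nonneg_left ?_ hA
  norm_num
  linarith

/-- If ‖v‖₄⁴ ≥ 4/N, subtracting 3/N leaves at least a quarter of it; otherwise ‖v‖₄⁴ < 4/N, and the
assumed gap c/N is comparable with it. -/
lemma le_abs_four_sub (hN : 0 < N) {c : ℝ} (hc : c / N ≤ |ellNorm 4 v ^ 4 - 3 / N|) :
    min c 1 / 4 * ellNorm 4 v ^ 4 ≤ |ellNorm 4 v ^ 4 - 3 / N| := by
  have hN0 : (0 : ℝ) < N := by exact_mod_cast hN
  have h4 : 0 ≤ ellNorm 4 v ^ 4 := by positivity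
  rcases le_or_gt (4 / (N : ℝ)) (ellNorm 4 v ^ 4) with h | h
  · refine le_trans ?_ (le_abs_self _)
    have h1 : min c 1 / 4 * ellNorm 4 v ^ 4 ≤ 1 / 4 * ellNorm 4 v ^ 4 := by
      gcongr; exact min_le_right _ _
    have h2 : 3 / (N : ℝ) = 3 / 4 * (4 / N) := by ring
    rw [h2]
    linarith
  · rcases le_or_gt 0 (min c 1) with hc0 | hc0
    · refine le_trans ?_ hc
      calc min c 1 / 4 * ellNorm 4 v ^ 4 ≤ c / 4 * (4 / N) := by
            have h1 : min c 1 ≤ c := min_le_left _ _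
            exact mul_le_mul (by linarith) h.le h4 (by linarith)
        _ = _ := by ring
    · refine le_trans ?_ (abs_nonneg _)
      exact mul_nonpos_of_nonpos_of_nonneg (by linarith) h4

/-- Cauchy–Schwarz: the crude bound for N below a threshold depending on c. -/
lemma entrywiseClose_of_row_norm_le {A : Matrix (Fin N) (Fin n) ℝ} {T : ℝ}
    (hA : ∀ j, ellNorm 2 (A j) ≤ T) : EntrywiseClose A v fun j => T + |v j| := by
  rintro u ⟨hu, -⟩
  refine ⟨1, Or.inl rfl, fun j => ?_⟩
  rw [one_smul]
  refine (norm_sub_le (A j ⬝ᵥ u) (v j)).trans (add_le_add_left ?_ _)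
  rw [Real.norm_eq_abs]
  have h := abs_real_inner_le_norm (WithLp.toLp 2 (A j) : EuclideanSpace ℝ (Fin n))
    (WithLp.toLp 2 u)
  have e : ⟪(WithLp.toLp 2 (A j) : EuclideanSpace ℝ (Fin n)), WithLp.toLp 2 u⟫ = A j ⬝ᵥ u := by
    simp [EuclideanSpace.inner_eq_star_dotProduct, dotProduct_comm]
  rw [e] at h
  refine h.trans ?_
  calc ‖(WithLp.toLp 2 (A j) : EuclideanSpace ℝ (Fin n))‖ *
        ‖(WithLp.toLp 2 u : EuclideanSpace ℝ (Fin n))‖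
      = ellNorm 2 (A j) * ellNorm 2 u := rfl
    _ ≤ T := by rw [hu, mul_one]; exact hA j

/-- The event on the row norms bounds the squared tail by 1 + 4 + 16 = 21, and v_j² ≤ 1. -/
lemma ellNorm_row_le_of_rowEvents (hn : 0 < n) (hnN : n ≤ N) {A : Matrix (Fin N) (Fin n) ℝ}
    (hA : ∀ i, A i ⟨0, hn⟩ = v i) (hv : ellNorm 2 v = 1) {L κ κ₀ c : ℝ} (hL : 0 ≤ L) (hLN : L ≤ N)
    (hev : RowEvents v n L κ κ₀ c (√(N : ℝ) • rowTail A)) (j : Fin N) : ellNorm 2 (A j) ≤ 6 := by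
  refine le_of_sq_le_sq ?_ (by norm_num)
  have hN0 : (0 : ℝ) < N := by exact_mod_cast hn.trans_le hnN
  have hnN' : (n : ℝ) ≤ N := by exact_mod_cast hnN
  have h1 := (le_abs_self _).trans (hev.dev j)
  have h2 : √(n * L) ≤ N := by
    rw [Real.sqrt_le_left hN0.le, sq]
    gcongr
  have h3 : v j ^ 2 ≤ 1 := by
    have h2 := ellNorm_two_sq v
    rw [hv, one_pow] at h2
    rw [h2]
    exact Finset.single_le_sum (f := fun i => v i ^ 2) (fun i _ => sq_nonneg _) (Finset.mem_univ j)
  have h4 : ‖rowTail A j‖ ^ 2 ≤ 21 := by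
    rw [chiDev, finrank_rowTail hn, Pi.smul_apply, norm_smul, mul_pow, Real.norm_eq_abs, sq_abs,
      Real.sq_sqrt hN0.le, devRadius, Nat.cast_pred hn] at h1
    have : N * ‖rowTail A j‖ ^ 2 ≤ N * 21 := by linarith
    exact le_of_mul_le_mul_left this hN0
  have e : ellNorm 2 (A j) ^ 2 = v j ^ 2 + ‖rowTail A j‖ ^ 2 := by
    rw [ellNorm_two_sq, sum_eq_zero_add_sum_subtype hn, hA, EuclideanSpace.real_norm_sq_eq]
    rfl
  rw [e]
  linarith

lemma exists_forall_log_pow_le (p : ℕ) (C : ℝ) : ∃ N₀ : ℕ, ∀ N : ℕ, N₀ ≤ N →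
    C * Real.log N ^ p ≤ N := by
  have h := (Real.isLittleO_pow_log_id_atTop (n := p)).def (c := (|C| + 1)⁻¹) (by positivity)
  obtain ⟨N₀, hN₀⟩ := eventually_atTop.1 (tendsto_natCast_atTop_atTop.eventually h)
  refine ⟨N₀, fun N hN => ?_⟩
  have h1 := hN₀ N hN
  rw [id, Real.norm_of_nonneg (N.cast_nonneg : (0 : ℝ) ≤ N), inv_mul_eq_div,
    le_div_iff₀ (by positivity)] at h1
  refine (le_abs_self _).trans ?_
  rw [abs_mul, ← Real.norm_eq_abs (_ ^ p)]
  nlinarith [norm_nonneg (Real.log (N : ℝ) ^ p)]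

variable {Ω : Type*} [MeasurableSpace Ω] {μ : Measure Ω} [IsProbabilityMeasure μ]
  {Y : Ω → Matrix (Fin N) (Fin n) ℝ}

/-- The spectral estimate with probability `1 - N ^ (-log N)`. -/
theorem IsGaussianBasis.measure_not_entrywiseClose_epsRate_le (hY : IsGaussianBasis μ v Y)
    (hN : 16 ≤ N) (hlogN : 128 * Real.log N ^ 14 ≤ N) (hn : 0 < n) (hnN : n ≤ N)
    (hv : ellNorm 2 v = 1) {c : ℝ} (hc0 : 0 < c) (hc : c / N ≤ |ellNorm 4 v ^ 4 - 3 / N|)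
    (hε : epsRate n v ≤ 1 / Real.log N ^ 5) {H K : ℝ} (hH : H = 2560000000 / min c 1)
    (hK : K = 384 * H + 7 * Real.exp (32 * H)) :
    μ {ω | ¬ ∀ Q ∈ Matrix.orthogonalGroup (Fin n) ℝ, EntrywiseClose (Y ω * Q) v
      (fun j => K * Real.log N ^ 5 * (epsRate n v * (|v j| + 1 / √(N : ℝ))))}
      ≤ ENNReal.ofReal ((N : ℝ) ^ (-Real.log N)) := by
  have hN' : 0 < N := by omega
  have hN16 : (16 : ℝ) ≤ N := by exact_mod_cast hN
  have hN0 : (0 : ℝ) < N := by linarith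
  have hc1 : 0 < min c 1 := lt_min hc0 one_pos
  have hH0 : 0 < H := by rw [hH]; positivity
  have hl : 1 ≤ Real.log N := by
    rw [Real.le_log_iff_exp_le hN0]
    linarith [Real.exp_one_lt_d9]
  have hδ : 0 < (N : ℝ) ^ (-Real.log N) := by positivity
  have hδ1 : (N : ℝ) ^ (-Real.log N) < 1 :=
    Real.rpow_lt_one_of_one_lt_of_neg (by linarith) (by linarith)
  have hLeq : Real.log (N / (N : ℝ) ^ (-Real.log N)) = Real.log N + Real.log N ^ 2 := by
    rw [Real.log_div hN0.ne' hδ.ne', Real.log_rpow hN0]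
    ring
  generalize hδeq : (N : ℝ) ^ (-Real.log N) = δ at *
  have hell : Real.log N ≤ Real.log N ^ 2 := le_self_pow₀ hl (by norm_num)
  have hL1 : 1 ≤ Real.log (N / δ) := by rw [hLeq]; linarith
  have hL2 : Real.log (N / δ) ≤ 2 * Real.log N ^ 2 := by rw [hLeq]; linarith
  have hL7 : Real.log (N / δ) ^ 7 ≤ N := by
    calc Real.log (N / δ) ^ 7 ≤ (2 * Real.log N ^ 2) ^ 7 := by gcongr
      _ = 128 * Real.log N ^ 14 := by ring
      _ ≤ N := hlogN
  have hε0 := inv_sqrt_le_epsRate (N := N) hv hn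
  have hw : 0 < (√(N : ℝ))⁻¹ := inv_pos.2 (Real.sqrt_pos.2 hN0)
  have hl0 : 0 < Real.log N := by linarith
  have hl5 : 1 ≤ Real.log N ^ 5 := one_le_pow₀ hl
  set ε := epsRate n v
  have hεpos : 0 < ε := hw.trans_le hε0
  have hlam0 : 0 < |ellNorm 4 v ^ 4 - 3 / N| := lt_of_lt_of_le (by positivity) hc
  -- H (log N)⁴ ε bounds the ratio of η to the gap, with H = 20000000·8·2²·4/min(c, 1). As ε ≤ (log
  -- N)^(-5), it is at most 1/32 once log N ≥ 32H. Otherwise N < exp(32H), and the second summand of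
  -- K makes the claim crude.
  rcases le_or_gt (32 * H) (Real.log N) with hcase | hcase
  · have hη : etaRate 20000000 n v δ / |ellNorm 4 v ^ 4 - 3 / N| ≤ H * Real.log N ^ 4 * ε := by
      have hε1 : ε ≤ 1 := hε.trans (by rw [div_le_one (by positivity)]; exact hl5)
      have h4 : 0 < ellNorm 4 v ^ 4 := by have := ellNorm_four_pos hv; positivity
      rw [div_le_iff₀ hlam0]
      calc etaRate 20000000 n v δ
          ≤ 20000000 * (8 * Real.log (N / δ) ^ 2 * (ellNorm 4 v ^ 4 * ε)) :=
            etaRate_le_epsRate hv hn hnN hL1 hε1 (by norm_num)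
        _ ≤ 20000000 * (8 * (2 * Real.log N ^ 2) ^ 2 * (ellNorm 4 v ^ 4 * ε)) := by gcongr
        _ = H * Real.log N ^ 4 * ε * (min c 1 / 4 * ellNorm 4 v ^ 4) := by
            rw [hH]; field_simp; ring
        _ ≤ _ := by gcongr; exact le_abs_four_sub hN' hc
    have hη32 : etaRate 20000000 n v δ / |ellNorm 4 v ^ 4 - 3 / N| ≤ 1 / 32 := by
      refine hη.trans ?_
      calc H * Real.log N ^ 4 * ε ≤ Real.log N / 32 * Real.log N ^ 4 * (1 / Real.log N ^ 5) := by
            gcongr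
            linarith
        _ = 1 / 32 := by field_simp
    refine le_trans (measure_mono fun ω hω => ?_) (hY.measure_not_entrywiseClose_le hN hn hδ hδ1 hL7
      (sub_ne_zero.1 (abs_pos.1 hlam0)) hη32)
    rw [Set.mem_ofPred_eq] at hω ⊢
    refine fun hclose => hω fun Q hQ => (hclose Q hQ).mono fun j => ?_
    have hy : √(Real.log (N / δ)) ≤ 2 * Real.log N := by
      rw [Real.sqrt_le_left (by positivity), mul_pow]
      nlinarith
    calc 192 * etaRate 20000000 n v δ / |ellNorm 4 v ^ 4 - 3 / N| *
          (|v j| + √(Real.log (N / δ)) / √(N : ℝ))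
        ≤ 192 * (H * Real.log N ^ 4 * ε) * (2 * Real.log N * |v j| + 2 * Real.log N / √N) := by
          rw [mul_div_assoc]
          gcongr
          nlinarith [abs_nonneg (v j)]
      _ = 384 * H * Real.log N ^ 5 * (ε * (|v j| + 1 / √N)) := by ring
      _ ≤ _ := by
          gcongr
          rw [hK]
          linarith [Real.exp_pos (32 * H)]
  · have hv0 : v ≠ 0 := fun h => (ellNorm_four_pos hv).ne' (by
      have : Fact ((1 : ℝ≥0∞) ≤ 4) := ⟨by norm_num⟩
      rw [h, ellNorm, WithLp.toLp_zero, norm_zero])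
    refine (measure_mono fun ω hω => ?_).trans (hY.measure_not_rowEvents_le hN hn hv0 hδ hδ1 hL1)
    rw [Set.mem_ofPred_eq] at hω ⊢
    refine fun hev => hω fun Q hQ => EntrywiseClose.mul_orthogonal ?_ hQ
    refine (entrywiseClose_of_row_norm_le fun j => ellNorm_row_le_of_rowEvents hn hnN
      (fun i => hY.first_column ω i ⟨0, hn⟩ rfl) hv (by linarith)
      ((le_self_pow₀ hL1 (by norm_num)).trans hL7) hev j).mono fun j => ?_
    have hvj : |v j| ≤ 1 := by
      rw [← hv]
      exact PiLp.norm_apply_le (WithLp.toLp 2 v : PiLp 2 fun _ : Fin N => ℝ) j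
    have hNe : (N : ℝ) ≤ Real.exp (32 * H) := by
      rw [← Real.exp_log hN0]
      exact Real.exp_le_exp.2 hcase.le
    have hK0 : 0 < K := by rw [hK]; positivity
    have hNw : (N : ℝ) * ((√(N : ℝ))⁻¹ * (√(N : ℝ))⁻¹) = 1 := by
      rw [← mul_inv, Real.mul_self_sqrt hN0.le, mul_inv_cancel₀ hN0.ne']
    -- 7 = 7N·N^(-1/2)·N^(-1/2) ≤ 7N ε/√N, and K ≥ 7 exp(32H) ≥ 7N.
    calc 6 + |v j| ≤ 7 * (N * ((√(N : ℝ))⁻¹ * (√(N : ℝ))⁻¹)) := by rw [hNw]; linarith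
      _ = 7 * N * 1 * ((√(N : ℝ))⁻¹ * (0 + 1 / √(N : ℝ))) := by rw [one_div]; ring
      _ ≤ _ := by
          gcongr
          · rw [hK]; linarith
          · exact abs_nonneg _

end asymptotic

/-! ### The theorem. -/

theorem theorem2p2 :
    -- asymptotic form
    (∃ (C₀ C₁ : ℝ) (N₀ : ℕ) (w : ℕ → ℝ), 0 < C₀ ∧ 0 < C₁ ∧ Tendsto w atTop atTop ∧
      ∀ c : ℝ, 0 < c → ∃ K : ℝ, 0 < K ∧
        ∀ (N n : ℕ), N₀ ≤ N → 1 ≤ n → n ≤ N →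
        ∀ v : Fin N → ℝ, ellNorm 2 v = 1 → c / N ≤ |ellNorm 4 v ^ 4 - 3 / N| →
          epsRate n v ≤ 1 / Real.log N ^ C₀ →
        ∀ (Ω : Type*) [MeasurableSpace Ω] (μ : Measure Ω) [IsProbabilityMeasure μ]
          (Y : Ω → Matrix (Fin N) (Fin n) ℝ), IsGaussianBasis μ v Y →
          μ {ω | ¬ ∀ Q ∈ Matrix.orthogonalGroup (Fin n) ℝ, EntrywiseClose (Y ω * Q) v
              (fun j => K * Real.log N ^ C₁ * (epsRate n v * (|v j| + 1 / √(N : ℝ))))}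
            ≤ ENNReal.ofReal ((N : ℝ) ^ (-(w N)))) ∧
    -- precise form
    (∃ (A c C : ℝ) (N₀ : ℕ), 0 < A ∧ 0 < c ∧ 0 < C ∧
      ∀ (N n : ℕ), N₀ ≤ N → 1 ≤ n → n ≤ N →
      ∀ δ : ℝ, 0 < δ → δ < 1 → Real.log (N / δ) ^ 7 ≤ N →
      ∀ v : Fin N → ℝ, ellNorm 4 v ^ 4 ≠ 3 / N →
        etaRate A n v δ / |ellNorm 4 v ^ 4 - 3 / N| ≤ c →
      ∀ (Ω : Type*) [MeasurableSpace Ω] (μ : Measure Ω) [IsProbabilityMeasure μ]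
        (Y : Ω → Matrix (Fin N) (Fin n) ℝ), IsGaussianBasis μ v Y →
        μ {ω | ¬ ∀ Q ∈ Matrix.orthogonalGroup (Fin n) ℝ, EntrywiseClose (Y ω * Q) v
            (fun j => C * etaRate A n v δ / |ellNorm 4 v ^ 4 - 3 / N|
              * (|v j| + √(Real.log (N / δ)) / √(N : ℝ)))}
          ≤ ENNReal.ofReal δ) := by
  refine ⟨?_, 20000000, 1 / 32, 192, 16, by norm_num, by norm_num, by norm_num, ?_⟩
  · obtain ⟨N₀, hN₀⟩ := exists_forall_log_pow_le 14 128
    -- Here ω(N) = log N, so log(N/δ) is of order (log N)². Its square in η gives four powers of log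
    -- N, and its root in the entrywise bound the fifth.
    refine ⟨5, 5, max 16 N₀, fun N => Real.log N, by norm_num, by norm_num,
      Real.tendsto_log_atTop.comp tendsto_natCast_atTop_atTop, fun c hc0 => ?_⟩
    refine ⟨384 * (2560000000 / min c 1) + 7 * Real.exp (32 * (2560000000 / min c 1)), ?_, ?_⟩
    · have : 0 < min c 1 := lt_min hc0 one_pos
      positivity
    · intro N n hN hn hnN v hv hc hε Ω _ μ _ Y hY
      rw [Real.rpow_ofNat] at hε ⊢
      exact hY.measure_not_entrywiseClose_epsRate_le ((le_max_left _ _).trans hN)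
        (hN₀ N ((le_max_right _ _).trans hN)) hn hnN hv hc0 hc hε rfl rfl
  · intro N n hN hn _ δ hδ hδ1 hLN v hlam hη Ω _ μ _ Y hY
    exact hY.measure_not_entrywiseClose_le hN hn hδ hδ1 hLN hlam hη
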